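/- **Setting.** A *Morse matching* on a finite simplicial complex $K$ is an acyclic partial matching $M$ on its face poset (non-empty faces ordered by inclusion): a set of covering pairs $\sigma\prec\tau$ in which each simplex occurs at most once, without cycles $\sigma_1\prec\tau_1\succ\sigma_2\prec\tau_2\succ\cdots\prec\tau_k\succ\sigma_1$ with $k\ge 2$, $(\sigma_i,\tau_i)\in M$ and distinct $\tau_i$. The problem MaxMM asks, for a given finite simplicial complex $K$, for a Morse matching $M$ maximizing the number $m_{\mathrm{MaxMM}}(K,M)$ of matched simplices. An *oriented degree-3 graph* is a finite directed graph $G=(V,E)$ whose underlying undirected graph is simple and in which every vertex has total degree at most $3$. The problem 3OMAS asks, for such a $G$, for an arc set $A\subseteq E$ with $(V,A)$ acyclic maximizing $m_{\mathrm{3OMAS}}(G,A)=|A|$; $\mathrm{OPT}_{\mathrm{minFAS}}(G)$ is the minimum size of an $F\subseteq E$ with $(V,E\setminus F)$ acyclic. $\mathrm{OPT}$ denotes the optimal value of a problem on an instance. **The complex.** Let $\mathcal D$ be the modified dunce hat with vertices $s,t,w,y,z,a,b$ and the $13$ triangles $$swb,\ ast,\ asy,\ asz,\ awt,\ awy,\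 awz,\ sty,\ szb,\ wtz,\ wyb,\ tyb,\ tzb$$ ($39$ simplices; $\omega=sw$ is its only free face, and $\varphi=ty$, $\psi=tz$). Given an oriented degree-3 graph $G$ with a fixed numbering of its arcs, $\mathcal K(G)$ is obtained from disjoint copies $\mathcal D_e$ of $\mathcal D$, one for each arc $e$, by the following identifications at each vertex $v$ of $G$: all $t_e$ with $e$ entering $v$ and all $s_f$ with $f$ leaving $v$ become one vertex; if $f$ is the first arc leaving $v$, then $\varphi_e$ is identified with $\omega_f$ for every arc $e$ entering $v$ (with $t_e=s_f$, $y_e=w_f$); if $f'$ is the second arc leaving $v$, then $\psi_e$ is identified with $\omega_{f'}$ for every arc $e$ entering $v$ (with $t_e=s_{f'}$, $z_e=w_{f'}$). Let $n$ be the number of simplices of $\mathcal K(G)$ and $\beta=\beta_0+\beta_1+\beta_2$ the sum of its Betti numbers over a field $\mathbb F$. For a Morse matching $M$ on $\mathcal K(G)$ let $H_M=(V,E\setminus F)$, where $F$ is the set of the arcs $e$ such that $\mathcal D_e$ contains a triangle not matched by $M$. **Theorem.** Let $\mathbb F$ be any field. For every oriented degree-3 graph $G$ and every Morse matching $M$ on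 $\mathcal K(G)$, $$\mathrm{OPT}_{\mathrm{MaxMM}}(\mathcal K(G))=n-2\,\mathrm{OPT}_{\mathrm{minFAS}}(G)-\beta,\qquad \mathrm{OPT}_{\mathrm{MaxMM}}(\mathcal K(G))\le 78\,\mathrm{OPT}_{\mathrm{3OMAS}}(G),$$ $$\mathrm{OPT}_{\mathrm{3OMAS}}(G)-m_{\mathrm{3OMAS}}(G,H_M)\le \tfrac12\bigl[\mathrm{OPT}_{\mathrm{MaxMM}}(\mathcal K(G))-m_{\mathrm{MaxMM}}(\mathcal K(G),M)\bigr].$$ Moreover the pair $f(G)=\mathcal K(G)$, $g(G,M)=H_M$ is an L-reduction from 3OMAS to MaxMM with parameters $\mu=78$ and $\nu=\tfrac12$. That is: $f$ and $g$ are computable in polynomial time (on a random access machine whose only arithmetic is addition and subtraction, at uniform cost, with graphs, complexes, matchings and arc sets given as lists of numbers, in time polynomial in the total binary length of the input); $H_M$ is acyclic for every Morse matching $M$ on $\mathcal K(G)$; and $$\mathrm{OPT}_{\mathrm{MaxMM}}(f(G))\le\mu\,\mathrm{OPT}_{\mathrm{3OMAS}}(G),$$ $$\mathrm{OPT}_{\mathrm{3OMAS}}(G)-m_{\mathrm{3OMAS}}(G,g(G,M))\le\nu\bigl[\mathrm{OPT}_{\mathrm{MaxMM}}(f(G))-m_{\mathrm{MaxMM}}(f(G),M)\bigr]$$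 for all $G$ and all Morse matchings $M$ on $f(G)$. -/

import Mathlib

open Finset

/-! ### Random access machines and polynomial time -/

namespace RAM

/-- Programs of a random access machine with registers `0, 1, 2, …`, an addressable memory,
a read-only input tape and a write-only output tape.  The only arithmetic is addition and
(truncated) subtraction of natural numbers, so the uniform cost of a run and the running time of
a Turing machine are polynomially related. -/
inductive Prog : Type
  /-- do nothing -/
  | skip : Prog
  /-- `reg x := n` -/
  | const (x n : ℕ) : Prog
  /-- `reg x := reg y + reg z` -/
  | add (x y z : ℕ) : Prog
  /-- `reg x := reg y - reg z`, and `0` if this is negative -/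
  | sub (x y z : ℕ) : Prog
  /-- `reg x := mem (reg y)` -/
  | load (x y : ℕ) : Prog
  /-- `mem (reg x) := reg y` -/
  | store (x y : ℕ) : Prog
  /-- `reg x :=` the next number on the input tape (`0` when the input is exhausted) -/
  | read (x : ℕ) : Prog
  /-- append `reg x` to the output tape -/
  | write (x : ℕ) : Prog
  /-- first `p`, then `q` -/
  | seq (p q : Prog) : Prog
  /-- `p` if `reg x ≠ 0`, otherwise `q` -/
  | ite (x : ℕ) (p q : Prog) : Prog
  /-- repeat `p` as long as `reg x ≠ 0` -/
  | loop (x : ℕ) (p : Prog) : Prog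

/-- A configuration of the machine. -/
structure State where
  reg : ℕ → ℕ
  mem : ℕ → ℕ
  inp : List ℕ
  out : List ℕ

/-- The initial configuration on the input `l`. -/
def init (l : List ℕ) : State := ⟨fun _ => 0, fun _ => 0, l, []⟩

/-- Assignment to a register. -/
def State.set (s : State) (x v : ℕ) : State := { s with reg := Function.update s.reg x v }

/-- `Run p s t s'`: started in `s`, the program `p` halts in `s'` after exactly `t` steps; every
elementary instruction and every test costs one step. -/
inductive Run : Prog → State → ℕ → State → Prop
  | skip (s : State) : Run .skip s 1 s
  | const (s : State) (x n : ℕ) : Run (.const x n) s 1 (s.set x n)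
  | add (s : State) (x y z : ℕ) : Run (.add x y z) s 1 (s.set x (s.reg y + s.reg z))
  | sub (s : State) (x y z : ℕ) : Run (.sub x y z) s 1 (s.set x (s.reg y - s.reg z))
  | load (s : State) (x y : ℕ) : Run (.load x y) s 1 (s.set x (s.mem (s.reg y)))
  | store (s : State) (x y : ℕ) :
      Run (.store x y) s 1 { s with mem := Function.update s.mem (s.reg x) (s.reg y) }
  | read (s : State) (x : ℕ) :
      Run (.read x) s 1 { s.set x (s.inp.headD 0) with inp := s.inp.tail }
  | write (s : State) (x : ℕ) : Run (.write x) s 1 { s with out := s.out ++ [s.reg x] }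
  | seq {p q : Prog} {s s' s'' : State} {t t' : ℕ} :
      Run p s t s' → Run q s' t' s'' → Run (.seq p q) s (t + t') s''
  | ite_true {x : ℕ} {p q : Prog} {s s' : State} {t : ℕ} :
      s.reg x ≠ 0 → Run p s t s' → Run (.ite x p q) s (t + 1) s'
  | ite_false {x : ℕ} {p q : Prog} {s s' : State} {t : ℕ} :
      s.reg x = 0 → Run q s t s' → Run (.ite x p q) s (t + 1) s'
  | loop_done {x : ℕ} {p : Prog} {s : State} :
      s.reg x = 0 → Run (.loop x p) s 1 s
  | loop_step {x : ℕ} {p : Prog} {s s' s'' : State} {t t' : ℕ} :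
      s.reg x ≠ 0 → Run p s t s' → Run (.loop x p) s' t' s'' →
        Run (.loop x p) s (t + t' + 1) s''

/-- The size of a list of numbers written in binary, with a separator after each number. -/
def size (l : List ℕ) : ℕ := (l.map fun a => Nat.size a + 1).sum

/-- A task has a family of inputs `i`; `inp i l` says that the list `l` is a code of `i`, and
`out i l` says that `l` is a code of an answer for `i`.  The task is solvable in polynomial time if
one program turns every code of every `i` into a code of an answer for `i`, in a number of steps
bounded by a polynomial in the size of the given code. -/
def PolyTime {ι : Type} (inp out : ι → List ℕ → Prop) : Prop :=
  ∃ (P : Prog) (p : Polynomial ℕ), ∀ (i : ι) (l : List ℕ), inp i l →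
    ∃ (t : ℕ) (s : State), Run P (init l) t s ∧ t ≤ p.eval (size l) ∧ out i s.out

end RAM

/-! ### Maximization problems and L-reductions -/

/-- A maximization problem with natural number values, together with the codes by which its
instances and solutions are presented to an algorithm. -/
structure MaxProblem where
  Inst : Type
  Sol : Inst → Type
  feasible : ∀ x, Sol x → Prop
  value : ∀ x, Sol x → ℕ
  instCode : Inst → List ℕ → Prop
  solCode : ∀ x, Sol x → List ℕ → Prop
  exists_max : ∀ x, ∃ y, feasible x y ∧ ∀ z, feasible x z → value x z ≤ value x y

/-- The optimal value of an instance. -/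
noncomputable def MaxProblem.opt (A : MaxProblem) (x : A.Inst) : ℕ :=
  sSup {k | ∃ y, A.feasible x y ∧ A.value x y = k}

theorem MaxProblem.isGreatest_opt (A : MaxProblem) (x : A.Inst) :
    IsGreatest {k | ∃ y, A.feasible x y ∧ A.value x y = k} (A.opt x) := by
  obtain ⟨y, hy, hmax⟩ := A.exists_max x
  have h : IsGreatest {k | ∃ y, A.feasible x y ∧ A.value x y = k} (A.value x y) :=
    ⟨⟨y, hy, rfl⟩, by rintro k ⟨z, hz, rfl⟩; exact hmax z hz⟩
  have h2 : A.opt x = A.value x y := h.csSup_eq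
  rw [h2]
  exact h

/-- `(f, g)` is an L-reduction from `A` to `B` with parameters `μ` and `ν`. -/
structure IsLReduction (A B : MaxProblem) (f : A.Inst → B.Inst)
    (g : ∀ x, B.Sol (f x) → A.Sol x) (μ ν : ℝ) : Prop where
  mu_pos : 0 < μ
  nu_pos : 0 < ν
  polyTime_f : RAM.PolyTime A.instCode (fun x => B.instCode (f x))
  polyTime_g : RAM.PolyTime (ι := Σ x, {y : B.Sol (f x) // B.feasible (f x) y})
    (fun i l => ∃ l₁ l₂, A.instCode i.1 l₁ ∧ B.solCode (f i.1) i.2.1 l₂ ∧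
      l = l₁.length :: (l₁ ++ l₂))
    (fun i => A.solCode i.1 (g i.1 i.2.1))
  feasible_g : ∀ x y, B.feasible (f x) y → A.feasible x (g x y)
  opt_le : ∀ x, (B.opt (f x) : ℝ) ≤ μ * A.opt x
  gap_le : ∀ x y, B.feasible (f x) y →
    (A.opt x : ℝ) - A.value x (g x y) ≤ ν * ((B.opt (f x) : ℝ) - B.value (f x) y)

/-! ### Oriented graphs of degree at most three, acyclic subgraphs, feedback arc sets -/

/-- A finite oriented graph with vertex set `Fin n` and arcs numbered by `Fin m`, in which every
vertex has total degree at most three.  Oriented: the underlying undirected graph is simple. -/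
structure DegThreeOrientedGraph where
  n : ℕ
  m : ℕ
  src : Fin m → Fin n
  tgt : Fin m → Fin n
  loopless : ∀ e, src e ≠ tgt e
  simple : ∀ e f, s(src e, tgt e) = s(src f, tgt f) → e = f
  degree_le : ∀ v, #{e | src e = v} + #{e | tgt e = v} ≤ 3

namespace DegThreeOrientedGraph

variable (G : DegThreeOrientedGraph)

/-- The subgraph with all the vertices and the arcs in `A` has no directed cycle. -/
def Acyclic (A : Finset (Fin G.m)) : Prop :=
  ∀ v, ¬ Relation.TransGen (fun u w => ∃ e ∈ A, G.src e = u ∧ G.tgt e = w) v v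

/-- `F` is a feedback arc set. -/
def IsFeedbackArcSet (F : Finset (Fin G.m)) : Prop := G.Acyclic Fᶜ

/-- The minimum cardinality of a feedback arc set. -/
noncomputable def optMinFAS : ℕ := sInf {k | ∃ F, G.IsFeedbackArcSet F ∧ #F = k}

/-- The code of a graph: the number of vertices, the number of arcs, and the list of arcs. -/
def code : List ℕ :=
  G.n :: G.m :: (List.finRange G.m).flatMap fun e => [(G.src e : ℕ), (G.tgt e : ℕ)]

theorem acyclic_empty : G.Acyclic ∅ := by
  intro v h
  obtain ⟨_, ⟨e, he, -⟩, -⟩ := Relation.TransGen.head'_iff.1 h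
  simp at he

end DegThreeOrientedGraph

/-- The maximum acyclic subgraph problem for oriented graphs of degree at most three.  A solution
is a set of arcs, presented by a list of its elements preceded by the length of the list. -/
def OMAS3 : MaxProblem where
  Inst := DegThreeOrientedGraph
  Sol G := Finset (Fin G.m)
  feasible G A := G.Acyclic A
  value _ A := #A
  instCode G l := l = G.code
  solCode G A l := ∃ L : List (Fin G.m), L.toFinset = A ∧ l = L.length :: L.map Fin.val
  exists_max G := by
    classical
    obtain ⟨A, hA, h⟩ := (univ.filter G.Acyclic).exists_max_image (fun A => #A)
      ⟨∅, by simpa using G.acyclic_empty⟩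
    exact ⟨A, by simpa using hA, fun B hB => h B (by simpa using hB)⟩

/-! ### Acyclic matchings on posets -/

/-- `M` is a partial matching in the poset `P`: its pairs are covering pairs `a ⋖ b`, and each
element of `P` belongs to at most one pair. -/
def IsPartialMatching {P : Type*} [PartialOrder P] (M : Finset (P × P)) : Prop :=
  (∀ p ∈ M, p.1 ⋖ p.2) ∧
    ∀ p ∈ M, ∀ q ∈ M, ∀ x, (x = p.1 ∨ x = p.2) → (x = q.1 ∨ x = q.2) → p = q

/-- There is no cycle `a₀ ⋖ b₀ ⋗ a₁ ⋖ b₁ ⋗ ⋯ ⋖ bₙ₋₁ ⋗ a₀` with `n ≥ 2`, all `(aᵢ, bᵢ)` in `M` and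
the `bᵢ` distinct.  (Addition in `Fin (k + 2)` is cyclic.) -/
def IsAcyclicMatching {P : Type*} [PartialOrder P] (M : Finset (P × P)) : Prop :=
  ∀ (k : ℕ) (a b : Fin (k + 2) → P), Function.Injective b →
    ¬ ∀ i, (a i, b i) ∈ M ∧ a (i + 1) ⋖ b i

/-! ### Finite simplicial complexes, Betti numbers, Morse matchings -/

/-- Finite abstract simplicial complexes with vertices labelled by natural numbers. -/
structure FiniteComplex extends PreAbstractSimplicialComplex ℕ where
  finite_faces : faces.Finite

namespace FiniteComplex

/-- The face poset: the non-empty faces, ordered by inclusion. -/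
abbrev Face (K : FiniteComplex) : Type := {σ : Finset ℕ // σ ∈ K.faces}

instance (K : FiniteComplex) : Finite K.Face := K.finite_faces

/-- The number of simplices. -/
noncomputable def numSimplices (K : FiniteComplex) : ℕ := K.faces.ncard

/-- The simplices with `k` vertices, that is, of dimension `k - 1`; there are none for `k = 0`. -/
abbrev Simplex (K : FiniteComplex) (k : ℕ) : Type := {σ : K.Face // #σ.1 = k}

noncomputable instance (K : FiniteComplex) (k : ℕ) : Fintype (K.Simplex k) := Fintype.ofFinite _

/-- The incidence number `[σ : τ]` for the orientations given by the order of the vertices: it is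
`(-1) ^ j` if `τ` arises from `σ` by removing the `j`-th smallest vertex (counted from zero), and
`0` if `τ` is not a facet of `σ`. -/
def incidence (𝔽 : Type*) [Field 𝔽] (τ σ : Finset ℕ) : 𝔽 :=
  ∑ v ∈ σ, if σ.erase v = τ then (-1) ^ #{w ∈ σ | w < v} else 0

/-- The simplicial boundary operator from chains of dimension `i` to chains of dimension `i - 1`;
for `i = 0` its target is the zero space. -/
noncomputable def boundary (𝔽 : Type*) [Field 𝔽] (K : FiniteComplex) (i : ℕ) :
    (K.Simplex (i + 1) → 𝔽) →ₗ[𝔽] (K.Simplex i → 𝔽) :=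
  Matrix.mulVecLin (Matrix.of fun τ σ => incidence 𝔽 τ.1.1 σ.1.1)

/-- The `i`-th Betti number over `𝔽`: the dimension of the space of `i`-cycles modulo
`i`-boundaries. -/
noncomputable def betti (𝔽 : Type*) [Field 𝔽] (K : FiniteComplex) (i : ℕ) : ℕ :=
  Module.finrank 𝔽 ((boundary 𝔽 K i).ker ⧸
    (boundary 𝔽 K (i + 1)).range.comap (boundary 𝔽 K i).ker.subtype)

/-- A Morse matching is an acyclic partial matching on the face poset. -/
def IsMorseMatching (K : FiniteComplex) (M : Finset (K.Face × K.Face)) : Prop :=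
  IsPartialMatching M ∧ IsAcyclicMatching M

/-- The simplices matched by `M`. -/
def matched {K : FiniteComplex} (M : Finset (K.Face × K.Face)) : Finset K.Face :=
  M.image Prod.fst ∪ M.image Prod.snd

/-- A simplex is presented by a list of its vertices without repetition, preceded by the length of
the list. -/
def simplexCode (vs : List ℕ) : List ℕ := vs.length :: vs

/-- `l` presents `K`: it lists all its simplices, preceded by the length of the list. -/
def IsCode (K : FiniteComplex) (l : List ℕ) : Prop :=
  ∃ L : List (List ℕ), (∀ vs ∈ L, vs.Nodup) ∧
    (∀ σ : Finset ℕ, σ ∈ K.faces ↔ ∃ vs ∈ L, vs.toFinset = σ) ∧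
    l = L.length :: L.flatMap simplexCode

/-- `l` presents `M`: it lists all its pairs, preceded by the length of the list. -/
def IsMatchingCode (K : FiniteComplex) (M : Finset (K.Face × K.Face)) (l : List ℕ) : Prop :=
  ∃ L : List (List ℕ × List ℕ), (∀ q ∈ L, q.1.Nodup ∧ q.2.Nodup) ∧
    (∀ σ τ : Finset ℕ, (∃ p ∈ M, p.1.1 = σ ∧ p.2.1 = τ) ↔
      ∃ q ∈ L, q.1.toFinset = σ ∧ q.2.toFinset = τ) ∧
    l = L.length :: L.flatMap fun q => simplexCode q.1 ++ simplexCode q.2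

end FiniteComplex

/-- The max Morse matching problem: find a Morse matching of a given finite simplicial complex with
as many matched simplices as possible. -/
def MaxMM : MaxProblem where
  Inst := FiniteComplex
  Sol K := Finset (K.Face × K.Face)
  feasible K M := K.IsMorseMatching M
  value _ M := #(FiniteComplex.matched M)
  instCode K l := K.IsCode l
  solCode K M l := K.IsMatchingCode M l
  exists_max K := by
    classical
    have := Fintype.ofFinite K.Face
    obtain ⟨A, hA, h⟩ := (univ.filter K.IsMorseMatching).exists_max_image
      (fun M => #(FiniteComplex.matched M))
      ⟨∅, by simp [FiniteComplex.IsMorseMatching, IsPartialMatching, IsAcyclicMatching]⟩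
    exact ⟨A, by simpa using hA, fun B hB => h B (by simpa using hB)⟩

/-! ### The modified dunce hat -/

/-- The seven vertices of the modified dunce hat. -/
inductive DunceVertex : Type
  | s | t | w | y | z | a | b
  deriving DecidableEq

instance : Fintype DunceVertex :=
  ⟨{.s, .t, .w, .y, .z, .a, .b}, fun x => by cases x <;> simp⟩

open DunceVertex in
/-- The thirteen triangles of the modified dunce hat `𝒟`.  Going once around the triangulated
heptagon from which it is glued, one reads `s w a s a w a`: the edges `{a, s}` and `{a, w}` occur
three times and the edge `{s, w}` once.  The distinguished simplices are
`ω = {s, w}` (the only free face), `Γ = {s, w, b}` (the only triangle that contains `ω`),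
`η = {s, t}`, `φ = {t, y}`, `ψ = {t, z}`, and their vertices. -/
def dunceTriangles : Finset (Finset DunceVertex) :=
  {{s, w, b}, {a, s, t}, {a, s, y}, {a, s, z}, {a, w, t}, {a, w, y}, {a, w, z},
    {s, t, y}, {s, z, b}, {w, t, z}, {w, y, b}, {t, y, b}, {t, z, b}}

/-- The modified dunce hat: `7` vertices, `19` edges and `13` triangles. -/
def dunceHat : PreAbstractSimplicialComplex DunceVertex where
  faces := {σ | σ.Nonempty ∧ ∃ τ ∈ dunceTriangles, σ ⊆ τ}
  isRelLowerSet_faces := by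
    rintro σ ⟨hσ, τ, hτ, h⟩
    exact ⟨hσ, fun ρ hρ hne => ⟨hne, τ, hτ, subset_trans hρ h⟩⟩

/-! ### The complex of an oriented graph of degree at most three -/

namespace DegThreeOrientedGraph

variable (G : DegThreeOrientedGraph)

/-- The arcs that leave `v`, in the order of their numbers. -/
def outArcs (v : Fin G.n) : List (Fin G.m) := (List.finRange G.m).filter fun e => G.src e = v

/-- A label for the `k`-th own vertex (`k < 5`) of the copy of the dunce hat at the arc `e`; the
labels below `G.n` are the vertices of `G`. -/
def ownLabel (e : Fin G.m) (k : ℕ) : ℕ := G.n + 5 * (e : ℕ) + k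

/-- The image of a vertex of the copy `𝒟ₑ` at the arc `e : u → v` after the identifications.
The vertices `sₑ` and `tₑ` become the vertices `u` and `v` of `G`.  The edge `φₑ` is identified
with `ω_f` if `f` is the first arc that leaves `v`, and `ψₑ` with `ω_g` if `g` is the second one.
So at a vertex with one incoming arc `e` and two outgoing arcs `f, g` one has `φₑ = ω_f` and
`ψₑ = ω_g`; at a vertex with one outgoing arc `f`, `φₑ = ω_f` for every incoming arc `e`; at a
vertex without incoming or without outgoing arcs only vertices are identified.  (A vertex with an
incoming arc has at most two outgoing ones.) -/
def gluing (e : Fin G.m) : DunceVertex → ℕ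
  | .s => G.src e
  | .t => G.tgt e
  | .w => G.ownLabel e 0
  | .a => G.ownLabel e 1
  | .b => G.ownLabel e 2
  | .y => match (G.outArcs (G.tgt e))[0]? with
    | some f => G.ownLabel f 0
    | none => G.ownLabel e 3
  | .z => match (G.outArcs (G.tgt e))[1]? with
    | some f => G.ownLabel f 0
    | none => G.ownLabel e 4

/-- The image of the copy `𝒟ₑ` of the modified dunce hat after the identifications. -/
def dunceCopy (e : Fin G.m) : PreAbstractSimplicialComplex ℕ := dunceHat.map (G.gluing e)

/-- The complex `𝒦(G)`: one copy of the modified dunce hat for each arc of `G`, glued along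
vertices and edges. -/
def complex : FiniteComplex where
  toPreAbstractSimplicialComplex := ⨆ e, G.dunceCopy e
  finite_faces := by
    have h : (⨆ e, G.dunceCopy e).faces = ⋃ e, (G.dunceCopy e).faces := by
      change (⋃ K ∈ Set.range G.dunceCopy, K.faces) = _
      simp
    rw [h]
    exact Set.finite_iUnion fun e => (Set.toFinite dunceHat.faces).image _

open Classical in
/-- The arcs of the subgraph `H_M` obtained from a matching `M` on `𝒦(G)`: those arcs `e` such
that no triangle of `𝒟ₑ` is critical for `M`. -/
noncomputable def arcsOfMatching (M : Finset (G.complex.Face × G.complex.Face)) :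
    Finset (Fin G.m) :=
  univ.filter fun e => ¬ ∃ σ : G.complex.Face, #σ.1 = 3 ∧ σ.1 ∈ (G.dunceCopy e).faces ∧
    σ ∉ FiniteComplex.matched M

end DegThreeOrientedGraph

/-!
The complex `𝒦(G)` has one copy of the modified dunce hat for each arc, and two copies meet at most
in vertices and in the edges `φ`, `ψ`, `ω`: any other edge has its ends on different sides of the
arc, so a common edge would give two arcs with the same ends (`eq_of_unshared`).  In particular each
triangle belongs to one copy.

*Upper bound.*  Let `M` be a Morse matching.  If all triangles of the copies along a directed cycle
of arcs were matched, then, as each edge of these copies lies in two of the triangles (the free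
edge of a copy is glued to an edge of the preceding one), gradient paths could be continued
backwards forever; hence the arcs without critical triangles form an acyclic subgraph
(`acyclic_arcsOfMatching`).  So at least as many triangles are critical as a feedback arc set has
arcs.  Each component contains a critical vertex (`card_lower_vertices_le`).  The two bounds limit
the numbers of vertex-edge pairs and of edge-triangle pairs, which together are all the pairs of `M`
(`card_add_le_of_isMorseMatching`).

*Construction.*  Given a feedback arc set `F`, collapse each copy from its free edge, avoiding `φ`
and `ψ`, but leave the triangle at the free edge critical for the arcs in `F`.  A gradient path
leaves a copy only towards the copy of a following arc outside `F`, so no path closes up.  The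
remaining graph has the same components as `𝒦(G)`, and a spanning forest of shortest paths matches
all its vertices but one in each component (`exists_isMorseMatching_extending`).

*Betti numbers.*  `β₀` is the number of components (`betti_zero`), and `β₂ = 0` since the
coefficients of a 2-cycle in a copy agree up to sign across the unshared edges and cancel at the
edge `as` (`boundary_two_injective`).  With the Euler relation the optimum takes the stated form
(`opt_MaxMM_eq`).  The factor `78 = 2 * 39` comes from the `39` faces of the dunce hat and from the
acyclic subgraphs of the ascending and of the descending arcs, one of which contains half of the
arcs.

*Running time.*  Programs are verified with a Hoare-style predicate `RAM.Reaches` that includes a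
time bound, a rule for loops over lists, and the direct evaluation of loop-free code.  The memory is
only ever appended to, so its contents are described by a list.  The codes admit repetitions: the
first program writes all faces of all triangles, and the second one looks up each triangle of each
copy among the upper faces of the matching.  The constants in the time bounds are generous.
-/

set_option linter.constructorNameAsVariable false
set_option linter.unusedSimpArgs false

/-! ### The modified dunce hat and its copies -/

/-- The faces of the modified dunce hat as a finite set. -/
def dunceFaces : Finset (Finset DunceVertex) := (dunceTriangles.biUnion powerset).erase ∅

theorem mem_dunceFaces {σ : Finset DunceVertex} : σ ∈ dunceFaces ↔ σ ∈ dunceHat.faces := by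
  simp [dunceFaces, dunceHat, nonempty_iff_ne_empty]

theorem card_dunceFaces : #dunceFaces = 39 := by decide +kernel

theorem card_of_mem_dunceTriangles {τ : Finset DunceVertex} (h : τ ∈ dunceTriangles) : #τ = 3 := by
  revert τ; decide +kernel

theorem mem_dunceFaces_of_mem_dunceTriangles {τ : Finset DunceVertex} (h : τ ∈ dunceTriangles) :
    τ ∈ dunceHat.faces :=
  ⟨card_pos.1 (by rw [card_of_mem_dunceTriangles h]; norm_num), τ, h, Subset.rfl⟩

theorem mem_dunceTriangles_of_card {σ : Finset DunceVertex} (h : σ ∈ dunceHat.faces)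
    (h3 : 3 ≤ #σ) : σ ∈ dunceTriangles := by
  obtain ⟨-, τ, hτ, hs⟩ := h
  rwa [eq_of_subset_of_card_le hs (by rw [card_of_mem_dunceTriangles hτ]; exact h3)]

/-- The end of an arc to which a vertex of its copy of the dunce hat is attached: `s` and `w` may
be shared with copies at the source (`false`), and `t`, `y` and `z` with copies at the target
(`true`), while `a` and `b` belong to this copy only. -/
def DunceVertex.side : DunceVertex → Option Bool
  | s | w => some false
  | t | y | z => some true
  | a | b => none

/-- An edge of the dunce hat none of whose images is shared by two copies. -/
def DunceVertex.Unshared (x y : DunceVertex) : Prop :=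
  x.side = none ∨ y.side = none ∨ x.side ≠ y.side

instance (x y : DunceVertex) : Decidable (x.Unshared y) := by
  unfold DunceVertex.Unshared; infer_instance

theorem exists_unshared_of_mem_dunceTriangles {τ : Finset DunceVertex} (h : τ ∈ dunceTriangles) :
    ∃ x ∈ τ, ∃ y ∈ τ, x.Unshared y := by
  revert τ; decide +kernel

open DunceVertex in
/-- Apart from the free edge `sw`, each edge of the dunce hat lies in at least two triangles. -/
theorem exists_ne_triangle {τ : Finset DunceVertex} (h : τ ∈ dunceTriangles)
    {x : DunceVertex} (hx : x ∈ τ) (hne : τ.erase x ≠ {s, w}) :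
    ∃ τ' ∈ dunceTriangles, τ' ≠ τ ∧ τ.erase x ⊆ τ' := by
  revert x; revert τ; decide +kernel

namespace DegThreeOrientedGraph

variable {G : DegThreeOrientedGraph}

theorem mem_outArcs {v : Fin G.n} {e : Fin G.m} : e ∈ G.outArcs v ↔ G.src e = v := by
  simp [outArcs]

theorem src_of_outArcs_getElem? {v : Fin G.n} {i : ℕ} {f : Fin G.m}
    (h : (G.outArcs v)[i]? = some f) : G.src f = v :=
  mem_outArcs.1 (List.mem_of_getElem? h)

/-- The label of `y` or `z` in the copy at `e`: an own label, or the label of `w` in the copy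
at an arc that leaves the target of `e`. -/
theorem gluing_yz (e : Fin G.m) {x : DunceVertex} (hx : x = .y ∨ x = .z) :
    (∃ f, G.src f = G.tgt e ∧ G.gluing e x = G.ownLabel f 0) ∨
      ∃ k, k < 5 ∧ k ≠ 0 ∧ k ≠ 1 ∧ k ≠ 2 ∧ G.gluing e x = G.ownLabel e k := by
  rcases hx with rfl | rfl
  · rcases h : (G.outArcs (G.tgt e))[0]? with _ | f
    · exact Or.inr ⟨3, by simp [gluing, h]⟩
    · exact Or.inl ⟨f, src_of_outArcs_getElem? h, by simp [gluing, h]⟩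
  · rcases h : (G.outArcs (G.tgt e))[1]? with _ | f
    · exact Or.inr ⟨4, by simp [gluing, h]⟩
    · exact Or.inl ⟨f, src_of_outArcs_getElem? h, by simp [gluing, h]⟩

theorem ownLabel_inj {e f : Fin G.m} {k l : ℕ} (hk : k < 5) (hl : l < 5)
    (h : G.ownLabel e k = G.ownLabel f l) : e = f ∧ k = l := by
  simp only [ownLabel] at h
  exact ⟨Fin.ext (by omega), by omega⟩

theorem ownLabel_ne_vertex {e : Fin G.m} {k : ℕ} {v : Fin G.n} : G.ownLabel e k ≠ v := by
  have := v.2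
  simp only [ownLabel]; omega

theorem gluing_y_ne_gluing_z (e : Fin G.m) : G.gluing e .y ≠ G.gluing e .z := by
  have hnd : (G.outArcs (G.tgt e)).Nodup := (List.nodup_finRange _).filter _
  intro h
  simp only [gluing] at h
  rcases h0 : (G.outArcs (G.tgt e))[0]? with _ | f <;>
    rcases h1 : (G.outArcs (G.tgt e))[1]? with _ | g <;> simp only [h0, h1] at h <;>
    have := ownLabel_inj (by norm_num) (by norm_num) h
  · simp at this
  · simp at this
  · simp at this
  · obtain ⟨rfl, -⟩ := this
    have := (List.getElem?_inj (List.getElem?_eq_some_iff.1 h0).1 hnd).1 (h0.trans h1.symm)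
    simp at this

theorem gluing_injective (e : Fin G.m) : Function.Injective (G.gluing e) := by
  have hst : (G.src e : ℕ) ≠ G.tgt e := fun h => G.loopless e (Fin.ext h)
  have key : ∀ x, x = .y ∨ x = .z → ∀ y, y ≠ .y → y ≠ .z → G.gluing e x ≠ G.gluing e y := by
    intro x hx y hy hz h
    rcases gluing_yz e hx with ⟨f, hf, hfe⟩ | ⟨k, hk, hk0, hk1, hk2, hke⟩
    · rw [hfe] at h
      cases y <;> simp only [gluing, ne_eq, not_true_eq_false] at h hy hz
      · exact ownLabel_ne_vertex h
      · exact ownLabel_ne_vertex h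
      · obtain ⟨rfl, -⟩ := ownLabel_inj (by norm_num) (by norm_num) h
        exact G.loopless _ hf
      · simpa using ownLabel_inj (by norm_num) (by norm_num) h
      · simpa using ownLabel_inj (by norm_num) (by norm_num) h
    · rw [hke] at h
      cases y <;> simp only [gluing, ne_eq, not_true_eq_false] at h hy hz
      · exact ownLabel_ne_vertex h
      · exact ownLabel_ne_vertex h
      all_goals exact absurd (ownLabel_inj hk (by norm_num) h).2 (by assumption)
  intro x y h
  by_contra hxy
  by_cases hx : x = .y ∨ x = .z
  · by_cases hy : y = .y ∨ y = .z
    · rcases hx with rfl | rfl <;> rcases hy with rfl | rfl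
      · exact hxy rfl
      · exact gluing_y_ne_gluing_z e h
      · exact gluing_y_ne_gluing_z e h.symm
      · exact hxy rfl
    · push Not at hy
      exact key x hx y hy.1 hy.2 h
  · by_cases hy : y = .y ∨ y = .z
    · push Not at hx
      exact key y hy x hx.1 hx.2 h.symm
    · push Not at hx hy
      have h1 := (G.src e).2
      have h2 := (G.tgt e).2
      cases x <;> cases y <;>
        first
        | exact hxy rfl
        | exact hx.1 rfl
        | exact hx.2 rfl
        | exact hy.1 rfl
        | exact hy.2 rfl
        | (simp only [gluing, ownLabel] at h; omega)

/-- The end of an arc on the given side. -/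
def endOf (G : DegThreeOrientedGraph) (e : Fin G.m) : Bool → Fin G.n
  | false => G.src e
  | true => G.tgt e

/-- A vertex shared by the copies at two different arcs lies on a side, and the end on this side is
an end of the other arc too. -/
theorem side_of_gluing_eq {e e' : Fin G.m} (hne : e ≠ e') {x x' : DunceVertex}
    (h : G.gluing e x = G.gluing e' x') :
    ∃ i, x.side = some i ∧ ∃ j, G.endOf e i = G.endOf e' j := by
  have hs : ∀ v : Fin G.n, (v : ℕ) = G.gluing e' x' → ∃ j, v = G.endOf e' j := by
    intro v hv
    by_cases hx : x' = .y ∨ x' = .z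
    · rcases gluing_yz e' hx with ⟨f, -, hfe⟩ | ⟨k, -, -, -, -, hfe⟩ <;> rw [hfe] at hv <;>
        exact absurd hv.symm ownLabel_ne_vertex
    · cases x' <;> simp only [gluing] at hv
      · exact ⟨false, Fin.ext hv⟩
      · exact ⟨true, Fin.ext hv⟩
      · exact absurd hv.symm ownLabel_ne_vertex
      · simp at hx
      · simp at hx
      · exact absurd hv.symm ownLabel_ne_vertex
      · exact absurd hv.symm ownLabel_ne_vertex
  have hw : ∀ f, G.ownLabel f 0 = G.gluing e' x' → ∃ j, G.src f = G.endOf e' j := by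
    intro f hf
    by_cases hx : x' = .y ∨ x' = .z
    · rcases gluing_yz e' hx with ⟨g, hg, hge⟩ | ⟨k, hk, hk0, -, -, hge⟩ <;> rw [hge] at hf
      · obtain ⟨rfl, -⟩ := ownLabel_inj (by norm_num) (by norm_num) hf
        exact ⟨true, hg⟩
      · exact absurd (ownLabel_inj (by norm_num) hk hf).2.symm hk0
    · cases x' <;> simp only [gluing] at hf
      · exact absurd hf ownLabel_ne_vertex
      · exact absurd hf ownLabel_ne_vertex
      · exact ⟨false, by rw [(ownLabel_inj (by norm_num) (by norm_num) hf).1]; rfl⟩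
      · simp at hx
      · simp at hx
      all_goals simpa using ownLabel_inj (by norm_num) (by norm_num) hf
  have ho : ∀ k, k < 5 → k ≠ 0 → G.ownLabel e k ≠ G.gluing e' x' := by
    intro k hk hk0 hf
    by_cases hx : x' = .y ∨ x' = .z
    · rcases gluing_yz e' hx with ⟨g, hg, hge⟩ | ⟨l, hl, hl0, -, -, hge⟩ <;> rw [hge] at hf
      · exact hk0 (ownLabel_inj hk (by norm_num) hf).2
      · exact hne (ownLabel_inj hk hl hf).1
    · cases x' <;> simp only [gluing] at hf
      · exact absurd hf ownLabel_ne_vertex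
      · exact absurd hf ownLabel_ne_vertex
      · exact hk0 (ownLabel_inj hk (by norm_num) hf).2
      · simp at hx
      · simp at hx
      all_goals exact hne (ownLabel_inj hk (by norm_num) hf).1
  by_cases hx : x = .y ∨ x = .z
  · have hside : x.side = some true := by rcases hx with rfl | rfl <;> rfl
    refine ⟨true, hside, ?_⟩
    rcases gluing_yz e hx with ⟨f, hf, hfe⟩ | ⟨k, hk, hk0, -, -, hke⟩
    · obtain ⟨j, hj⟩ := hw f (hfe.symm.trans h)
      exact ⟨j, hf.symm.trans hj⟩
    · exact absurd (hke.symm.trans h) (ho k hk hk0)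
  · cases x <;> simp only [gluing] at h
    · exact ⟨false, rfl, hs _ h⟩
    · exact ⟨true, rfl, hs _ h⟩
    · exact ⟨false, rfl, hw _ h⟩
    · simp at hx
    · simp at hx
    · exact absurd h (ho 1 (by norm_num) (by norm_num))
    · exact absurd h (ho 2 (by norm_num) (by norm_num))

/-- The two ends of an unshared edge do not both occur in another copy: otherwise two arcs would
have the same ends. -/
theorem eq_of_unshared {e e' : Fin G.m} {x y x' y' : DunceVertex} (hu : x.Unshared y)
    (hx : G.gluing e x = G.gluing e' x') (hy : G.gluing e y = G.gluing e' y') : e = e' := by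
  by_contra hne
  obtain ⟨i, hi, i', hi'⟩ := side_of_gluing_eq hne hx
  obtain ⟨j, hj, j', hj'⟩ := side_of_gluing_eq hne hy
  have hij : i ≠ j := by
    rintro rfl
    simp [DunceVertex.Unshared, hi, hj] at hu
  apply hne
  apply G.simple
  have h1 := G.loopless e
  cases i <;> cases j <;> cases i' <;> cases j' <;> simp_all [endOf]

/-- The image of a set of vertices of the dunce hat in the copy at `e`. -/
def glued (G : DegThreeOrientedGraph) (e : Fin G.m) (ρ : Finset DunceVertex) : Finset ℕ :=
  ρ.image (G.gluing e)

theorem glued_injective (e : Fin G.m) : Function.Injective (G.glued e) :=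
  Finset.image_injective (gluing_injective e)

theorem card_glued (e : Fin G.m) (ρ : Finset DunceVertex) : #(G.glued e ρ) = #ρ :=
  card_image_of_injective _ (gluing_injective e)

theorem glued_subset_glued {e : Fin G.m} {ρ τ : Finset DunceVertex} :
    G.glued e ρ ⊆ G.glued e τ ↔ ρ ⊆ τ :=
  image_subset_image_iff (gluing_injective e)

theorem mem_dunceCopy {e : Fin G.m} {σ : Finset ℕ} :
    σ ∈ (G.dunceCopy e).faces ↔ ∃ ρ ∈ dunceHat.faces, G.glued e ρ = σ := Iff.rfl

theorem mem_complex {σ : Finset ℕ} :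
    σ ∈ G.complex.faces ↔ ∃ e, ∃ ρ ∈ dunceHat.faces, G.glued e ρ = σ := by
  have h : (⨆ e, G.dunceCopy e).faces = ⋃ e, (G.dunceCopy e).faces := by
    change (⋃ K ∈ Set.range G.dunceCopy, K.faces) = _
    simp
  change σ ∈ (⨆ e, G.dunceCopy e).faces ↔ _
  rw [h, Set.mem_iUnion]
  rfl

theorem glued_mem_complex (e : Fin G.m) {τ : Finset DunceVertex} (h : τ ∈ dunceTriangles) :
    G.glued e τ ∈ G.complex.faces :=
  mem_complex.2 ⟨e, τ, mem_dunceFaces_of_mem_dunceTriangles h, rfl⟩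

theorem eq_of_unshared_subset {e e' : Fin G.m} {x y : DunceVertex} (hu : x.Unshared y)
    {τ : Finset DunceVertex} (h : G.glued e {x, y} ⊆ G.glued e' τ) : e = e' := by
  simp only [glued, image_insert, image_singleton, insert_subset_iff, singleton_subset_iff,
    mem_image] at h
  obtain ⟨⟨x', -, hx⟩, y', -, hy⟩ := h
  exact eq_of_unshared hu hx.symm hy.symm

/-- A triangle of the complex belongs to a single copy. -/
theorem glued_triangle_inj {e e' : Fin G.m} {τ ρ : Finset DunceVertex} (h : τ ∈ dunceTriangles)
    (he : G.glued e τ ⊆ G.glued e' ρ) : e = e' := by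
  obtain ⟨x, hx, y, hy, hu⟩ := exists_unshared_of_mem_dunceTriangles h
  refine eq_of_unshared_subset hu (subset_trans (glued_subset_glued.2 ?_) he)
  simp [insert_subset_iff, hx, hy]

theorem exists_triangle_of_card {σ : Finset ℕ} (h : σ ∈ G.complex.faces) (h3 : 3 ≤ #σ) :
    ∃ e, ∃ τ ∈ dunceTriangles, G.glued e τ = σ := by
  obtain ⟨e, ρ, hρ, rfl⟩ := mem_complex.1 h
  exact ⟨e, ρ, mem_dunceTriangles_of_card hρ (by rwa [card_glued] at h3), rfl⟩

theorem card_le_three {σ : Finset ℕ} (h : σ ∈ G.complex.faces) : #σ ≤ 3 := by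
  by_contra h3
  push Not at h3
  obtain ⟨e, τ, hτ, rfl⟩ := exists_triangle_of_card h h3.le
  rw [card_glued, card_of_mem_dunceTriangles hτ] at h3
  omega

/-- At most two arcs leave the target of an arc. -/
theorem length_outArcs_le (e : Fin G.m) : (G.outArcs (G.tgt e)).length ≤ 2 := by
  have h1 : #{f | G.src f = G.tgt e} = (G.outArcs (G.tgt e)).length := by
    rw [← List.toFinset_card_of_nodup (l := G.outArcs (G.tgt e))
      ((List.nodup_finRange _).filter _)]
    congr 1
    ext f
    simp [mem_outArcs]
  have h2 : 0 < #{f | G.tgt f = G.tgt e} := card_pos.2 ⟨e, by simp⟩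
  have := G.degree_le (G.tgt e)
  omega

open DunceVertex in
/-- If `f` continues `e`, then the free edge of the copy at `f` is glued to `ty` or `tz` in the
copy at `e`, and so lies in a triangle of that copy. -/
theorem exists_triangle_of_tgt_eq_src {e f : Fin G.m} (h : G.tgt e = G.src f) :
    ∃ τ ∈ dunceTriangles, G.glued f {s, w} ⊆ G.glued e τ := by
  have hmem : f ∈ G.outArcs (G.tgt e) := mem_outArcs.2 h.symm
  obtain ⟨i, hi, hfi⟩ := List.mem_iff_getElem.1 hmem
  have hlen := length_outArcs_le e
  have hi2 : i = 0 ∨ i = 1 := by omega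
  have hs : G.gluing f s = G.gluing e t := by simp [gluing, h]
  rcases hi2 with rfl | rfl
  · refine ⟨{s, t, y}, by decide, ?_⟩
    have hw : G.gluing f w = G.gluing e y := by
      simp [gluing, List.getElem?_eq_getElem hi, hfi]
    simp [glued, hs, hw]
  · refine ⟨{w, t, z}, by decide, ?_⟩
    have hw : G.gluing f w = G.gluing e z := by
      simp [gluing, List.getElem?_eq_getElem hi, hfi]
    simp [glued, hs, hw]

theorem numSimplices_le (G : DegThreeOrientedGraph) : G.complex.numSimplices ≤ 39 * G.m := by
  classical
  have h : G.complex.faces ⊆ ((univ : Finset (Fin G.m)).biUnion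
      fun e => dunceFaces.image (G.glued e) : Finset (Finset ℕ)) := by
    intro σ hσ
    obtain ⟨e, ρ, hρ, rfl⟩ := mem_complex.1 hσ
    simp only [coe_biUnion, Set.mem_iUnion, coe_image]
    exact ⟨e, by simp, ρ, by simpa [mem_dunceFaces] using hρ, rfl⟩
  refine (Set.ncard_le_ncard h (finite_toSet _)).trans ?_
  rw [Set.ncard_coe_finset]
  refine (card_biUnion_le_card_mul _ _ 39 fun e _ => ?_).trans ?_
  · exact card_image_le.trans card_dunceFaces.le
  · simp [mul_comm]

end DegThreeOrientedGraph

/-! ### Cycles of acyclic matchings -/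

/-- A fixed-point-free self-map of a finite type has a periodic orbit with at least two elements. -/
theorem exists_cycle_of_forall_ne {α : Type*} [Finite α] [Nonempty α] (f : α → α)
    (hf : ∀ x, f x ≠ x) :
    ∃ (k : ℕ) (c : Fin (k + 2) → α), Function.Injective c ∧ ∀ i, c (i + 1) = f (c i) := by
  obtain ⟨x, hx⟩ : ∃ x, x ∈ Function.periodicPts f := by
    obtain ⟨x0⟩ := ‹Nonempty α›
    obtain ⟨i, j, hij, h⟩ := Finite.exists_ne_map_eq_of_infinite fun n : ℕ => f^[n] x0
    wlog hlt : i < j generalizing i j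
    · exact this j i hij.symm h.symm (by omega)
    refine ⟨f^[i] x0, Function.mk_mem_periodicPts (n := j - i) (by omega) ?_⟩
    rw [Function.IsPeriodicPt, Function.IsFixedPt, ← Function.iterate_add_apply,
      Nat.sub_add_cancel hlt.le]
    exact h.symm
  have hp := Function.minimalPeriod_pos_of_mem_periodicPts hx
  have h1 : Function.minimalPeriod f x ≠ 1 := fun h =>
    hf x (Function.minimalPeriod_eq_one_iff_isFixedPt.1 h)
  obtain ⟨k, hk⟩ : ∃ k, Function.minimalPeriod f x = k + 2 :=
    ⟨Function.minimalPeriod f x - 2, by omega⟩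
  refine ⟨k, fun i => f^[i] x, fun i j hij => ?_, fun i => ?_⟩
  · have := Function.iterate_injOn_Iio_minimalPeriod (f := f) (x := x)
      (by simp [hk]) (by simp [hk]) hij
    exact Fin.ext this
  · have : ((i + 1 : Fin (k + 2)) : ℕ) = (i + 1) % (k + 2) := by
      rw [Fin.val_add]; simp
    have h2 := Function.iterate_mod_minimalPeriod_eq (f := f) (x := x) (n := (i : ℕ) + 1)
    rw [hk, Function.iterate_succ_apply'] at h2
    simp only [this, h2]

section Poset

variable {P : Type*} [PartialOrder P] {M : Finset (P × P)}

theorem IsPartialMatching.eq_of_snd_eq (hM : IsPartialMatching M) {p q : P × P} (hp : p ∈ M)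
    (hq : q ∈ M) (h : p.2 = q.2) : p = q :=
  hM.2 p hp q hq p.2 (Or.inr rfl) (Or.inr h)

theorem IsPartialMatching.eq_of_fst_eq (hM : IsPartialMatching M) {p q : P × P} (hp : p ∈ M)
    (hq : q ∈ M) (h : p.1 = q.1) : p = q :=
  hM.2 p hp q hq p.1 (Or.inl rfl) (Or.inl h)

/-- A matching along which a potential increases is acyclic. -/
theorem isAcyclicMatching_of_potential (h : P × P → ℕ)
    (hh : ∀ p ∈ M, ∀ q ∈ M, p ≠ q → q.1 ⋖ p.2 → h p < h q) : IsAcyclicMatching M := by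
  intro k a b hb hc
  obtain ⟨i, hi⟩ := Finite.exists_max fun i => h (a i, b i)
  have hne : (a i, b i) ≠ (a (i + 1), b (i + 1)) := by
    intro he
    have := hb (congrArg Prod.snd he)
    simp at this
  exact absurd (hi (i + 1)) (not_le.2 (hh _ (hc i).1 _ (hc (i + 1)).1 hne (hc i).2))

theorem IsAcyclicMatching.exists_no_successor (hA : IsAcyclicMatching M)
    (hM : IsPartialMatching M) {S : Set (P × P)} (hS : S ⊆ M) (hne : S.Nonempty) :
    ∃ p ∈ S, ∀ q ∈ S, q ≠ p → ¬ q.1 ⋖ p.2 := by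
  by_contra! hcon
  have : Finite S := M.finite_toSet.subset hS
  have : Nonempty S := hne.to_subtype
  choose! f hfS hfne hf using hcon
  obtain ⟨k, c, hc, hcf⟩ := exists_cycle_of_forall_ne (fun p : S => (⟨f p.1, hfS _ p.2⟩ : S))
    fun p h => hfne _ p.2 (congrArg Subtype.val h)
  refine hA k (fun i => (c i).1.1) (fun i => (c i).1.2) (fun i j hij => hc (Subtype.ext
    (hM.eq_of_snd_eq (hS (c i).2) (hS (c j).2) hij))) fun i => ⟨hS (c i).2, ?_⟩
  simp only [hcf]
  exact hf _ (c i).2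

theorem IsAcyclicMatching.exists_no_predecessor (hA : IsAcyclicMatching M)
    (hM : IsPartialMatching M) {S : Set (P × P)} (hS : S ⊆ M) (hne : S.Nonempty) :
    ∃ p ∈ S, ∀ q ∈ S, q ≠ p → ¬ p.1 ⋖ q.2 := by
  by_contra! hcon
  have : Finite S := M.finite_toSet.subset hS
  have : Nonempty S := hne.to_subtype
  choose! f hfS hfne hf using hcon
  obtain ⟨k, c, hc, hcf⟩ := exists_cycle_of_forall_ne (fun p : S => (⟨f p.1, hfS _ p.2⟩ : S))
    fun p h => hfne _ p.2 (congrArg Subtype.val h)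
  -- The orbit runs against the direction of the forbidden cycles, hence the sign.
  refine hA k (fun i => (c (-i)).1.1) (fun i => (c (-i)).1.2) (fun i j hij => neg_injective
    (hc (Subtype.ext (hM.eq_of_snd_eq (hS (c _).2) (hS (c _).2) hij)))) fun i => ⟨hS (c _).2, ?_⟩
  have h := hcf (-(i + 1))
  rw [show -(i + 1) + 1 = -i by abel] at h
  have h2 := hf _ (c (-(i + 1))).2
  rw [h]
  exact h2

end Poset

namespace FiniteComplex

variable {K : FiniteComplex}

theorem face_nonempty (σ : K.Face) : σ.1.Nonempty := (K.isRelLowerSet_faces σ.2).1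

theorem mem_faces_of_subset {σ τ : Finset ℕ} (hσ : σ ∈ K.faces) (h : τ ⊆ σ) (hne : τ.Nonempty) :
    τ ∈ K.faces := (K.isRelLowerSet_faces hσ).2 h hne

theorem face_covBy_iff {σ τ : K.Face} : σ ⋖ τ ↔ σ.1 ⊆ τ.1 ∧ #τ.1 = #σ.1 + 1 := by
  constructor
  · rintro ⟨hlt, hcov⟩
    have hss : σ.1 ⊂ τ.1 := hlt
    refine ⟨hss.1, ?_⟩
    obtain ⟨x, hx, hxσ⟩ := exists_of_ssubset hss
    by_contra hne
    have hlt1 := card_lt_card hss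
    have hsub : insert x σ.1 ⊆ τ.1 := insert_subset hx hss.1
    have hmem : insert x σ.1 ∈ K.faces := mem_faces_of_subset τ.2 hsub ⟨x, by simp⟩
    have h1 : σ < ⟨insert x σ.1, hmem⟩ := (ssubset_insert hxσ : σ.1 ⊂ insert x σ.1)
    refine hcov h1 (ssubset_of_subset_of_ne hsub fun h => hne ?_ : insert x σ.1 ⊂ τ.1)
    rw [← h, card_insert_of_notMem hxσ]
  · rintro ⟨hs, hc⟩
    refine ⟨(ssubset_of_subset_of_ne hs fun h => by rw [h] at hc; omega : σ.1 ⊂ τ.1), ?_⟩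
    intro ρ h1 h2
    have h1 := card_lt_card (show σ.1 ⊂ ρ.1 from h1)
    have h2 := card_lt_card (show ρ.1 ⊂ τ.1 from h2)
    omega

variable {M : Finset (K.Face × K.Face)}

theorem IsMorseMatching.card_snd (hM : K.IsMorseMatching M) {p : K.Face × K.Face} (hp : p ∈ M) :
    #p.2.1 = #p.1.1 + 1 := (face_covBy_iff.1 (hM.1.1 p hp)).2

theorem IsMorseMatching.fst_subset_snd (hM : K.IsMorseMatching M) {p : K.Face × K.Face}
    (hp : p ∈ M) : p.1.1 ⊆ p.2.1 := (face_covBy_iff.1 (hM.1.1 p hp)).1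

theorem mem_matched {σ : K.Face} : σ ∈ matched M ↔ ∃ p ∈ M, p.1 = σ ∨ p.2 = σ := by
  simp only [matched, mem_union, mem_image]
  constructor
  · rintro (⟨p, hp, h⟩ | ⟨p, hp, h⟩)
    · exact ⟨p, hp, Or.inl h⟩
    · exact ⟨p, hp, Or.inr h⟩
  · rintro ⟨p, hp, h | h⟩
    · exact Or.inl ⟨p, hp, h⟩
    · exact Or.inr ⟨p, hp, h⟩

/-- Each pair of a Morse matching accounts for two matched simplices. -/
theorem IsMorseMatching.card_matched (hM : K.IsMorseMatching M) : #(matched M) = 2 * #M := by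
  rw [matched, card_union_of_disjoint, card_image_of_injOn, card_image_of_injOn, two_mul]
  · exact fun p hp q hq h => hM.1.eq_of_snd_eq hp hq h
  · exact fun p hp q hq h => hM.1.eq_of_fst_eq hp hq h
  · rw [disjoint_left]
    intro σ h1 h2
    obtain ⟨p, hp, rfl⟩ := mem_image.1 h1
    obtain ⟨q, hq, h⟩ := mem_image.1 h2
    obtain rfl := hM.1.2 p hp q hq p.1 (Or.inl rfl) (Or.inr h.symm)
    have := hM.card_snd hp
    rw [h] at this
    omega

/-- A non-empty set of upper faces of a Morse matching contains one whose partner is a facet of no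
other member of the set. -/
theorem IsMorseMatching.exists_free (hM : K.IsMorseMatching M) {S : Set K.Face}
    (hne : S.Nonempty) (hS : ∀ τ ∈ S, ∃ σ, (σ, τ) ∈ M) :
    ∃ σ, ∃ τ ∈ S, (σ, τ) ∈ M ∧ ∀ τ' ∈ S, σ ⋖ τ' → τ' = τ := by
  obtain ⟨τ, hτ⟩ := hne
  obtain ⟨σ, hσ⟩ := hS τ hτ
  obtain ⟨p, ⟨hp, hpS⟩, h⟩ := hM.2.exists_no_predecessor hM.1 (S := {p | p ∈ M ∧ p.2 ∈ S})
    (fun p hp => hp.1) ⟨(σ, τ), hσ, hτ⟩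
  refine ⟨p.1, p.2, hpS, hp, fun τ' hτ' hcov => ?_⟩
  obtain ⟨σ', hσ'⟩ := hS τ' hτ'
  by_contra hne
  exact h (σ', τ') ⟨hσ', hτ'⟩ (fun he => hne (congrArg Prod.snd he)) hcov

end FiniteComplex

/-! ### The subgraph of a Morse matching is acyclic -/

namespace DegThreeOrientedGraph

variable {G : DegThreeOrientedGraph} {M : Finset (G.complex.Face × G.complex.Face)}

/-- The image of a triangle of the dunce hat, as a face of the complex. -/
def triangle (G : DegThreeOrientedGraph) (e : Fin G.m) (τ : dunceTriangles) : G.complex.Face :=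
  ⟨G.glued e τ.1, glued_mem_complex e τ.2⟩

theorem card_triangle (e : Fin G.m) (τ : dunceTriangles) : #(G.triangle e τ).1 = 3 := by
  rw [triangle, card_glued, card_of_mem_dunceTriangles τ.2]

theorem triangle_inj {e e' : Fin G.m} {τ τ' : dunceTriangles} :
    G.triangle e τ = G.triangle e' τ' ↔ e = e' ∧ τ = τ' := by
  constructor
  · intro h
    have h := congrArg Subtype.val h
    obtain rfl := glued_triangle_inj τ.2 h.subset
    exact ⟨rfl, Subtype.ext (glued_injective e h)⟩
  · rintro ⟨rfl, rfl⟩; rfl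

theorem exists_eq_triangle {σ : G.complex.Face} (h : 3 ≤ #σ.1) : ∃ e τ, σ = G.triangle e τ := by
  obtain ⟨e, τ, hτ, h⟩ := exists_triangle_of_card σ.2 h
  exact ⟨e, ⟨τ, hτ⟩, Subtype.ext h.symm⟩

theorem exists_mem_of_triangle_matched (hM : G.complex.IsMorseMatching M) {e : Fin G.m}
    {τ : dunceTriangles} (h : G.triangle e τ ∈ FiniteComplex.matched M) :
    ∃ σ, (σ, G.triangle e τ) ∈ M := by
  obtain ⟨p, hp, h | h⟩ := FiniteComplex.mem_matched.1 h
  · have h1 := hM.card_snd hp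
    have h2 := card_le_three p.2.2
    rw [h, card_triangle] at h1
    omega
  · exact ⟨p.1, by rw [← h]; exact hp⟩

theorem mem_arcsOfMatching {e : Fin G.m} :
    e ∈ G.arcsOfMatching M ↔ ∀ τ, G.triangle e τ ∈ FiniteComplex.matched M := by
  simp only [arcsOfMatching, mem_filter, mem_univ, true_and, not_exists, not_and, not_not]
  constructor
  · exact fun h τ => h _ (card_triangle e τ) (mem_dunceCopy.2
      ⟨τ.1, mem_dunceFaces_of_mem_dunceTriangles τ.2, rfl⟩)
  · intro h σ h3 hσ
    obtain ⟨ρ, hρ, hσ⟩ := mem_dunceCopy.1 hσ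
    have hρ3 : 3 ≤ #ρ := by rw [← card_glued e, hσ, h3]
    have : σ = G.triangle e ⟨ρ, mem_dunceTriangles_of_card hρ hρ3⟩ := Subtype.ext hσ.symm
    rw [this]
    exact h _

open DunceVertex in
/-- Around a directed cycle of `H_M`, each edge of a triangle lies in another triangle, since the
free edge of each copy is glued to an edge of the previous one. -/
theorem acyclic_arcsOfMatching (hM : G.complex.IsMorseMatching M) :
    G.Acyclic (G.arcsOfMatching M) := by
  intro v hv
  set R := fun u w => ∃ e ∈ G.arcsOfMatching M, G.src e = u ∧ G.tgt e = w with hR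
  let S : Set G.complex.Face := {σ | ∃ e ∈ G.arcsOfMatching M,
    Relation.TransGen R v (G.src e) ∧ ∃ τ, σ = G.triangle e τ}
  have hne : S.Nonempty := by
    obtain ⟨_, ⟨e, he, rfl, -⟩, -⟩ := Relation.TransGen.head'_iff.1 hv
    exact ⟨G.triangle e ⟨{s, w, b}, by decide⟩, e, he, hv, _, rfl⟩
  obtain ⟨σ, τ, ⟨e, he, hve, ⟨ρ, rfl⟩⟩, hστ, huniq⟩ := hM.exists_free hne (by
    rintro _ ⟨e, he, -, τ, rfl⟩
    exact exists_mem_of_triangle_matched hM (mem_arcsOfMatching.1 he τ))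
  obtain ⟨hss, hcard⟩ := FiniteComplex.face_covBy_iff.1 (hM.1.1 _ hστ)
  simp only [card_triangle] at hcard
  obtain ⟨ρ', hρ', hσ⟩ : ∃ ρ' ⊆ ρ.1, G.glued e ρ' = σ.1 := by
    obtain ⟨ρ', hρ', h⟩ := subset_image_iff.1 hss
    exact ⟨ρ', hρ', h⟩
  have hρ'c : #ρ' = 2 := by rw [← card_glued e, hσ]; omega
  obtain ⟨x, hx⟩ : ∃ x, ρ.1 \ ρ' = {x} := by
    rw [← card_eq_one, card_sdiff_of_subset hρ', hρ'c, card_of_mem_dunceTriangles ρ.2]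
  have hxρ : x ∈ ρ.1 := (mem_sdiff.1 (hx ▸ mem_singleton_self x)).1
  have hρ'e : ρ' = ρ.1.erase x := by
    rw [← sdiff_singleton_eq_erase, ← hx, Finset.sdiff_sdiff_eq_self hρ']
  have hcov : ∀ f τ', σ.1 ⊆ (G.triangle f τ').1 → σ ⋖ G.triangle f τ' := fun f τ' h =>
    FiniteComplex.face_covBy_iff.2 ⟨h, by rw [card_triangle]; omega⟩
  by_cases hsw : ρ.1.erase x = {s, w}
  · obtain ⟨u, hvu, f, hf, hfu, hfe⟩ := Relation.TransGen.tail'_iff.1 hve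
    obtain ⟨τ', hτ', hsub⟩ := exists_triangle_of_tgt_eq_src hfe
    have hvf : Relation.TransGen R v (G.src f) := by
      rw [hfu]
      rcases Relation.reflTransGen_iff_eq_or_transGen.1 hvu with rfl | h
      · exact hv
      · exact h
    have := huniq (G.triangle f ⟨τ', hτ'⟩) ⟨f, hf, hvf, _, rfl⟩
      (hcov _ _ (by rw [← hσ, hρ'e, hsw]; exact hsub))
    exact G.loopless e ((triangle_inj.1 this).1 ▸ hfe).symm
  · obtain ⟨τ', hτ', hne', hsub⟩ := exists_ne_triangle ρ.2 hxρ hsw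
    have := huniq (G.triangle e ⟨τ', hτ'⟩) ⟨e, he, hve, _, rfl⟩
      (hcov _ _ (by rw [← hσ, hρ'e]; exact glued_subset_glued.2 hsub))
    exact hne' (congrArg Subtype.val (triangle_inj.1 this).2)

/-- Each arc outside `H_M` has a critical triangle of its own. -/
theorem card_upper_triangles_le (hM : G.complex.IsMorseMatching M) :
    #{p ∈ M | #p.2.1 = 3} + #(G.arcsOfMatching M)ᶜ ≤ 13 * G.m := by
  classical
  have h : ∀ e, ∃ τ, e ∈ (G.arcsOfMatching M)ᶜ → G.triangle e τ ∉ FiniteComplex.matched M := by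
    intro e
    by_cases he : e ∈ G.arcsOfMatching M
    · exact ⟨⟨{.s, .w, .b}, by decide⟩, fun h => absurd he (mem_compl.1 h)⟩
    · rw [mem_arcsOfMatching] at he
      push Not at he
      exact he.imp fun τ h _ => h
  choose τ hτ using h
  let T : Finset G.complex.Face :=
    (univ : Finset (Fin G.m × dunceTriangles)).image fun p => G.triangle p.1 p.2
  have hT : #T ≤ 13 * G.m := by
    refine card_image_le.trans ?_
    rw [card_univ, Fintype.card_prod, Fintype.card_fin, Fintype.card_coe, mul_comm]
    rfl
  refine le_trans ?_ hT
  rw [← card_image_of_injOn (f := Prod.snd) (s := {p ∈ M | #p.2.1 = 3}) ?inj,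
    ← card_image_of_injective (f := fun e => G.triangle e (τ e)) (G.arcsOfMatching M)ᶜ ?inj2,
    ← card_union_of_disjoint]
  · refine card_le_card (union_subset ?_ ?_)
    · intro σ hσ
      obtain ⟨p, hp, rfl⟩ := mem_image.1 hσ
      obtain ⟨e, ρ, h⟩ := exists_eq_triangle (mem_filter.1 hp).2.ge
      exact mem_image.2 ⟨(e, ρ), mem_univ _, h.symm⟩
    · intro σ hσ
      obtain ⟨e, -, rfl⟩ := mem_image.1 hσ
      exact mem_image.2 ⟨(e, τ e), mem_univ _, rfl⟩
  case inj => exact fun p hp q hq h =>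
    hM.1.eq_of_snd_eq (mem_filter.1 hp).1 (mem_filter.1 hq).1 h
  case inj2 => exact fun e f h => (triangle_inj.1 h).1
  · rw [disjoint_left]
    intro σ h1 h2
    obtain ⟨p, hp, rfl⟩ := mem_image.1 h1
    obtain ⟨e, he, h⟩ := mem_image.1 h2
    exact hτ e he (FiniteComplex.mem_matched.2 ⟨p, (mem_filter.1 hp).1, Or.inr h.symm⟩)

end DegThreeOrientedGraph

/-! ### Betti numbers and components -/

namespace FiniteComplex

variable {𝔽 : Type*} [Field 𝔽] {K : FiniteComplex}

theorem incidence_insert {τ : Finset ℕ} {r : ℕ} (hr : r ∉ τ) :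
    incidence 𝔽 τ (insert r τ) = (-1) ^ #{w ∈ τ | w < r} := by
  rw [incidence, sum_eq_single r]
  · rw [erase_insert hr, if_pos rfl, filter_insert, if_neg (lt_irrefl r)]
  · intro v hv hvr
    rw [if_neg]
    intro h
    apply hr
    rw [← h]
    exact mem_erase.2 ⟨hvr.symm, mem_insert_self _ _⟩
  · simp

theorem subset_of_incidence_ne_zero {τ σ : Finset ℕ} (h : incidence 𝔽 τ σ ≠ 0) : τ ⊆ σ := by
  obtain ⟨v, -, hv⟩ := exists_ne_zero_of_sum_ne_zero h
  have : σ.erase v = τ := by by_contra h; simp [h] at hv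
  exact this ▸ erase_subset _ _

/-- A sum against incidence numbers runs over the facets of a simplex. -/
theorem sum_mul_incidence {i : ℕ} (hi : i ≠ 0) (Φ : Finset ℕ → 𝔽) (σ : K.Simplex (i + 1)) :
    ∑ τ : K.Simplex i, Φ τ.1.1 * incidence 𝔽 τ.1.1 σ.1.1 =
      ∑ v ∈ σ.1.1, (-1) ^ #{w ∈ σ.1.1 | w < v} * Φ (σ.1.1.erase v) := by
  simp only [incidence, mul_sum]
  rw [sum_comm]
  refine sum_congr rfl fun v hv => ?_
  have hc : #(σ.1.1.erase v) = i := by rw [card_erase_of_mem hv, σ.2]; rfl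
  have hf : σ.1.1.erase v ∈ K.faces :=
    mem_faces_of_subset σ.1.2 (erase_subset _ _) (card_pos.1 (by omega))
  rw [Fintype.sum_eq_single (⟨⟨σ.1.1.erase v, hf⟩, hc⟩ : K.Simplex i)]
  · simp [mul_comm]
  · intro τ hτ
    rw [if_neg, mul_zero]
    intro h
    exact hτ (Subtype.ext (Subtype.ext h.symm))

theorem exists_lt_of_card_two {σ : Finset ℕ} (h : #σ = 2) : ∃ u v, u < v ∧ σ = {u, v} := by
  obtain ⟨u, v, hne, rfl⟩ := card_eq_two.1 h
  rcases hne.lt_or_gt with h | h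
  · exact ⟨u, v, h, rfl⟩
  · exact ⟨v, u, h, pair_comm _ _⟩

theorem exists_lt_of_card_three {σ : Finset ℕ} (h : #σ = 3) :
    ∃ x y z, x < y ∧ y < z ∧ σ = {x, y, z} := by
  have hne : σ.Nonempty := card_pos.1 (by omega)
  obtain ⟨y, z, hyz, he⟩ := exists_lt_of_card_two
    (show #(σ.erase (σ.min' hne)) = 2 by rw [card_erase_of_mem (min'_mem _ _), h])
  refine ⟨σ.min' hne, y, z, ?_, hyz, by rw [← he, insert_erase (min'_mem _ _)]⟩
  exact min'_lt_of_mem_erase_min' _ hne (by rw [he]; simp)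

theorem sum_pair_facets (Φ : Finset ℕ → 𝔽) {u v : ℕ} (h : u < v) :
    ∑ x ∈ ({u, v} : Finset ℕ), (-1) ^ #{w ∈ ({u, v} : Finset ℕ) | w < x} *
      Φ (({u, v} : Finset ℕ).erase x) = Φ {v} - Φ {u} := by
  have h1 : ({u, v} : Finset ℕ).erase u = {v} := by ext; simp; omega
  have h2 : ({u, v} : Finset ℕ).erase v = {u} := by ext; simp; omega
  rw [sum_pair h.ne, h1, h2]
  simp [filter_insert, filter_singleton, h, h.not_gt]
  ring

theorem sum_triple_facets (Φ : Finset ℕ → 𝔽) {x y z : ℕ} (hxy : x < y) (hyz : y < z) :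
    ∑ v ∈ ({x, y, z} : Finset ℕ), (-1) ^ #{w ∈ ({x, y, z} : Finset ℕ) | w < v} *
      Φ (({x, y, z} : Finset ℕ).erase v) = Φ {y, z} - Φ {x, z} + Φ {x, y} := by
  have h1 : ({x, y, z} : Finset ℕ).erase x = {y, z} := by ext; simp; omega
  have h2 : ({x, y, z} : Finset ℕ).erase y = {x, z} := by ext; simp; omega
  have h3 : ({x, y, z} : Finset ℕ).erase z = {x, y} := by ext; simp; omega
  have hxz := hxy.trans hyz
  rw [sum_insert (by simp; omega), sum_pair hyz.ne, h1, h2, h3]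
  simp [filter_insert, filter_singleton, hxy, hyz, hxz, hxy.not_gt, hyz.not_gt, hxz.not_gt,
    hxy.ne]
  ring

theorem incidence_pair (ρ : Finset ℕ) {u v : ℕ} (h : u < v) :
    incidence 𝔽 ρ {u, v} = (if {v} = ρ then 1 else 0) - (if {u} = ρ then 1 else 0) := by
  rw [← sum_pair_facets (fun τ => if τ = ρ then (1 : 𝔽) else 0) h, incidence]
  exact sum_congr rfl fun x _ => by simp

theorem boundary_comp_boundary : boundary 𝔽 K 1 ∘ₗ boundary 𝔽 K 2 = 0 := by
  rw [boundary, boundary, ← Matrix.mulVecLin_mul, ← Matrix.mulVecLin_zero]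
  congr 1
  ext ρ σ
  obtain ⟨x, y, z, hxy, hyz, hσ⟩ := exists_lt_of_card_three σ.2
  rw [Matrix.mul_apply]
  simp only [Matrix.of_apply, Matrix.zero_apply]
  rw [sum_mul_incidence (by norm_num) (fun τ => incidence 𝔽 ρ.1.1 τ), hσ,
    sum_triple_facets _ hxy hyz, incidence_pair _ hxy, incidence_pair _ hyz,
    incidence_pair _ (hxy.trans hyz)]
  ring

instance : IsEmpty (K.Simplex 0) :=
  ⟨fun σ => (face_nonempty σ.1).ne_empty (card_eq_zero.1 σ.2)⟩

theorem betti_add_finrank_range (i : ℕ) (h : boundary 𝔽 K i ∘ₗ boundary 𝔽 K (i + 1) = 0) :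
    betti 𝔽 K i + Module.finrank 𝔽 (boundary 𝔽 K i).range +
      Module.finrank 𝔽 (boundary 𝔽 K (i + 1)).range = Fintype.card (K.Simplex (i + 1)) := by
  have h1 := LinearMap.finrank_range_add_finrank_ker (boundary 𝔽 K i)
  have h2 := Submodule.finrank_quotient_add_finrank
    ((boundary 𝔽 K (i + 1)).range.comap (boundary 𝔽 K i).ker.subtype)
  have h3 := (Submodule.comapSubtypeEquivOfLe (LinearMap.range_le_ker_iff.2 h)).finrank_eq
  rw [Module.finrank_fintype_fun_eq_card] at h1
  rw [betti]
  omega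

/-- The graph of the vertices and edges of a complex. -/
def oneSkeleton (K : FiniteComplex) : SimpleGraph (K.Simplex 1) where
  Adj σ τ := σ ≠ τ ∧ σ.1.1 ∪ τ.1.1 ∈ K.faces
  symm := ⟨fun σ τ h => ⟨h.1.symm, by rw [union_comm]; exact h.2⟩⟩
  loopless := ⟨fun σ h => h.1 rfl⟩

/-- A vertex of a complex as a simplex. -/
def vertexOf {σ : Finset ℕ} (hσ : σ ∈ K.faces) {v : ℕ} (hv : v ∈ σ) : K.Simplex 1 :=
  ⟨⟨{v}, mem_faces_of_subset hσ (singleton_subset_iff.2 hv) (singleton_nonempty v)⟩,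
    card_singleton v⟩

theorem oneSkeleton_adj_vertexOf {σ : Finset ℕ} (hσ : σ ∈ K.faces) {u v : ℕ} (hu : u ∈ σ)
    (hv : v ∈ σ) (hne : u ≠ v) : K.oneSkeleton.Adj (vertexOf hσ hu) (vertexOf hσ hv) := by
  refine ⟨fun h => hne ?_, mem_faces_of_subset hσ ?_ ⟨u, by simp [vertexOf]⟩⟩
  · simpa [vertexOf] using congrArg (fun τ : K.Simplex 1 => τ.1.1) h
  · exact union_subset (singleton_subset_iff.2 hu) (singleton_subset_iff.2 hv)

noncomputable instance (Γ : SimpleGraph (K.Simplex 1)) : Fintype Γ.ConnectedComponent :=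
  Fintype.ofFinite _

/-- The number of components. -/
noncomputable def numComponents (K : FiniteComplex) : ℕ :=
  Fintype.card K.oneSkeleton.ConnectedComponent

/-- The cocycles of degree zero are the functions that are constant on the components. -/
theorem finrank_ker_coboundary : Module.finrank 𝔽
    ((Matrix.of fun (τ : K.Simplex 1) (σ : K.Simplex 2) =>
      incidence 𝔽 τ.1.1 σ.1.1).transpose.mulVecLin).ker = K.numComponents := by
  classical
  set A := Matrix.of fun (τ : K.Simplex 1) (σ : K.Simplex 2) => incidence 𝔽 τ.1.1 σ.1.1
  let L := LinearMap.funLeft 𝔽 𝔽 K.oneSkeleton.connectedComponentMk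
  have hL : Function.Injective L := LinearMap.funLeft_injective_of_surjective _ _ _
    (fun c => c.exists_rep)
  have hsum : ∀ (φ : K.Simplex 1 → 𝔽) (σ : K.Simplex 2) (u v : ℕ) (huv : u < v)
      (hσ : σ.1.1 = {u, v}), A.transpose.mulVecLin φ σ =
        φ (vertexOf σ.1.2 (v := v) (by simp [hσ])) -
          φ (vertexOf σ.1.2 (v := u) (by simp [hσ])) := by
    intro φ σ u v huv hσ
    let Φ : Finset ℕ → 𝔽 := fun τ => if h : ∃ h : τ ∈ K.faces, #τ = 1 then φ ⟨⟨τ, h.1⟩, h.2⟩ else 0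
    have hΦ : ∀ τ : K.Simplex 1, Φ τ.1.1 = φ τ := fun τ => dif_pos ⟨τ.1.2, τ.2⟩
    have h := sum_mul_incidence one_ne_zero Φ σ
    rw [hσ, sum_pair_facets _ huv] at h
    rw [← hΦ, ← hΦ]
    refine Eq.trans ?_ h
    simp only [Matrix.mulVecLin_apply, Matrix.mulVec, dotProduct, Matrix.transpose_apply, A,
      Matrix.of_apply, hΦ]
    exact sum_congr rfl fun τ _ => by rw [mul_comm, hσ]
  have hrange : L.range = A.transpose.mulVecLin.ker := by
    ext φ
    rw [LinearMap.mem_range, LinearMap.mem_ker]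
    constructor
    · rintro ⟨f, rfl⟩
      ext σ
      obtain ⟨u, v, huv, hσ⟩ := exists_lt_of_card_two σ.2
      rw [hsum _ σ u v huv hσ, Pi.zero_apply, sub_eq_zero]
      change f _ = f _
      congr 1
      exact SimpleGraph.ConnectedComponent.sound
        (oneSkeleton_adj_vertexOf σ.1.2 _ _ huv.ne').reachable
    · intro hφ
      have hadj : ∀ x y, K.oneSkeleton.Adj x y → φ x = φ y := by
        intro x y hxy
        obtain ⟨u, hu⟩ := card_eq_one.1 x.2
        obtain ⟨v, hv⟩ := card_eq_one.1 y.2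
        wlog huv : u < v generalizing x y u v
        · refine (this y x hxy.symm v hv u hu (lt_of_le_of_ne (not_lt.1 huv) ?_)).symm
          rintro rfl
          exact hxy.1 (Subtype.ext (Subtype.ext (hu.trans hv.symm)))
        have hxy2 : x.1.1 ∪ y.1.1 = {u, v} := by rw [hu, hv]; rfl
        have hmem : x.1.1 ∪ y.1.1 ∈ K.faces := hxy.2
        have h := hsum φ ⟨⟨x.1.1 ∪ y.1.1, hmem⟩, by simp only [hxy2, card_pair huv.ne]⟩ u v huv hxy2
        rw [hφ, Pi.zero_apply, eq_comm, sub_eq_zero] at h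
        have hx : x = vertexOf hmem (v := u) (by simp [hu]) := Subtype.ext (Subtype.ext hu)
        have hy : y = vertexOf hmem (v := v) (by simp [hv]) := Subtype.ext (Subtype.ext hv)
        exact (congrArg φ hx).trans (h.symm.trans (congrArg φ hy).symm)
      have hreach : ∀ x y, K.oneSkeleton.Reachable x y → φ x = φ y := by
        rintro x y ⟨w⟩
        induction w with
        | nil => rfl
        | cons h _ ih => exact (hadj _ _ h).trans ih
      refine ⟨fun c => φ c.out, funext fun x => hreach _ _ ?_⟩
      exact SimpleGraph.ConnectedComponent.exact (Quot.out_eq _)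
  rw [← hrange, LinearMap.finrank_range_of_inj hL, Module.finrank_fintype_fun_eq_card]
  rfl

theorem betti_zero : betti 𝔽 K 0 = K.numComponents := by
  have h := betti_add_finrank_range (𝔽 := 𝔽) (K := K) 0 (LinearMap.ext fun _ => Subsingleton.elim _ _)
  have h0 : Module.finrank 𝔽 (boundary 𝔽 K 0).range = 0 :=
    Module.finrank_zero_of_subsingleton
  have h1 := LinearMap.finrank_range_add_finrank_ker
    ((Matrix.of fun (τ : K.Simplex 1) (σ : K.Simplex 2) =>
      incidence 𝔽 τ.1.1 σ.1.1).transpose.mulVecLin)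
  rw [finrank_ker_coboundary, Module.finrank_fintype_fun_eq_card] at h1
  have h2 := Matrix.rank_transpose
    (Matrix.of fun (τ : K.Simplex 1) (σ : K.Simplex 2) => incidence 𝔽 τ.1.1 σ.1.1)
  rw [Matrix.rank, Matrix.rank] at h2
  rw [h2] at h1
  change betti 𝔽 K 0 + _ + Module.finrank 𝔽 (Matrix.mulVecLin (Matrix.of
    fun (τ : K.Simplex 1) (σ : K.Simplex 2) => incidence 𝔽 τ.1.1 σ.1.1)).range =
      Fintype.card (K.Simplex 1) at h
  omega

/-- The Euler relation for a complex of dimension at most two without two-dimensional cycles. -/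
theorem card_add_card_eq_of_injective (h2 : Function.Injective (boundary 𝔽 K 2))
    (h4 : IsEmpty (K.Simplex 4)) :
    betti 𝔽 K 2 = 0 ∧ Fintype.card (K.Simplex 1) + Fintype.card (K.Simplex 3) + betti 𝔽 K 1 =
      Fintype.card (K.Simplex 2) + betti 𝔽 K 0 := by
  have e0 := betti_add_finrank_range (𝔽 := 𝔽) (K := K) 0
    (LinearMap.ext fun _ => Subsingleton.elim _ _)
  have e1 := betti_add_finrank_range (𝔽 := 𝔽) (K := K) 1 boundary_comp_boundary
  have e2 := betti_add_finrank_range (𝔽 := 𝔽) (K := K) 2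
    (LinearMap.ext fun x => by rw [Subsingleton.elim x 0]; simp)
  have h0 : Module.finrank 𝔽 (boundary 𝔽 K 0).range = 0 :=
    Module.finrank_zero_of_subsingleton
  have h := LinearMap.finrank_range_of_inj h2
  rw [Module.finrank_fintype_fun_eq_card] at h
  simp only [Nat.reduceAdd, zero_add] at *
  omega

theorem numSimplices_eq (h3 : ∀ σ ∈ K.faces, #σ ≤ 3) : K.numSimplices =
    Fintype.card (K.Simplex 1) + Fintype.card (K.Simplex 2) + Fintype.card (K.Simplex 3) := by
  classical
  have := Fintype.ofFinite K.Face
  have hc : ∀ k, Fintype.card (K.Simplex k) = #{σ : K.Face | #σ.1 = k} := fun k => by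
    rw [← Fintype.card_subtype]
  rw [numSimplices, ← Nat.card_coe_set_eq, Nat.card_eq_fintype_card (α := K.Face), ← card_univ,
    card_eq_sum_card_fiberwise (f := fun σ : K.Face => #σ.1) (t := {1, 2, 3})]
  · simp [hc, add_assoc]
  · intro σ _
    have h1 := card_pos.2 (face_nonempty σ)
    have h2 := h3 _ σ.2
    simp
    omega

end FiniteComplex

/-! ### The complex has no two-dimensional cycles -/

namespace DegThreeOrientedGraph

variable {𝔽 : Type*} [Field 𝔽] {G : DegThreeOrientedGraph}

/-- The sign of the difference of two distinct numbers. -/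
def orderSign (𝔽 : Type*) [Field 𝔽] (p q : ℕ) : 𝔽 := if p < q then 1 else -1

theorem orderSign_swap {p q : ℕ} (h : p ≠ q) : orderSign 𝔽 p q = -orderSign 𝔽 q p := by
  rcases h.lt_or_gt with h | h <;> simp [orderSign, h, h.not_gt]

theorem orderSign_mul_self (p q : ℕ) : orderSign 𝔽 p q * orderSign 𝔽 p q = 1 := by
  unfold orderSign; split_ifs <;> ring

theorem incidence_triple {p q r : ℕ} (hpq : p ≠ q) (hpr : p ≠ r) (hqr : q ≠ r) :
    FiniteComplex.incidence 𝔽 {p, q} {p, q, r} = orderSign 𝔽 p r * orderSign 𝔽 q r := by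
  rw [show ({p, q, r} : Finset ℕ) = insert r {p, q} by ext; simp; tauto,
    FiniteComplex.incidence_insert (by simp [hpr.symm, hqr.symm])]
  by_cases h1 : p < r <;> by_cases h2 : q < r <;>
    simp [orderSign, filter_insert, filter_singleton, h1, h2, hpq]

/-- The coefficient of a 2-chain at the oriented image of the triangle `xyz` in the copy at `e`. -/
noncomputable def orientedCoeff (c : G.complex.Simplex 3 → 𝔽) (e : Fin G.m)
    (x y z : DunceVertex) : 𝔽 :=
  orderSign 𝔽 (G.gluing e x) (G.gluing e y) * orderSign 𝔽 (G.gluing e x) (G.gluing e z) *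
    orderSign 𝔽 (G.gluing e y) (G.gluing e z) *
      if h : {x, y, z} ∈ dunceTriangles then c ⟨G.triangle e ⟨_, h⟩, card_triangle e _⟩ else 0

theorem orientedCoeff_of_insert_eq (c : G.complex.Simplex 3 → 𝔽) (e : Fin G.m)
    {x y z x' y' z' : DunceVertex} (h : ({x, y, z} : Finset DunceVertex) = {x', y', z'}) :
    orientedCoeff c e x' y' z' = orderSign 𝔽 (G.gluing e x') (G.gluing e y') *
      orderSign 𝔽 (G.gluing e x') (G.gluing e z') * orderSign 𝔽 (G.gluing e y') (G.gluing e z') *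
      if h : {x, y, z} ∈ dunceTriangles then c ⟨G.triangle e ⟨_, h⟩, card_triangle e _⟩ else 0 := by
  simp only [orientedCoeff, h]

theorem orientedCoeff_swap_left (c : G.complex.Simplex 3 → 𝔽) (e : Fin G.m)
    {x y : DunceVertex} (hxy : x ≠ y) (z : DunceVertex) :
    orientedCoeff c e x y z = -orientedCoeff c e y x z := by
  rw [orientedCoeff_of_insert_eq c e (show ({x, y, z} : Finset _) = {y, x, z} from
    insert_comm _ _ _), orientedCoeff, orderSign_swap ((gluing_injective e).ne hxy)]
  ring

theorem orientedCoeff_swap_right (c : G.complex.Simplex 3 → 𝔽) (e : Fin G.m)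
    (x : DunceVertex) {y z : DunceVertex} (hyz : y ≠ z) :
    orientedCoeff c e x y z = -orientedCoeff c e x z y := by
  rw [orientedCoeff_of_insert_eq c e (show ({x, y, z} : Finset _) = {x, z, y} by
    rw [pair_comm]), orientedCoeff, orderSign_swap ((gluing_injective e).ne hyz)]
  ring

/-- At an unshared edge the boundary of a chain only involves the triangles of its copy. -/
theorem sum_orientedCoeff_eq_zero {c : G.complex.Simplex 3 → 𝔽}
    (hc : FiniteComplex.boundary 𝔽 G.complex 2 c = 0) (e : Fin G.m) {x y : DunceVertex}
    (hne : x ≠ y) (hu : x.Unshared y) (hface : {x, y} ∈ dunceHat.faces) :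
    ∑ z with {x, y, z} ∈ dunceTriangles, orientedCoeff c e x y z = 0 := by
  let τ : G.complex.Simplex 2 := ⟨⟨G.glued e {x, y}, mem_complex.2 ⟨e, _, hface, rfl⟩⟩,
    by rw [card_glued, card_pair hne]⟩
  have hpair : G.glued e {x, y} = {G.gluing e x, G.gluing e y} := by simp [glued]
  have h := congrFun hc τ
  have hinj := gluing_injective e
  suffices hs : ∑ z : {z // {x, y, z} ∈ dunceTriangles}, orderSign 𝔽 (G.gluing e x) (G.gluing e y) *
      orientedCoeff c e x y z.1 = 0 by
    rw [← mul_sum] at hs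
    have h0 : orderSign 𝔽 (G.gluing e x) (G.gluing e y) ≠ 0 := fun h0 => by
      simpa [h0] using orderSign_mul_self (𝔽 := 𝔽) (G.gluing e x) (G.gluing e y)
    rw [← (mul_eq_zero.1 hs).resolve_left h0]
    exact sum_subtype _ (by simp) _
  refine Eq.trans ?_ h
  simp only [FiniteComplex.boundary, Matrix.mulVecLin_apply, Matrix.mulVec, dotProduct,
    Matrix.of_apply]
  have hdist : ∀ z, {x, y, z} ∈ dunceTriangles → x ≠ z ∧ y ≠ z := by
    intro z hz
    have h3 := card_of_mem_dunceTriangles hz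
    constructor
    · rintro rfl
      have := card_le_two (a := x) (b := y)
      rw [pair_comm y x, insert_eq_of_mem (mem_insert_self _ _)] at h3
      omega
    · rintro rfl
      have := card_le_two (a := x) (b := y)
      rw [insert_eq_of_mem (mem_singleton_self _)] at h3
      omega
  refine sum_of_injOn (fun z => ⟨G.triangle e ⟨_, z.2⟩, card_triangle e _⟩) ?_ (by simp) ?_ ?_
  · intro z _ z' _ h
    have h := (triangle_inj.1 (congrArg Subtype.val h)).2
    have h : ({x, y, z.1} : Finset _) = {x, y, z'.1} := congrArg Subtype.val h
    have hz : z.1 ∈ ({x, y, z'.1} : Finset _) := h ▸ (by simp)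
    have := hdist _ z.2
    simp only [mem_insert, mem_singleton, this.1.symm, this.2.symm, false_or] at hz
    exact Subtype.ext hz
  · intro σ _ hσ
    have h0 : FiniteComplex.incidence 𝔽 τ.1.1 σ.1.1 = 0 := by
      by_contra hinc
      have hsub := FiniteComplex.subset_of_incidence_ne_zero hinc
      obtain ⟨e', ⟨ρ, hρ⟩, he'⟩ := exists_eq_triangle (σ := σ.1) σ.2.ge
      rw [he'] at hsub
      obtain rfl := eq_of_unshared_subset hu hsub
      have hsub : {x, y} ⊆ ρ := glued_subset_glued.1 hsub
      obtain ⟨z, hz⟩ : ∃ z, ρ \ {x, y} = {z} := by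
        rw [← card_eq_one, card_sdiff_of_subset hsub, card_of_mem_dunceTriangles hρ, card_pair hne]
      have hρz : ρ = {x, y, z} := by
        calc ρ = {x, y} ∪ ρ \ {x, y} := (union_sdiff_of_subset hsub).symm
          _ = {x, y, z} := by rw [hz]; ext; simp
      subst hρz
      exact hσ ⟨⟨z, hρ⟩, by simp, Subtype.ext he'.symm⟩
    rw [h0, zero_mul]
  · rintro ⟨z, hz⟩ -
    have hz' := hdist z hz
    have htri : (G.triangle e ⟨_, hz⟩).1 = {G.gluing e x, G.gluing e y, G.gluing e z} := by
      simp [triangle, glued]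
    simp only [orientedCoeff, dif_pos hz]
    change _ = FiniteComplex.incidence 𝔽 (G.glued e {x, y}) (G.triangle e ⟨_, hz⟩).1 * _
    rw [htri, hpair, incidence_triple (hinj.ne hne) (hinj.ne hz'.1) (hinj.ne hz'.2)]
    linear_combination (orderSign 𝔽 (G.gluing e x) (G.gluing e z) *
      orderSign 𝔽 (G.gluing e y) (G.gluing e z) * c ⟨G.triangle e ⟨_, hz⟩, card_triangle e _⟩) *
      orderSign_mul_self (𝔽 := 𝔽) (G.gluing e x) (G.gluing e y)

theorem card_simplex_three : Fintype.card (G.complex.Simplex 3) = 13 * G.m := by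
  have h : Function.Bijective fun p : Fin G.m × dunceTriangles =>
      (⟨G.triangle p.1 p.2, card_triangle _ _⟩ : G.complex.Simplex 3) := by
    constructor
    · intro p q h
      have := triangle_inj.1 (congrArg Subtype.val h)
      exact Prod.ext this.1 this.2
    · intro σ
      obtain ⟨e, τ, h⟩ := exists_eq_triangle (σ := σ.1) σ.2.ge
      exact ⟨(e, τ), Subtype.ext h.symm⟩
  rw [← Fintype.card_of_bijective h, Fintype.card_prod, Fintype.card_fin, Fintype.card_coe,
    mul_comm]
  rfl

open DunceVertex in
/-- Passing through unshared edges, all coefficients of a cycle in one copy agree up to sign; the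
three triangles at the edge `as` then force their common value to vanish. -/
theorem boundary_two_injective :
    Function.Injective (FiniteComplex.boundary 𝔽 G.complex 2) := by
  rw [← LinearMap.ker_eq_bot, LinearMap.ker_eq_bot']
  intro c hc
  ext σ
  obtain ⟨e, ⟨ρ, hρ⟩, hσ⟩ := exists_eq_triangle (σ := σ.1) σ.2.ge
  have E : ∀ x y, x ≠ y → x.Unshared y → {x, y} ∈ dunceFaces →
      ∑ z with {x, y, z} ∈ dunceTriangles, orientedCoeff c e x y z = 0 := fun x y hne hu hf =>
    sum_orientedCoeff_eq_zero hc e hne hu (mem_dunceFaces.1 hf)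
  set D := orientedCoeff c e with hD
  have E2 : ∀ x y z z', x ≠ y → x.Unshared y → {x, y} ∈ dunceFaces → z ≠ z' →
      ({z | {x, y, z} ∈ dunceTriangles} : Finset DunceVertex) = {z, z'} →
      D x y z + D x y z' = 0 := by
    intro x y z z' h1 h2 h3 h4 h5
    rw [← E x y h1 h2 h3, h5, sum_pair h4]
  have sl := fun x y z (h : x ≠ y) => orientedCoeff_swap_left c e h z
  have sr := fun x y z (h : y ≠ z) => orientedCoeff_swap_right c e x h
  have szb := E2 s b w z (by decide) (by decide) (by decide +kernel) (by decide) (by decide +kernel)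
  have wyb := E2 w b s y (by decide) (by decide) (by decide +kernel) (by decide) (by decide +kernel)
  have tyb := E2 y b w t (by decide) (by decide) (by decide +kernel) (by decide) (by decide +kernel)
  have tzb := E2 z b s t (by decide) (by decide) (by decide +kernel) (by decide) (by decide +kernel)
  have asz := E2 s z b a (by decide) (by decide) (by decide +kernel) (by decide) (by decide +kernel)
  have awy := E2 w y b a (by decide) (by decide) (by decide +kernel) (by decide) (by decide +kernel)
  have asy := E2 a y w s (by decide) (by decide) (by decide +kernel) (by decide) (by decide +kernel)
  have awz := E2 a z s w (by decide) (by decide) (by decide +kernel) (by decide) (by decide +kernel)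
  have sty := E2 s y a t (by decide) (by decide) (by decide +kernel) (by decide) (by decide +kernel)
  have wtz := E2 w z a t (by decide) (by decide) (by decide +kernel) (by decide) (by decide +kernel)
  have ast := E2 s t y a (by decide) (by decide) (by decide +kernel) (by decide) (by decide +kernel)
  have awt := E2 w t z a (by decide) (by decide) (by decide +kernel) (by decide) (by decide +kernel)
  have as := E a s (by decide) (by decide) (by decide +kernel)
  rw [show ({z | {a, s, z} ∈ dunceTriangles} : Finset DunceVertex) = {t, y, z} by decide +kernel,
    sum_insert (by decide), sum_pair (by decide)] at as
  have hszb : D s z b = -D s w b := by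
    linear_combination -szb + sr s b w (by decide) + sr s b z (by decide)
  have hwyb : D w y b = D s w b := by
    linear_combination -wyb + sr w b s (by decide) - sl w s b (by decide) + sr w b y (by decide)
  have htyb : D t y b = -D s w b := by
    linear_combination tyb - sr y b w (by decide) + sl y w b (by decide) - sr y b t (by decide) + sl y t b (by decide) - hwyb
  have htzb : D t z b = D s w b := by
    linear_combination tzb - sr z b s (by decide) + sl z s b (by decide) - sr z b t (by decide) + sl z t b (by decide) - hszb
  have hasz : D a s z = D s w b := by
    linear_combination asz - sr s z a (by decide) + sl s a z (by decide) - hszb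
  have hawy : D a w y = -D s w b := by
    linear_combination awy - sr w y a (by decide) + sl w a y (by decide) - hwyb
  have hasy : D a s y = D s w b := by
    linear_combination -asy + sr a y w (by decide) + sr a y s (by decide) - hawy
  have hawz : D a w z = -D s w b := by
    linear_combination -awz + sr a z s (by decide) + sr a z w (by decide) - hasz
  have hsty : D s t y = D s w b := by
    linear_combination -sty + sr s y a (by decide) - sl s a y (by decide) + sr s y t (by decide) + hasy
  have hwtz : D w t z = -D s w b := by
    linear_combination -wtz + sr w z a (by decide) - sl w a z (by decide) + sr w z t (by decide) + hawz
  have hast : D a s t = -D s w b := by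
    linear_combination ast - sr s t a (by decide) + sl s a t (by decide) - hsty
  have hawt : D a w t = D s w b := by
    linear_combination awt - sr w t a (by decide) + sl w a t (by decide) - hwtz
  have hswb : D s w b = 0 := by
    linear_combination as - hast - hasy - hasz

  have hall : ∀ x y z, D x y z = 0 → ∀ h : ({x, y, z} : Finset DunceVertex) ∈ dunceTriangles,
      c ⟨G.triangle e ⟨_, h⟩, card_triangle e _⟩ = 0 := by
    intro x y z h0 h
    have hsq := fun p q => orderSign_mul_self (𝔽 := 𝔽) (G.gluing e p) (G.gluing e q)
    simp only [hD, orientedCoeff, dif_pos h] at h0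
    refine (mul_eq_zero.1 h0).resolve_left fun h1 => ?_
    rcases mul_eq_zero.1 h1 with h1 | h1
    · rcases mul_eq_zero.1 h1 with h1 | h1
      · simpa [h1] using hsq x y
      · simpa [h1] using hsq x z
    · simpa [h1] using hsq y z
  rw [show σ = ⟨G.triangle e ⟨ρ, hρ⟩, card_triangle e _⟩ from Subtype.ext hσ]
  have hρ' := hρ
  simp only [dunceTriangles, mem_insert, mem_singleton] at hρ'
  rcases hρ' with rfl | rfl | rfl | rfl | rfl | rfl | rfl | rfl | rfl | rfl | rfl | rfl | rfl <;>
    refine hall _ _ _ ?_ hρ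
  · exact hswb
  · simp [hast, hswb]
  · simp [hasy, hswb]
  · simp [hasz, hswb]
  · simp [hawt, hswb]
  · simp [hawy, hswb]
  · simp [hawz, hswb]
  · simp [hsty, hswb]
  · simp [hszb, hswb]
  · simp [hwtz, hswb]
  · simp [hwyb, hswb]
  · simp [htyb, hswb]
  · simp [htzb, hswb]

end DegThreeOrientedGraph

/-! ### Spanning forests complete an edge-triangle matching -/

namespace FiniteComplex

variable {K : FiniteComplex}

theorem eq_or_eq_of_subset_union {x y z : K.Simplex 1} (h : x.1.1 ⊆ y.1.1 ∪ z.1.1) :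
    x = y ∨ x = z := by
  obtain ⟨u, hu⟩ := card_eq_one.1 x.2
  obtain ⟨v, hv⟩ := card_eq_one.1 y.2
  obtain ⟨w, hw⟩ := card_eq_one.1 z.2
  rw [hu, hv, hw, singleton_subset_iff] at h
  rcases mem_union.1 h with h | h
  · exact Or.inl (Subtype.ext (Subtype.ext (by rw [hu, hv, mem_singleton.1 h])))
  · exact Or.inr (Subtype.ext (Subtype.ext (by rw [hu, hw, mem_singleton.1 h])))

/-- The graph of the vertices of a complex and of the edges which are not lower faces of `M`. -/
def unmatchedGraph (M : Finset (K.Face × K.Face)) : SimpleGraph (K.Simplex 1) where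
  Adj x y := K.oneSkeleton.Adj x y ∧ ∀ p ∈ M, p.1.1 ≠ x.1.1 ∪ y.1.1
  symm := ⟨fun x y h => ⟨h.1.symm, by rw [union_comm]; exact h.2⟩⟩
  loopless := ⟨fun x h => h.1.1 rfl⟩

/-- Removing the matched edges of an acyclic matching of edges with triangles does not disconnect
vertices: a matched edge can be replaced by the other two edges of its triangle, and this process
ends. -/
theorem unmatchedGraph_reachable {M : Finset (K.Face × K.Face)} (hM : IsPartialMatching M)
    (hM2 : ∀ p ∈ M, #p.1.1 = 2) (h : K.Face × K.Face → ℕ)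
    (hh : ∀ p ∈ M, ∀ q ∈ M, p ≠ q → q.1 ⋖ p.2 → h p < h q) {x y : K.Simplex 1}
    (hxy : K.oneSkeleton.Reachable x y) : (unmatchedGraph M).Reachable x y := by
  classical
  have key : ∀ n, ∀ p ∈ M, M.sup h - h p ≤ n → ∀ u (hu : u ∈ p.1.1) v (hv : v ∈ p.1.1), u ≠ v →
      (unmatchedGraph M).Reachable (vertexOf p.1.2 hu) (vertexOf p.1.2 hv) := by
    intro n
    induction n with
    | zero | succ n ih =>
    intro p hp hn u hu v hv hne
    obtain ⟨hsub, hcard⟩ := face_covBy_iff.1 (hM.1 p hp)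
    obtain ⟨w, hw, hwp⟩ := exists_of_ssubset (ssubset_of_subset_of_ne hsub fun h => by
      rw [h] at hcard; omega)
    have huv : p.1.1 = {u, v} := (eq_of_subset_of_card_le (by simp [insert_subset_iff, hu, hv])
      (by rw [hM2 p hp, card_pair hne])).symm
    -- The edge from a vertex of the matched edge to the third vertex of the triangle.
    have step : ∀ a (ha : a ∈ p.1.1), (unmatchedGraph M).Reachable
        (vertexOf p.1.2 ha) (vertexOf p.2.2 hw) := by
      intro a ha
      have haw : a ≠ w := fun h => hwp (h ▸ ha)
      have hadj := oneSkeleton_adj_vertexOf p.2.2 (hsub ha) hw haw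
      by_cases hq : ∃ q ∈ M, q.1.1 = {a, w}
      · obtain ⟨q, hq, hqe⟩ := hq
        have hpq : p ≠ q := by
          rintro rfl
          exact hwp (by rw [hqe]; simp)
        have hlt := hh p hp q hq hpq (face_covBy_iff.2 ⟨by
          simp [hqe, insert_subset_iff, hsub ha, hw], by rw [hqe, card_pair haw, hcard, hM2 p hp]⟩)
        have hle : h q ≤ M.sup h := le_sup hq
        first
        | omega
        | exact ih q hq (by omega) a (by rw [hqe]; simp) w (by rw [hqe]; simp) haw
      · push Not at hq
        exact SimpleGraph.Adj.reachable ⟨hadj, fun q hq' => hq q hq'⟩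
    exact (step u hu).trans (step v hv).symm
  obtain ⟨w⟩ := hxy
  induction w with
  | nil => exact SimpleGraph.Reachable.refl _
  | @cons x z y hxz _ ih =>
    refine SimpleGraph.Reachable.trans ?_ ih
    by_cases hq : ∃ q ∈ M, q.1.1 = x.1.1 ∪ z.1.1
    · obtain ⟨q, hq, hqe⟩ := hq
      obtain ⟨u, hu⟩ := card_eq_one.1 x.2
      obtain ⟨v, hv⟩ := card_eq_one.1 z.2
      have hu' : u ∈ q.1.1 := by rw [hqe, hu]; simp
      have hv' : v ∈ q.1.1 := by rw [hqe, hv]; simp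
      have hx : x = vertexOf q.1.2 hu' := Subtype.ext (Subtype.ext hu)
      have hz : z = vertexOf q.1.2 hv' := Subtype.ext (Subtype.ext hv)
      have hne : u ≠ v := fun h => hxz.1 (Subtype.ext (Subtype.ext (by rw [hu, hv, h])))
      rw [hx, hz]
      exact key _ q hq le_rfl u hu' v hv' hne
    · push Not at hq
      exact SimpleGraph.Adj.reachable ⟨hxz, hq⟩

/-- An acyclic matching of edges with triangles extends to a Morse matching with one critical vertex
in each component: each vertex other than a chosen root is matched with the first edge of a
shortest path to the root that avoids the matched edges. -/
theorem exists_isMorseMatching_extending {M : Finset (K.Face × K.Face)} (hM : IsPartialMatching M)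
    (hM2 : ∀ p ∈ M, #p.1.1 = 2) (h : K.Face × K.Face → ℕ)
    (hh : ∀ p ∈ M, ∀ q ∈ M, p ≠ q → q.1 ⋖ p.2 → h p < h q) :
    ∃ M', K.IsMorseMatching M' ∧ #M' + K.numComponents = #M + Fintype.card (K.Simplex 1) := by
  classical
  let root : K.Simplex 1 → K.Simplex 1 := fun x => (K.oneSkeleton.connectedComponentMk x).out
  have hroot : ∀ x, (unmatchedGraph M).Reachable x (root x) := fun x =>
    unmatchedGraph_reachable hM hM2 h hh
      (SimpleGraph.ConnectedComponent.exact (Quot.out_eq _)).symm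
  let d : K.Simplex 1 → ℕ := fun x => (unmatchedGraph M).dist x (root x)
  have hpar : ∀ x, ∃ y, x ≠ root x → (unmatchedGraph M).Adj x y ∧ d y < d x := by
    intro x
    by_cases hx : x = root x
    · exact ⟨x, fun h => absurd hx h⟩
    obtain ⟨y, hadj, hlt⟩ : ∃ y, (unmatchedGraph M).Adj x y ∧
        (unmatchedGraph M).dist y (root x) < (unmatchedGraph M).dist x (root x) := by
      obtain ⟨w, hw⟩ := (hroot x).exists_walk_length_eq_dist
      generalize root x = r at *
      cases w with
      | nil => exact absurd rfl hx
      | @cons _ y _ hadj w =>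
        refine ⟨y, hadj, ?_⟩
        rw [← hw, SimpleGraph.Walk.length_cons]
        exact Nat.lt_succ_of_le (SimpleGraph.dist_le w)
    refine ⟨y, fun _ => ⟨hadj, ?_⟩⟩
    have hr : root y = root x := by
      change Quot.out _ = Quot.out _
      rw [SimpleGraph.ConnectedComponent.sound hadj.1.reachable]
    change (unmatchedGraph M).dist y (root y) < (unmatchedGraph M).dist x (root x)
    rwa [hr]
  choose par hpar using hpar
  let V := {x : K.Simplex 1 // x ≠ root x}
  have hadj : ∀ x : V, (unmatchedGraph M).Adj x.1 (par x.1) := fun x => (hpar x.1 x.2).1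
  let pr : V → K.Face × K.Face := fun x => (x.1.1, ⟨x.1.1.1 ∪ (par x.1).1.1, (hadj x).1.2⟩)
  have hcard2 : ∀ x, #(pr x).2.1 = 2 := by
    intro x
    change #(x.1.1.1 ∪ (par x.1).1.1) = 2
    obtain ⟨u, hu⟩ := card_eq_one.1 x.1.2
    obtain ⟨v, hv⟩ := card_eq_one.1 (par x.1).2
    rw [hu, hv]
    refine card_pair fun huv => (hadj x).1.1 (Subtype.ext (Subtype.ext ?_))
    rw [hu, hv, huv]
  have hprinj : Function.Injective pr := fun x y hxy =>
    Subtype.ext (Subtype.ext (congrArg Prod.fst hxy))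
  have hle : ∀ x y : V, x.1.1.1 ⊆ (pr y).2.1 → x = y ∨ d x.1 < d y.1 := by
    intro x y hxy
    rcases eq_or_eq_of_subset_union hxy with hxy | hxy
    · exact Or.inl (Subtype.ext hxy)
    · exact Or.inr (hxy ▸ (hpar y.1 y.2).2)
  let M1 : Finset (K.Face × K.Face) := univ.image pr
  have hM1 : ∀ p, p ∈ M1 ↔ ∃ x, pr x = p := by simp [M1]
  have hM1c : ∀ p ∈ M1, #p.1.1 = 1 := by
    intro p hp
    obtain ⟨x, rfl⟩ := (hM1 p).1 hp
    exact x.1.2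
  have hdisj : Disjoint M1 M := by
    rw [disjoint_left]
    intro p h1 h2
    have := hM1c p h1
    have := hM2 p h2
    omega
  have hpm : IsPartialMatching (M1 ∪ M) := by
    have hmix : ∀ p ∈ M1, ∀ q ∈ M, ∀ z, (z = p.1 ∨ z = p.2) → ¬ (z = q.1 ∨ z = q.2) := by
      intro p hp q hq z hz hz'
      have hq1 := hM2 q hq
      have hq2 := (face_covBy_iff.1 (hM.1 q hq)).2
      obtain ⟨x, rfl⟩ := (hM1 p).1 hp
      rcases hz with rfl | rfl
      · have hp1 := hM1c _ hp
        rcases hz' with h | h <;> rw [h] at hp1 <;> omega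
      · have hp2 := hcard2 x
        rcases hz' with h | h
        · exact (hadj x).2 q hq (congrArg Subtype.val h).symm
        · rw [h] at hp2; omega
    constructor
    · intro p hp
      rcases mem_union.1 hp with hp | hp
      · obtain ⟨x, rfl⟩ := (hM1 p).1 hp
        exact face_covBy_iff.2 ⟨subset_union_left, by rw [hcard2, hM1c _ hp]⟩
      · exact hM.1 p hp
    · intro p hp q hq z hz hz'
      rcases mem_union.1 hp with hp | hp <;> rcases mem_union.1 hq with hq | hq
      · obtain ⟨x, rfl⟩ := (hM1 p).1 hp
        obtain ⟨y, rfl⟩ := (hM1 q).1 hq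
        congr 1
        have hx := hcard2 x
        have hy := hcard2 y
        have hx1 := hM1c _ hp
        have hy1 := hM1c _ hq
        rcases hz with rfl | rfl <;> rcases hz' with h | h
        · exact Subtype.ext (Subtype.ext h)
        · rw [h] at hx1; omega
        · rw [h] at hx; omega
        · have hxy := hle x y (by rw [← h]; exact subset_union_left)
          have hyx := hle y x (by rw [h]; exact subset_union_left)
          rcases hxy with hxy | hxy
          · exact hxy
          · rcases hyx with hyx | hyx
            · exact hyx.symm
            · omega
      · exact absurd hz' (hmix p hp q hq z hz)
      · exact absurd hz (hmix q hq p hp z hz')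
      · exact hM.2 p hp q hq z hz hz'
  let H : K.Face × K.Face → ℕ := fun p =>
    if hp : #p.1.1 = 1 then univ.sup d - d ⟨p.1, hp⟩ else h p
  refine ⟨M1 ∪ M, ⟨hpm, isAcyclicMatching_of_potential H ?_⟩, ?_⟩
  · intro p hp q hq hne hcov
    have hc := (face_covBy_iff.1 hcov).2
    have hcp := (face_covBy_iff.1 (hpm.1 p hp)).2
    have hsub := (face_covBy_iff.1 hcov).1
    rcases mem_union.1 hp with hp1 | hp1 <;> rcases mem_union.1 hq with hq1 | hq1
    · have hp2 := hM1c p hp1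
      have hq2 := hM1c q hq1
      simp only [H, dif_pos hp2, dif_pos hq2]
      obtain ⟨x, rfl⟩ := (hM1 p).1 hp1
      obtain ⟨y, rfl⟩ := (hM1 q).1 hq1
      rcases hle y x hsub with rfl | hlt
      · exact absurd rfl hne
      · have : d x.1 ≤ univ.sup d := le_sup (mem_univ _)
        change univ.sup d - d x.1 < univ.sup d - d y.1
        omega
    · have := hM1c p hp1
      have := hM2 q hq1
      omega
    · have := hM1c q hq1
      have := hM2 p hp1
      omega
    · have hp2 := hM2 p hp1
      have hq2 := hM2 q hq1
      simp only [H, hp2, hq2, OfNat.ofNat_ne_one, dif_neg, not_false_eq_true]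
      exact hh p hp1 q hq1 hne hcov
  · rw [card_union_of_disjoint hdisj, card_image_of_injective _ hprinj, card_univ]
    have h1 : Fintype.card {x : K.Simplex 1 // x = root x} = K.numComponents := by
      refine Fintype.card_of_bijective (f := fun x => K.oneSkeleton.connectedComponentMk x.1)
        ⟨fun x y hxy => ?_, fun c => ?_⟩
      · refine Subtype.ext (x.2.trans (Eq.trans ?_ y.2.symm))
        exact congrArg Quot.out hxy
      · have hc : K.oneSkeleton.connectedComponentMk c.out = c := Quot.out_eq c
        exact ⟨⟨c.out, (congrArg Quot.out hc).symm⟩, hc⟩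
    have h2 := Fintype.card_subtype_compl fun x => x = root x
    have h3 := Fintype.card_subtype_le fun x => x = root x
    change Fintype.card V = _ at h2
    omega

/-- In each component some vertex is critical, since following matched edges must end. -/
theorem IsMorseMatching.card_lower_vertices_le {M : Finset (K.Face × K.Face)}
    (hM : K.IsMorseMatching M) :
    #{p ∈ M | #p.1.1 = 1} + K.numComponents ≤ Fintype.card (K.Simplex 1) := by
  classical
  let C : Finset (K.Simplex 1) := {x | ∀ p ∈ M, p.1 ≠ x.1}
  have h1 : K.numComponents ≤ #C := by
    rw [← Fintype.card_coe C]
    refine Fintype.card_le_of_surjective (fun x => K.oneSkeleton.connectedComponentMk x.1) ?_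
    intro c
    by_contra hcon
    push Not at hcon
    have hall : ∀ x, K.oneSkeleton.connectedComponentMk x = c → ∃ p ∈ M, p.1 = x.1 := by
      intro x hx
      by_contra hx'
      push Not at hx'
      exact hcon ⟨x, by simpa [C] using hx'⟩ hx
    obtain ⟨x0, hx0⟩ := c.exists_rep
    obtain ⟨p0, hp0, hp0e⟩ := hall x0 hx0
    obtain ⟨p, ⟨hp, x, hx, hpx⟩, hmax⟩ := hM.2.exists_no_successor hM.1
      (S := {p | p ∈ M ∧ ∃ x, K.oneSkeleton.connectedComponentMk x = c ∧ p.1 = x.1})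
      (fun p hp => hp.1) ⟨p0, hp0, x0, hx0, hp0e⟩
    have hc2 := hM.card_snd hp
    have hsub := hM.fst_subset_snd hp
    rw [hpx, x.2] at hc2
    obtain ⟨u, hu⟩ := card_eq_one.1 x.2
    have hup : u ∈ p.2.1 := hsub (by rw [hpx, hu]; simp)
    obtain ⟨v, hv, hvu⟩ := exists_mem_ne (by omega) u (s := p.2.1)
    have hx : x = vertexOf p.2.2 hup := Subtype.ext (Subtype.ext hu)
    have hadj := oneSkeleton_adj_vertexOf p.2.2 hup hv hvu.symm
    have hvc : K.oneSkeleton.connectedComponentMk (vertexOf p.2.2 hv) = c := by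
      rw [← SimpleGraph.ConnectedComponent.sound hadj.reachable, ← hx]
      assumption
    obtain ⟨q, hq, hqv⟩ := hall _ hvc
    refine hmax q ⟨hq, _, hvc, hqv⟩ ?_ ?_
    · rintro rfl
      apply hadj.1
      rw [← hx]
      exact Subtype.ext (hpx.symm.trans hqv)
    · rw [hqv]
      exact face_covBy_iff.2 ⟨singleton_subset_iff.2 hv, by rw [(vertexOf p.2.2 hv).2]; omega⟩
  have h2 : #{p ∈ M | #p.1.1 = 1} ≤ #Cᶜ := by
    rw [← card_image_of_injOn (f := Prod.fst) (s := {p ∈ M | #p.1.1 = 1}) fun p hp q hq h =>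
      hM.1.eq_of_fst_eq (mem_filter.1 hp).1 (mem_filter.1 hq).1 h]
    refine (card_le_card ?_).trans (card_image_le (s := Cᶜ) (f := Subtype.val))
    intro σ hσ
    obtain ⟨p, hp, rfl⟩ := mem_image.1 hσ
    obtain ⟨hpM, hp1⟩ := mem_filter.1 hp
    exact mem_image.2 ⟨⟨p.1, hp1⟩, mem_compl.2 fun h => (mem_filter.1 h).2 p hpM rfl, rfl⟩
  have h3 := card_add_card_compl C
  omega

end FiniteComplex

/-! ### A Morse matching from a feedback arc set -/

open DunceVertex in
/-- A collapse of the dunce hat to a spanning tree of its vertices, started at the free edge `sw`: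
pairs of an edge and a triangle, in the order of their removal.  The edges `ty` and `tz`, which may
be glued to free edges of other copies, remain. -/
def dunceCollapse : Fin 13 → Finset DunceVertex × Finset DunceVertex :=
  ![({s, w}, {s, w, b}), ({s, b}, {s, z, b}), ({w, b}, {w, y, b}), ({z, b}, {t, z, b}),
    ({y, b}, {t, y, b}), ({s, z}, {a, s, z}), ({w, y}, {a, w, y}), ({a, y}, {a, s, y}),
    ({s, y}, {s, t, y}), ({a, s}, {a, s, t}), ({a, t}, {a, w, t}), ({a, w}, {a, w, z}),
    ({w, z}, {w, t, z})]

theorem dunceCollapse_snd_mem (i : Fin 13) : (dunceCollapse i).2 ∈ dunceTriangles := by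
  revert i; decide +kernel

theorem dunceCollapse_snd_injective : Function.Injective fun i => (dunceCollapse i).2 := by
  unfold Function.Injective; decide +kernel

theorem dunceCollapse_fst_subset (i : Fin 13) : (dunceCollapse i).1 ⊆ (dunceCollapse i).2 := by
  revert i; decide +kernel

theorem card_dunceCollapse_fst (i : Fin 13) : #(dunceCollapse i).1 = 2 := by
  revert i; decide +kernel

/-- When a triangle is removed, its edge is in no other remaining triangle. -/
theorem le_of_dunceCollapse_subset {i j : Fin 13} (h : (dunceCollapse j).1 ⊆ (dunceCollapse i).2) :
    i ≤ j := by
  revert i j; decide +kernel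

theorem exists_unshared_dunceCollapse {i : Fin 13} (h : i ≠ 0) :
    ∃ x y, (dunceCollapse i).1 = {x, y} ∧ x.Unshared y := by
  revert i; decide +kernel

namespace DegThreeOrientedGraph

variable {G : DegThreeOrientedGraph}

/-- The `i`-th pair of the collapse in the copy at `e`. -/
def collapsePair (G : DegThreeOrientedGraph) (q : Fin G.m × Fin 13) :
    G.complex.Face × G.complex.Face :=
  (⟨G.glued q.1 (dunceCollapse q.2).1, FiniteComplex.mem_faces_of_subset
    (glued_mem_complex q.1 (dunceCollapse_snd_mem q.2))
    (glued_subset_glued.2 (dunceCollapse_fst_subset q.2)) (card_pos.1 (by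
      rw [card_glued, card_dunceCollapse_fst]; norm_num))⟩,
    G.triangle q.1 ⟨_, dunceCollapse_snd_mem q.2⟩)

theorem card_collapsePair_fst (q : Fin G.m × Fin 13) : #(G.collapsePair q).1.1 = 2 := by
  rw [collapsePair, card_glued, card_dunceCollapse_fst]

theorem card_collapsePair_snd (q : Fin G.m × Fin 13) : #(G.collapsePair q).2.1 = 3 :=
  card_triangle _ _

theorem collapsePair_fst_subset (q : Fin G.m × Fin 13) :
    (G.collapsePair q).1.1 ⊆ (G.collapsePair q).2.1 :=
  glued_subset_glued.2 (dunceCollapse_fst_subset q.2)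

theorem collapsePair_snd_inj {q q' : Fin G.m × Fin 13}
    (h : (G.collapsePair q).2 = (G.collapsePair q').2) : q = q' := by
  obtain ⟨h1, h2⟩ := triangle_inj.1 h
  exact Prod.ext h1 (dunceCollapse_snd_injective (congrArg Subtype.val h2))

/-- A path of the collapse either stays in one copy and proceeds there, or enters the copy of a
following arc at its free edge. -/
theorem collapse_step {e e' : Fin G.m} {i j : Fin 13}
    (h : (G.collapsePair (e', j)).1.1 ⊆ (G.collapsePair (e, i)).2.1) :
    (e' = e ∧ i ≤ j) ∨ (j = 0 ∧ G.src e' = G.tgt e) := by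
  change G.glued e' (dunceCollapse j).1 ⊆ G.glued e (dunceCollapse i).2 at h
  by_cases he : e' = e
  · subst he
    exact Or.inl ⟨rfl, le_of_dunceCollapse_subset (glued_subset_glued.1 h)⟩
  right
  by_cases hj : j = 0
  · refine ⟨hj, ?_⟩
    subst hj
    have hw : G.gluing e' .w ∈ G.glued e (dunceCollapse i).2 :=
      h (mem_image_of_mem _ (by decide))
    obtain ⟨x, -, hx⟩ := mem_image.1 hw
    change _ = G.ownLabel e' 0 at hx
    by_cases hyz : x = .y ∨ x = .z
    · rcases gluing_yz e hyz with ⟨f, hf, hfe⟩ | ⟨k, hk, hk0, -, -, hke⟩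
      · rw [hfe] at hx
        rw [← (ownLabel_inj (by norm_num) (by norm_num) hx).1]
        exact hf
      · rw [hke] at hx
        exact absurd (ownLabel_inj hk (by norm_num) hx).2 hk0
    · cases x <;> simp only [gluing] at hx
      · exact absurd hx.symm ownLabel_ne_vertex
      · exact absurd hx.symm ownLabel_ne_vertex
      · exact absurd (ownLabel_inj (by norm_num) (by norm_num) hx).1.symm he
      · simp at hyz
      · simp at hyz
      all_goals simpa using ownLabel_inj (by norm_num) (by norm_num) hx
  · obtain ⟨x, y, hxy, hu⟩ := exists_unshared_dunceCollapse hj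
    rw [hxy] at h
    exact absurd (eq_of_unshared_subset hu h) he

/-- A feedback arc set yields a Morse matching in which the copies at its arcs have one critical
triangle each, and all other triangles are matched. -/
theorem exists_isMorseMatching {F : Finset (Fin G.m)} (hF : G.IsFeedbackArcSet F) :
    ∃ M, G.complex.IsMorseMatching M ∧ #M + G.complex.numComponents + #F =
      13 * G.m + Fintype.card (G.complex.Simplex 1) := by
  classical
  let R := fun u w => ∃ e ∈ Fᶜ, G.src e = u ∧ G.tgt e = w
  -- The number of vertices from which the target of an arc can be reached.
  let r : Fin G.m → ℕ := fun e => #{v | Relation.ReflTransGen R v (G.tgt e)}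
  have hr : ∀ e e', e' ∉ F → G.src e' = G.tgt e → r e < r e' := by
    intro e e' he' h
    have hR : R (G.tgt e) (G.tgt e') := ⟨e', mem_compl.2 he', h, rfl⟩
    refine card_lt_card ⟨fun v hv => ?_, fun hsub => ?_⟩
    · simp only [mem_filter, mem_univ, true_and] at hv ⊢
      exact hv.tail hR
    · have := hsub (mem_filter.2 ⟨mem_univ _, Relation.ReflTransGen.refl⟩)
      simp only [mem_filter, mem_univ, true_and] at this
      exact hF _ (Relation.TransGen.tail' this hR)
  let I : Finset (Fin G.m × Fin 13) := {q | q.1 ∈ F → q.2 ≠ 0}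
  have hinj : Function.Injective G.collapsePair := fun q q' h =>
    collapsePair_snd_inj (congrArg Prod.snd h)
  have hI : #I + #F = 13 * G.m := by
    have h1 : #F = #Iᶜ := by
      rw [← card_image_of_injective (f := fun e => (e, (0 : Fin 13))) F
        fun e f h => congrArg Prod.fst h]
      congr 1
      ext ⟨e, i⟩
      simp [I, eq_comm]
    rw [h1, card_add_card_compl, Fintype.card_prod, Fintype.card_fin, Fintype.card_fin, mul_comm]
  have hstep : ∀ q ∈ I, ∀ q' ∈ I, (G.collapsePair q').1.1 ⊆ (G.collapsePair q).2.1 → q ≠ q' →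
      13 * r q.1 + q.2 < 13 * r q'.1 + q'.2 := by
    rintro ⟨e, i⟩ - ⟨e', j⟩ hq' h hne
    rcases collapse_step h with ⟨rfl, hij⟩ | ⟨rfl, hs⟩
    · have : i ≠ j := fun h => hne (h ▸ rfl)
      have : i < j := lt_of_le_of_ne hij this
      change 13 * r e' + (i : ℕ) < 13 * r e' + j
      have : (i : ℕ) < j := this
      omega
    · have he' : e' ∉ F := fun he' => (mem_filter.1 hq').2 he' rfl
      have := hr e e' he' hs
      have := i.2
      change 13 * r e + (i : ℕ) < 13 * r e' + (0 : Fin 13)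
      omega
  have hM : IsPartialMatching (I.image G.collapsePair) := by
    constructor
    · intro p hp
      obtain ⟨q, -, rfl⟩ := mem_image.1 hp
      exact FiniteComplex.face_covBy_iff.2 ⟨collapsePair_fst_subset q, by
        rw [card_collapsePair_fst, card_collapsePair_snd]⟩
    · intro p hp p' hp' x hx hx'
      obtain ⟨q, hq, rfl⟩ := mem_image.1 hp
      obtain ⟨q', hq', rfl⟩ := mem_image.1 hp'
      have h1 := card_collapsePair_fst q
      have h2 := card_collapsePair_snd q
      have h1' := card_collapsePair_fst q'
      have h2' := card_collapsePair_snd q'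
      rcases hx with rfl | rfl <;> rcases hx' with h | h
      · by_contra hne
        have hqq : q ≠ q' := fun h => hne (congrArg _ h)
        have hlt := hstep q hq q' hq' (by rw [← h]; exact collapsePair_fst_subset q) hqq
        have hgt := hstep q' hq' q hq (by rw [h]; exact collapsePair_fst_subset q') hqq.symm
        omega
      · rw [h] at h1; omega
      · rw [h] at h2; omega
      · rw [collapsePair_snd_inj h]
  obtain ⟨M, hMM, hcard⟩ := FiniteComplex.exists_isMorseMatching_extending hM
    (by
      intro p hp
      obtain ⟨q, -, rfl⟩ := mem_image.1 hp
      exact card_collapsePair_fst q)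
    (Function.extend G.collapsePair (fun q => 13 * r q.1 + q.2) 0) (by
      intro p hp p' hp' hne hcov
      obtain ⟨q, hq, rfl⟩ := mem_image.1 hp
      obtain ⟨q', hq', rfl⟩ := mem_image.1 hp'
      rw [hinj.extend_apply, hinj.extend_apply]
      exact hstep q hq q' hq' (FiniteComplex.face_covBy_iff.1 hcov).1 fun h => hne (congrArg _ h))
  refine ⟨M, hMM, ?_⟩
  rw [card_image_of_injective _ hinj] at hcard
  omega

/-! ### Optimal values -/

theorem exists_optMinFAS (G : DegThreeOrientedGraph) :
    ∃ F, G.IsFeedbackArcSet F ∧ #F = G.optMinFAS := by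
  have hne : {k | ∃ F, G.IsFeedbackArcSet F ∧ #F = k}.Nonempty :=
    ⟨_, univ, by rw [IsFeedbackArcSet, compl_univ]; exact G.acyclic_empty, rfl⟩
  exact Nat.sInf_mem hne

theorem optMinFAS_le {F : Finset (Fin G.m)} (hF : G.IsFeedbackArcSet F) : G.optMinFAS ≤ #F :=
  Nat.sInf_le ⟨F, hF, rfl⟩

theorem optMinFAS_le_compl {A : Finset (Fin G.m)} (hA : G.Acyclic A) : G.optMinFAS ≤ #Aᶜ :=
  optMinFAS_le (by rwa [IsFeedbackArcSet, compl_compl])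

theorem opt_OMAS3_add_optMinFAS (G : DegThreeOrientedGraph) :
    OMAS3.opt G + G.optMinFAS = G.m := by
  have hc : ∀ A : Finset (Fin G.m), #A + #Aᶜ = G.m := fun A => by
    rw [card_add_card_compl, Fintype.card_fin]
  have hmax : ∀ B : Finset (Fin G.m), G.Acyclic B → #B ≤ OMAS3.opt G :=
    fun B hB => (OMAS3.isGreatest_opt G).2 ⟨B, hB, rfl⟩
  obtain ⟨A, hA, hAc⟩ : ∃ A : Finset (Fin G.m), G.Acyclic A ∧ #A = OMAS3.opt G :=
    (OMAS3.isGreatest_opt G).1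
  obtain ⟨F, hF, hFc⟩ := G.exists_optMinFAS
  have h1 : #Fᶜ ≤ OMAS3.opt G := hmax _ hF
  have h2 := optMinFAS_le_compl hA
  have h3 := hc A
  have h4 := hc F
  omega

/-- The arcs that increase the number of the vertex and the arcs that decrease it both form acyclic
subgraphs. -/
theorem m_le_two_mul_opt (G : DegThreeOrientedGraph) : G.m ≤ 2 * OMAS3.opt G := by
  have hopt := (OMAS3.isGreatest_opt G).2
  have h1 : G.Acyclic {e | G.src e < G.tgt e} := by
    intro v hv
    have : ∀ u w, Relation.TransGen (fun u w => ∃ e ∈ ({e | G.src e < G.tgt e} : Finset (Fin G.m)),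
        G.src e = u ∧ G.tgt e = w) u w → u < w := by
      intro u w h
      induction h with
      | single h => obtain ⟨e, he, rfl, rfl⟩ := h; simpa using he
      | tail _ h ih => obtain ⟨e, he, rfl, rfl⟩ := h; exact ih.trans (by simpa using he)
    exact lt_irrefl _ (this v v hv)
  have h2 : G.Acyclic ({e | G.src e < G.tgt e} : Finset (Fin G.m))ᶜ := by
    intro v hv
    have hlt : ∀ e, e ∈ ({e | G.src e < G.tgt e} : Finset (Fin G.m))ᶜ → G.tgt e < G.src e := by
      intro e he
      simp only [mem_compl, mem_filter, mem_univ, true_and, not_lt] at he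
      exact lt_of_le_of_ne he (G.loopless e).symm
    have : ∀ u w, Relation.TransGen (fun u w => ∃ e ∈ ({e | G.src e < G.tgt e} :
        Finset (Fin G.m))ᶜ, G.src e = u ∧ G.tgt e = w) u w → w < u := by
      intro u w h
      induction h with
      | single h => obtain ⟨e, he, rfl, rfl⟩ := h; exact hlt e he
      | tail _ h ih => obtain ⟨e, he, rfl, rfl⟩ := h; exact (hlt e he).trans ih
    exact lt_irrefl _ (this v v hv)
  have h3 : #({e | G.src e < G.tgt e} : Finset (Fin G.m)) ≤ OMAS3.opt G := hopt ⟨_, h1, rfl⟩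
  have h4 : #({e | G.src e < G.tgt e} : Finset (Fin G.m))ᶜ ≤ OMAS3.opt G := hopt ⟨_, h2, rfl⟩
  have h5 := card_add_card_compl ({e | G.src e < G.tgt e} : Finset (Fin G.m))
  rw [Fintype.card_fin] at h5
  omega

theorem card_add_le_of_isMorseMatching {M : Finset (G.complex.Face × G.complex.Face)}
    (hM : G.complex.IsMorseMatching M) :
    #M + G.complex.numComponents + #(G.arcsOfMatching M)ᶜ ≤
      13 * G.m + Fintype.card (G.complex.Simplex 1) := by
  have h1 := hM.card_lower_vertices_le
  have h2 := card_upper_triangles_le hM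
  have h3 : #M ≤ #{p ∈ M | #p.1.1 = 1} + #{p ∈ M | #p.2.1 = 3} := by
    rw [← card_filter_add_card_filter_not (s := M) fun p => #p.1.1 = 1]
    refine Nat.add_le_add_left (card_le_card fun p hp => ?_) _
    obtain ⟨hp, hp1⟩ := mem_filter.1 hp
    refine mem_filter.2 ⟨hp, ?_⟩
    have := hM.card_snd hp
    have := card_le_three p.2.2
    have := card_pos.2 (FiniteComplex.face_nonempty p.1)
    omega
  omega

theorem opt_MaxMM_add (G : DegThreeOrientedGraph) :
    MaxMM.opt G.complex + 2 * G.complex.numComponents + 2 * G.optMinFAS =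
      2 * (13 * G.m) + 2 * Fintype.card (G.complex.Simplex 1) := by
  obtain ⟨⟨M, hM, hMc⟩, hmax⟩ := MaxMM.isGreatest_opt G.complex
  obtain ⟨F, hF, hFc⟩ := G.exists_optMinFAS
  obtain ⟨M', hM', hc'⟩ := exists_isMorseMatching hF
  have h1 : #(FiniteComplex.matched M') ≤ MaxMM.opt G.complex := hmax ⟨M', hM', rfl⟩
  change #(FiniteComplex.matched M) = _ at hMc
  have hM : G.complex.IsMorseMatching M := hM
  rw [hM'.card_matched] at h1
  rw [hM.card_matched] at hMc
  have h2 := card_add_le_of_isMorseMatching hM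
  have h3 := optMinFAS_le_compl (acyclic_arcsOfMatching hM)
  omega

theorem numSimplices_add (𝔽 : Type*) [Field 𝔽] (G : DegThreeOrientedGraph) :
    G.complex.numSimplices + 2 * G.complex.numComponents =
      2 * (13 * G.m) + 2 * Fintype.card (G.complex.Simplex 1) +
        ∑ i ∈ Finset.range 3, G.complex.betti 𝔽 i := by
  have h4 : IsEmpty (G.complex.Simplex 4) := ⟨fun σ => by
    have := card_le_three σ.1.2
    rw [σ.2] at this
    omega⟩
  obtain ⟨h2, hE⟩ := FiniteComplex.card_add_card_eq_of_injective
    (boundary_two_injective (𝔽 := 𝔽) (G := G)) h4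
  rw [FiniteComplex.numSimplices_eq fun σ hσ => card_le_three hσ, sum_range_succ, sum_range_succ,
    sum_range_one, h2]
  rw [FiniteComplex.betti_zero] at *
  rw [card_simplex_three] at *
  omega

theorem opt_MaxMM_eq (𝔽 : Type*) [Field 𝔽] (G : DegThreeOrientedGraph) :
    (MaxMM.opt G.complex : ℤ) = (G.complex.numSimplices : ℤ) - 2 * (G.optMinFAS : ℤ)
        - ∑ i ∈ Finset.range 3, (G.complex.betti 𝔽 i : ℤ) := by
  have h1 := G.opt_MaxMM_add
  have h2 := numSimplices_add 𝔽 G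
  rw [← Nat.cast_sum]
  omega

theorem opt_MaxMM_le (G : DegThreeOrientedGraph) : MaxMM.opt G.complex ≤ 78 * OMAS3.opt G := by
  have h1 := opt_MaxMM_eq ℚ G
  have h2 := G.numSimplices_le
  have h3 := G.m_le_two_mul_opt
  rw [← Nat.cast_sum] at h1
  omega

theorem opt_gap_le {M : Finset (G.complex.Face × G.complex.Face)}
    (hM : G.complex.IsMorseMatching M) :
    (OMAS3.opt G : ℝ) - OMAS3.value G (G.arcsOfMatching M) ≤
      1 / 2 * ((MaxMM.opt G.complex : ℝ) - MaxMM.value G.complex M) := by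
  have h1 := card_add_le_of_isMorseMatching hM
  have h2 := G.opt_MaxMM_add
  have h3 := G.opt_OMAS3_add_optMinFAS
  have h4 := card_add_card_compl (G.arcsOfMatching M)
  rw [Fintype.card_fin] at h4
  have hv : MaxMM.value G.complex M = 2 * #M := hM.card_matched
  have hv' : OMAS3.value G (G.arcsOfMatching M) = #(G.arcsOfMatching M) := rfl
  rw [hv, hv']
  have key : 2 * OMAS3.opt G + 2 * #M ≤ MaxMM.opt G.complex + 2 * #(G.arcsOfMatching M) := by
    omega
  have key : (2 * OMAS3.opt G + 2 * #M : ℝ) ≤ MaxMM.opt G.complex + 2 * #(G.arcsOfMatching M) := by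
    exact_mod_cast key
  push_cast
  linarith

end DegThreeOrientedGraph

/-! ### Reasoning about programs -/

namespace RAM

/-- Started in `s`, the program `p` halts within `T` steps in a configuration that satisfies `Q`. -/
def Reaches (p : Prog) (s : State) (T : ℕ) (Q : State → Prop) : Prop :=
  ∃ t s', Run p s t s' ∧ t ≤ T ∧ Q s'

theorem Reaches.mono {p : Prog} {s : State} {T T' : ℕ} {Q Q' : State → Prop}
    (h : Reaches p s T Q) (hT : T ≤ T') (hQ : ∀ s', Q s' → Q' s') : Reaches p s T' Q' := by
  obtain ⟨t, s', hr, ht, hq⟩ := h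
  exact ⟨t, s', hr, ht.trans hT, hQ s' hq⟩

theorem Reaches.seq {p q : Prog} {s : State} {T T' : ℕ} {Q Q' : State → Prop}
    (h : Reaches p s T Q) (h' : ∀ s', Q s' → Reaches q s' T' Q') :
    Reaches (.seq p q) s (T + T') Q' := by
  obtain ⟨t, s', hr, ht, hq⟩ := h
  obtain ⟨t', s'', hr', ht', hq'⟩ := h' s' hq
  exact ⟨t + t', s'', .seq hr hr', by omega, hq'⟩

/-- The rule for a loop that treats the elements of a list one after the other, while a register
counts those that remain.  The arguments of the invariant are the elements already treated and
those still to come. -/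
theorem Reaches.loop_list {α : Type*} {x : ℕ} {p : Prog} {T : ℕ}
    (Inv : List α → List α → State → Prop)
    (hstep : ∀ d a t s, Inv d (a :: t) s → s.reg x = t.length + 1 →
      Reaches p s T fun s' => Inv (d ++ [a]) t s' ∧ s'.reg x = t.length) :
    ∀ t d s, Inv d t s → s.reg x = t.length →
      Reaches (.loop x p) s (t.length * (T + 1) + 1) fun s' => Inv (d ++ t) [] s' := by
  intro t
  induction t with
  | nil =>
    intro d s h hx
    exact ⟨1, s, .loop_done hx, by simp, by simpa using h⟩
  | cons a t ih =>
    intro d s h hx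
    obtain ⟨k, s', hr, hk, hI, hx'⟩ := hstep d a t s h hx
    obtain ⟨k', s'', hr', hk', hI'⟩ := ih _ s' hI hx'
    refine ⟨k + k' + 1, s'', .loop_step (by rw [hx]; simp) hr hr', ?_, by simpa using hI'⟩
    rw [List.length_cons, Nat.succ_mul]
    omega

/-- The composition of a list of programs. -/
def Prog.seqs : List Prog → Prog
  | [] => .skip
  | p :: l => .seq p (seqs l)

/-- The program contains no loop. -/
def Prog.Flat : Prog → Bool
  | seq p q => p.Flat && q.Flat
  | ite _ p q => p.Flat && q.Flat
  | loop _ _ => false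
  | _ => true

/-- The effect of a program without loops; a loop is treated as if its body were never run. -/
def Prog.exec : Prog → State → State
  | skip, s => s
  | const x n, s => s.set x n
  | add x y z, s => s.set x (s.reg y + s.reg z)
  | sub x y z, s => s.set x (s.reg y - s.reg z)
  | load x y, s => s.set x (s.mem (s.reg y))
  | store x y, s => { s with mem := Function.update s.mem (s.reg x) (s.reg y) }
  | read x, s => { s.set x (s.inp.headD 0) with inp := s.inp.tail }
  | write x, s => { s with out := s.out ++ [s.reg x] }
  | seq p q, s => q.exec (p.exec s)
  | ite x p q, s => if s.reg x = 0 then q.exec s else p.exec s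
  | loop _ _, s => s

/-- A bound for the running time of a program without loops. -/
def Prog.cost : Prog → ℕ
  | seq p q => p.cost + q.cost
  | ite _ p q => p.cost + q.cost + 1
  | _ => 1

theorem exists_run_exec {p : Prog} (h : p.Flat = true) (s : State) :
    ∃ t, Run p s t (p.exec s) ∧ t ≤ p.cost := by
  induction p generalizing s with
  | skip => exact ⟨1, .skip s, le_rfl⟩
  | const x n => exact ⟨1, .const s x n, le_rfl⟩
  | add x y z => exact ⟨1, .add s x y z, le_rfl⟩
  | sub x y z => exact ⟨1, .sub s x y z, le_rfl⟩
  | load x y => exact ⟨1, .load s x y, le_rfl⟩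
  | store x y => exact ⟨1, .store s x y, le_rfl⟩
  | read x => exact ⟨1, .read s x, le_rfl⟩
  | write x => exact ⟨1, .write s x, le_rfl⟩
  | seq p q ihp ihq =>
    simp only [Prog.Flat, Bool.and_eq_true] at h
    obtain ⟨t, hr, ht⟩ := ihp h.1 s
    obtain ⟨t', hr', ht'⟩ := ihq h.2 (p.exec s)
    exact ⟨t + t', .seq hr hr', by simp only [Prog.cost]; omega⟩
  | ite x p q ihp ihq =>
    simp only [Prog.Flat, Bool.and_eq_true] at h
    by_cases hx : s.reg x = 0
    · obtain ⟨t, hr, ht⟩ := ihq h.2 s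
      exact ⟨t + 1, by rw [Prog.exec, if_pos hx]; exact .ite_false hx hr,
        by simp only [Prog.cost]; omega⟩
    · obtain ⟨t, hr, ht⟩ := ihp h.1 s
      exact ⟨t + 1, by rw [Prog.exec, if_neg hx]; exact .ite_true hx hr,
        by simp only [Prog.cost]; omega⟩
  | loop x p => simp [Prog.Flat] at h

theorem Reaches.flat {p : Prog} (h : p.Flat = true) {s : State} {Q : State → Prop}
    (hQ : Q (p.exec s)) : Reaches p s p.cost Q := by
  obtain ⟨t, hr, ht⟩ := exists_run_exec h s
  exact ⟨t, _, hr, ht, hQ⟩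

/-- The registers to which a program assigns. -/
def Prog.targets : Prog → List ℕ
  | const x _ | add x _ _ | sub x _ _ | load x _ | read x => [x]
  | seq p q | ite _ p q => p.targets ++ q.targets
  | loop _ p => p.targets
  | _ => []

/-- The program changes neither the memory nor the tapes. -/
def Prog.Quiet : Prog → Bool
  | store _ _ | read _ | write _ => false
  | seq p q | ite _ p q => p.Quiet && q.Quiet
  | loop _ p => p.Quiet
  | _ => true

theorem Run.reg_eq {p : Prog} {s s' : State} {t : ℕ} (h : Run p s t s') {r : ℕ}
    (hr : r ∉ p.targets) : s'.reg r = s.reg r := by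
  induction h <;> simp_all [Prog.targets, State.set]

theorem Run.quiet {p : Prog} {s s' : State} {t : ℕ} (h : Run p s t s') (hq : p.Quiet = true) :
    s'.mem = s.mem ∧ s'.inp = s.inp ∧ s'.out = s.out := by
  induction h <;> simp_all [Prog.Quiet, State.set]

theorem Reaches.frame {p : Prog} {s : State} {T : ℕ} {Q : State → Prop} (h : Reaches p s T Q) :
    Reaches p s T fun s' => Q s' ∧ ∀ r, r ∉ p.targets → s'.reg r = s.reg r := by
  obtain ⟨t, s', hr, ht, hQ⟩ := h
  exact ⟨t, s', hr, ht, hQ, fun r h => hr.reg_eq h⟩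

theorem Reaches.quiet {p : Prog} (hq : p.Quiet = true) {s : State} {T : ℕ} {Q : State → Prop}
    (h : Reaches p s T Q) :
    Reaches p s T fun s' => Q s' ∧ s'.mem = s.mem ∧ s'.inp = s.inp ∧ s'.out = s.out := by
  obtain ⟨t, s', hr, ht, hQ⟩ := h
  exact ⟨t, s', hr, ht, hQ, hr.quiet hq⟩

@[simp] theorem State.set_reg (s : State) (x v r : ℕ) :
    (s.set x v).reg r = if r = x then v else s.reg r := by
  simp [State.set, Function.update_apply]

@[simp] theorem State.set_mem (s : State) (x v : ℕ) : (s.set x v).mem = s.mem := rfl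

@[simp] theorem State.set_inp (s : State) (x v : ℕ) : (s.set x v).inp = s.inp := rfl

@[simp] theorem State.set_out (s : State) (x v : ℕ) : (s.set x v).out = s.out := rfl

/-- A memory with the entries of a list at its first addresses, and zeros elsewhere. -/
def ofList (l : List ℕ) : ℕ → ℕ := fun i => l.getD i 0

theorem update_ofList (l : List ℕ) (v : ℕ) :
    Function.update (ofList l) l.length v = ofList (l ++ [v]) := by
  ext i
  rw [Function.update_apply]
  unfold ofList
  split_ifs with h
  · subst h; simp
  · rcases Nat.lt_or_ge i l.length with hi | hi
    · rw [List.getD_append _ _ _ _ hi]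
    · rw [List.getD_eq_default _ _ hi, List.getD_eq_default _ _ (by simp; omega)]

theorem ofList_append_left {l l' : List ℕ} {i : ℕ} (h : i < l.length) :
    ofList (l ++ l') i = ofList l i := List.getD_append _ _ _ _ h

theorem ofList_append_right (l l' : List ℕ) (i : ℕ) :
    ofList (l ++ l') (l.length + i) = ofList l' i := by
  rw [ofList, List.getD_append_right _ _ _ _ (by omega), Nat.add_sub_cancel_left]
  rfl

end RAM

/-! ### Reading a graph and computing the labels of a copy -/

namespace DegThreeOrientedGraph

open RAM RAM.Prog

variable {G : DegThreeOrientedGraph}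

/-- The arcs as they are written on the tape. -/
def arcList (G : DegThreeOrientedGraph) : List ℕ :=
  (List.finRange G.m).flatMap fun e => [(G.src e : ℕ), (G.tgt e : ℕ)]

theorem length_arcList : G.arcList.length = 2 * G.m := by
  simp [arcList, mul_comm]

theorem eq_length_of_append_cons {m : ℕ} {d t : List (Fin m)} {e : Fin m}
    (h : d ++ e :: t = List.finRange m) : (e : ℕ) = d.length := by
  have h1 : (List.finRange m)[d.length]? = some e := by rw [← h]; simp
  obtain ⟨_, h2⟩ := List.getElem?_eq_some_iff.1 h1
  rw [← h2]
  simp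

theorem getD_flatMap_pair {α : Type*} (f g : α → ℕ) (L : List α) (i : ℕ) (h : i < L.length) :
    ofList (L.flatMap fun x => [f x, g x]) (2 * i) = f L[i] ∧
      ofList (L.flatMap fun x => [f x, g x]) (2 * i + 1) = g L[i] := by
  induction L generalizing i with
  | nil => simp at h
  | cons x L ih =>
    cases i with
    | zero => simp [ofList]
    | succ i =>
      have := ih i (by simpa using h)
      simpa [ofList, Nat.mul_add] using this

theorem ofList_arcList (l : List ℕ) (e : Fin G.m) :
    ofList (G.arcList ++ l) (2 * e) = G.src e ∧ ofList (G.arcList ++ l) (2 * e + 1) = G.tgt e := by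
  have he := e.2
  have hlen := length_arcList (G := G)
  rw [ofList_append_left (by omega), ofList_append_left (by omega)]
  have := getD_flatMap_pair (fun e => (G.src e : ℕ)) (fun e => (G.tgt e : ℕ))
    (List.finRange G.m) e (by simp)
  simpa [arcList] using this

/-- Reads a graph: `n` into register 0, `m` into register 4, and the arcs into the memory, whose
first free address is kept in register 5.  Registers 1, 2, 3 and 9 are set to 1, 2, 3 and 5, and
register 40 to `91 * m`, the number of faces of all triangles of all copies. -/
def readGraph : Prog :=
  .seq (seqs [.const 1 1, .const 2 2, .const 3 3, .const 9 5, .const 41 91, .const 40 0,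
    .const 5 0, .const 22 0, .read 0, .read 4, .add 6 4 22])
  (.loop 6 (seqs [.read 21, .store 5 21, .add 5 5 1, .read 21, .store 5 21, .add 5 5 1,
    .add 40 40 41, .sub 6 6 1]))

/-- The constants, the sizes and the arcs of the graph are in place, the latter followed in the
memory by the list `l`. -/
def HasGraph (G : DegThreeOrientedGraph) (l : List ℕ) (s : State) : Prop :=
  s.reg 0 = G.n ∧ s.reg 1 = 1 ∧ s.reg 2 = 2 ∧ s.reg 3 = 3 ∧ s.reg 4 = G.m ∧ s.reg 9 = 5 ∧
    s.mem = ofList (G.arcList ++ l)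

theorem readGraph_spec (G : DegThreeOrientedGraph) {s : State} {rest : List ℕ}
    (hinp : s.inp = G.code ++ rest) (hmem : s.mem = ofList []) :
    Reaches readGraph s (20 * G.m + 20) fun s' => HasGraph G [] s' ∧ s'.inp = rest ∧
      s'.out = s.out ∧ s'.reg 5 = 2 * G.m ∧ s'.reg 40 = 91 * G.m := by
  let cd : List (Fin G.m) → List ℕ := fun L => L.flatMap fun e => [(G.src e : ℕ), (G.tgt e : ℕ)]
  have hcd : ∀ L, (cd L).length = 2 * L.length := fun L => by simp [cd, mul_comm]
  refine (Reaches.seq (Q := fun s' => (s'.reg 0 = G.n ∧ s'.reg 1 = 1 ∧ s'.reg 2 = 2 ∧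
    s'.reg 3 = 3 ∧ s'.reg 4 = G.m ∧ s'.reg 9 = 5 ∧ s'.reg 41 = 91) ∧ s'.reg 40 = 0 ∧
    s'.reg 5 = 0 ∧ s'.mem = ofList [] ∧
    s'.inp = cd (List.finRange G.m) ++ rest ∧ s'.out = s.out ∧ s'.reg 6 = G.m)
    (Reaches.flat rfl ?_) fun s1 h1 => ?_).mono (T := 12 + (G.m * (9 + 1) + 1)) (by omega)
    fun s' h => h
  · simp [Prog.exec, seqs, hinp, hmem, code, cd]
  · obtain ⟨hc, h40, h5, hm, hi, ho, h6⟩ := h1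
    have := Reaches.loop_list (x := 6) (p := (seqs [.read 21, .store 5 21, .add 5 5 1, .read 21,
      .store 5 21, .add 5 5 1, .add 40 40 41, .sub 6 6 1])) (T := 9) (α := Fin G.m)
      (fun d t s' => (s'.reg 0 = G.n ∧ s'.reg 1 = 1 ∧ s'.reg 2 = 2 ∧
        s'.reg 3 = 3 ∧ s'.reg 4 = G.m ∧ s'.reg 9 = 5 ∧ s'.reg 41 = 91) ∧
        s'.reg 40 = 91 * d.length ∧ s'.reg 5 = 2 * d.length ∧
        s'.mem = ofList (cd d) ∧ s'.inp = cd t ++ rest ∧ s'.out = s.out) ?_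
      (List.finRange G.m) [] s1 ⟨hc, by simpa using h40, by simpa using h5, hm, hi, ho⟩
      (by simpa using h6)
    · refine this.mono (by simp) fun s' h => ?_
      obtain ⟨⟨a0, a1, a2, a3, a4, a9, -⟩, h40, h5, hm, hi, ho⟩ := h
      simp only [List.nil_append, List.length_finRange] at h40 h5
      refine ⟨⟨a0, a1, a2, a3, a4, a9, ?_⟩, by simpa [cd] using hi, ho, h5, h40⟩
      simp [hm, cd, arcList]
    · rintro d e t s' ⟨⟨a0, a1, a2, a3, a4, a9, a41⟩, h40, h5, hm, hi, ho⟩ h6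
      refine (Reaches.flat rfl ?_)
      have hd := hcd d
      have e1 : Function.update (ofList (cd d)) (2 * d.length) (G.src e : ℕ) =
          ofList (cd d ++ [(G.src e : ℕ)]) := by rw [← hd, update_ofList]
      have e2 : Function.update (ofList (cd d ++ [(G.src e : ℕ)])) (2 * d.length + 1)
          (G.tgt e : ℕ) = ofList (cd (d ++ [e])) := by
        rw [← hd]
        have := update_ofList (cd d ++ [(G.src e : ℕ)]) (G.tgt e)
        rw [List.length_append, List.length_singleton] at this
        rw [this]
        simp [cd]
      have hi' : s'.inp = (G.src e : ℕ) :: (G.tgt e : ℕ) :: (cd t ++ rest) := by simp [hi, cd]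
      simp [Prog.exec, seqs, hi', a0, a1, a2, a3, a4, a9, a41, h40, h5, h6, hm, ho, e1, e2]
      omega

/-- The register for the label of a vertex of the current copy. -/
def labelReg : DunceVertex → ℕ
  | .s => 10
  | .t => 11
  | .w => 12
  | .y => 13
  | .z => 14
  | .a => 15
  | .b => 16

/-- The body of the search for the arcs that leave the target of the current arc.  Register 18
holds the address of the arc that is examined, register 19 the label of `w` in its copy, and
register 20 the number of the vertices among `y`, `z` for which no arc has been found yet. -/
def labelsBody : Prog :=
  seqs [.load 21 18, .sub 22 21 11, .sub 23 11 21, .add 22 22 23,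
    .ite 22 .skip (.ite 20 (seqs [.sub 20 20 1, .const 23 0, .ite 20 (.add 13 19 23) (.add 14 19 23)])
      .skip),
    .add 18 18 2, .add 19 19 9, .sub 17 17 1]

/-- Computes the labels of the copy at the arc whose address in the memory is in register 7, while
register 8 holds the first own label of the copy. -/
def labels : Prog :=
  .seq (seqs [.const 22 0, .load 10 7, .add 21 7 1, .load 11 21, .add 12 8 22, .add 15 12 1,
    .add 16 15 1, .add 13 16 1, .add 14 13 1, .add 17 4 22, .const 18 0, .add 19 0 22,
    .add 20 2 22])
  (.loop 17 labelsBody)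

/-- The label chosen for `y` or `z`, given the arc found for it, if any, and the default. -/
def chosenLabel (G : DegThreeOrientedGraph) (f : Option (Fin G.m)) (k : ℕ) : ℕ :=
  match f with
  | some f => G.ownLabel f 0
  | none => k

theorem gluing_y (e : Fin G.m) :
    G.gluing e .y = G.chosenLabel (G.outArcs (G.tgt e))[0]? (G.ownLabel e 3) := by
  cases h : (G.outArcs (G.tgt e))[0]? <;> simp [gluing, chosenLabel, h]

theorem gluing_z (e : Fin G.m) :
    G.gluing e .z = G.chosenLabel (G.outArcs (G.tgt e))[1]? (G.ownLabel e 4) := by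
  cases h : (G.outArcs (G.tgt e))[1]? <;> simp [gluing, chosenLabel, h]

/-- The current arc has the number `k`: registers 7 and 8 hold its address and its first own label. -/
def AtArc (G : DegThreeOrientedGraph) (k : ℕ) (s : State) : Prop :=
  s.reg 7 = 2 * k ∧ s.reg 8 = G.n + 5 * k

theorem labels_spec (e : Fin G.m) {l : List ℕ} {s : State} (hG : HasGraph G l s)
    (he : AtArc G e s) :
    Reaches labels s (20 * G.m + 20) fun s' => (∀ x, s'.reg (labelReg x) = G.gluing e x) ∧
      (∀ r, r < 10 ∨ 25 ≤ r → s'.reg r = s.reg r) ∧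
      s'.mem = s.mem ∧ s'.inp = s.inp ∧ s'.out = s.out := by
  suffices h : Reaches labels s (20 * G.m + 20) fun s' =>
      ∀ x, s'.reg (labelReg x) = G.gluing e x by
    refine (h.frame.quiet rfl).mono le_rfl fun s' h => ⟨h.1.1, fun r hr => h.1.2 r ?_, h.2⟩
    have : ∀ r ∈ labels.targets, 10 ≤ r ∧ r < 25 := by decide
    intro hmem
    have := this r hmem
    omega
  obtain ⟨h0, h1, h2, h3, h4, h9, hm⟩ := hG
  obtain ⟨h7, h8⟩ := he
  have harc := fun f => ofList_arcList (G := G) l f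
  have hown : ∀ k, G.ownLabel e k = G.n + 5 * e + k := fun k => rfl
  refine (Reaches.seq (Q := fun s' => (s'.reg 10 = G.src e ∧ s'.reg 11 = G.tgt e ∧
    s'.reg 12 = G.ownLabel e 0 ∧ s'.reg 15 = G.ownLabel e 1 ∧ s'.reg 16 = G.ownLabel e 2 ∧
    s'.reg 1 = 1 ∧ s'.reg 2 = 2 ∧ s'.reg 9 = 5 ∧ s'.mem = ofList (G.arcList ++ l)) ∧
    s'.reg 13 = G.ownLabel e 3 ∧ s'.reg 14 = G.ownLabel e 4 ∧ s'.reg 17 = G.m ∧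
    s'.reg 18 = 0 ∧ s'.reg 19 = G.n ∧ s'.reg 20 = 2)
    (Reaches.flat rfl ?_) fun s1 hs1 => ?_).mono (T := 14 + (G.m * (18 + 1) + 1)) (by omega)
    fun s' h => h
  · simp [Prog.exec, seqs, h0, h1, h2, h4, h7, h8, h9, hm, harc, hown]
  obtain ⟨hc, h13, h14, h17, h18, h19, h20⟩ := hs1
  have hloop := Reaches.loop_list (x := 17) (p := labelsBody) (T := 18) (α := Fin G.m)
    (fun d t s' => d ++ t = List.finRange G.m ∧ (s'.reg 10 = G.src e ∧ s'.reg 11 = G.tgt e ∧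
      s'.reg 12 = G.ownLabel e 0 ∧ s'.reg 15 = G.ownLabel e 1 ∧ s'.reg 16 = G.ownLabel e 2 ∧
      s'.reg 1 = 1 ∧ s'.reg 2 = 2 ∧ s'.reg 9 = 5 ∧ s'.mem = ofList (G.arcList ++ l)) ∧
      s'.reg 13 = G.chosenLabel (d.filter fun f => G.src f = G.tgt e)[0]? (G.ownLabel e 3) ∧
      s'.reg 14 = G.chosenLabel (d.filter fun f => G.src f = G.tgt e)[1]? (G.ownLabel e 4) ∧
      s'.reg 18 = 2 * d.length ∧ s'.reg 19 = G.n + 5 * d.length ∧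
      s'.reg 20 = 2 - (d.filter fun f => G.src f = G.tgt e).length) ?_
    (List.finRange G.m) [] s1 ⟨rfl, hc, by simpa [chosenLabel] using h13,
      by simpa [chosenLabel] using h14, by simpa using h18, by simpa using h19,
      by simpa using h20⟩ (by simpa using h17)
  · refine hloop.mono (by simp) fun s' h => ?_
    obtain ⟨-, ⟨h10, h11, h12, h15, h16, -⟩, h13, h14, -⟩ := h
    intro x
    cases x with
    | s => exact h10
    | t => exact h11
    | w => exact h12
    | y => rw [gluing_y]; exact h13
    | z => rw [gluing_z]; exact h14
    | a => exact h15
    | b => exact h16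
  · rintro d f t s' ⟨hd, ⟨h10, h11, h12, h15, h16, h1, h2, h9, hm⟩, h13, h14, h18, h19, h20⟩ h17
    have hf : (f : ℕ) = d.length := eq_length_of_append_cons hd
    have hsrc : s'.mem (2 * d.length) = G.src f := by rw [hm, ← hf]; exact (harc f).1
    have hlab : G.n + 5 * d.length = G.ownLabel f 0 := by rw [← hf]; rfl
    refine Reaches.flat rfl ?_
    have hd' : (d ++ [f]) ++ t = List.finRange G.m := by rw [← hd]; simp
    rw [List.filter_append]
    by_cases hft : G.src f = G.tgt e
    · have hfil : [f].filter (fun f => G.src f = G.tgt e) = [f] := by simp [hft]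
      rw [hfil]
      generalize d.filter (fun f => G.src f = G.tgt e) = A at *
      rcases A with _ | ⟨x, _ | ⟨y, A⟩⟩ <;>
        simp [Prog.exec, seqs, labelsBody, h10, h11, h12, h13, h14, h15, h16, h17, h18, h19, h20,
          h1, h2, h9, hm, hsrc, hft, hlab, hd', chosenLabel] <;> omega
    · have hfil : [f].filter (fun f => G.src f = G.tgt e) = [] := by simp [hft]
      have hne : ¬ ((G.src f : ℕ) - G.tgt e = 0 ∧ (G.tgt e : ℕ) - G.src f = 0) := by
        have : (G.src f : ℕ) ≠ G.tgt e := fun h => hft (Fin.ext h)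
        omega
      rw [hfil, List.append_nil]
      simp [Prog.exec, seqs, labelsBody, h10, h11, h12, h13, h14, h15, h16, h17, h18, h19, h20,
          h1, h2, h9, hm, hsrc, hne, hd']
      omega

end DegThreeOrientedGraph

/-! ### Writing the complex -/

open DunceVertex in
/-- The triangles of the dunce hat as triples. -/
def dunceTriples : List (DunceVertex × DunceVertex × DunceVertex) :=
  [(s, w, b), (a, s, t), (a, s, y), (a, s, z), (a, w, t), (a, w, y), (a, w, z), (s, t, y),
    (s, z, b), (w, t, z), (w, y, b), (t, y, b), (t, z, b)]

theorem mem_dunceTriangles_iff {τ : Finset DunceVertex} :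
    τ ∈ dunceTriangles ↔ ∃ q ∈ dunceTriples, {q.1, q.2.1, q.2.2} = τ := by
  revert τ; decide +kernel

/-- The faces of the triangles of the dunce hat as lists, with repetitions. -/
def dunceFaceLists : List (List DunceVertex) :=
  dunceTriples.flatMap fun q => [[q.1], [q.2.1], [q.2.2], [q.1, q.2.1], [q.1, q.2.2],
    [q.2.1, q.2.2], [q.1, q.2.1, q.2.2]]

theorem mem_dunceFaces_iff {ρ : Finset DunceVertex} :
    ρ ∈ dunceHat.faces ↔ ∃ vs ∈ dunceFaceLists, vs.toFinset = ρ := by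
  rw [← mem_dunceFaces]
  have h : dunceFaces = (dunceFaceLists.map List.toFinset).toFinset := by decide +kernel
  rw [h]
  simp

theorem nodup_of_mem_dunceFaceLists : ∀ vs ∈ dunceFaceLists, vs.Nodup := by decide +kernel

namespace RAM

/-- Writes the contents of a list of registers. -/
def writeRegs (L : List ℕ) : Prog := Prog.seqs (L.map .write)

theorem flat_writeRegs (L : List ℕ) : (writeRegs L).Flat = true := by
  induction L with
  | nil => rfl
  | cons r L ih => exact ih

theorem cost_writeRegs (L : List ℕ) : (writeRegs L).cost = L.length + 1 := by
  induction L with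
  | nil => rfl
  | cons r L ih =>
    change 1 + (writeRegs L).cost = _
    rw [ih, List.length_cons]
    omega

theorem exec_writeRegs (L : List ℕ) (s : State) :
    (writeRegs L).exec s = { s with out := s.out ++ L.map s.reg } := by
  induction L generalizing s with
  | nil => simp [writeRegs, Prog.seqs, Prog.exec]
  | cons r L ih =>
    change (writeRegs L).exec { s with out := s.out ++ [s.reg r] } = _
    rw [ih]
    simp

end RAM

namespace DegThreeOrientedGraph

open RAM RAM.Prog

variable {G : DegThreeOrientedGraph}

/-- The registers whose contents form the code of the faces of the current copy; the registers 1,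
2 and 3 contain their own numbers. -/
def faceRegs : List ℕ := dunceFaceLists.flatMap fun vs => vs.length :: vs.map labelReg

/-- The code of the faces of the copy at an arc. -/
def faceCode (G : DegThreeOrientedGraph) (e : Fin G.m) : List ℕ :=
  dunceFaceLists.flatMap fun vs => FiniteComplex.simplexCode (vs.map (G.gluing e))

theorem map_faceRegs {e : Fin G.m} {s : State} (h1 : s.reg 1 = 1) (h2 : s.reg 2 = 2)
    (h3 : s.reg 3 = 3) (h : ∀ x, s.reg (labelReg x) = G.gluing e x) :
    faceRegs.map s.reg = G.faceCode e := by
  have hlen : ∀ vs ∈ dunceFaceLists, vs.length = 1 ∨ vs.length = 2 ∨ vs.length = 3 := by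
    decide +kernel
  rw [faceRegs, faceCode, List.map_flatMap]
  refine List.flatMap_congr fun vs hvs => ?_
  rw [FiniteComplex.simplexCode, List.map_cons, List.map_map, List.length_map]
  congr 1
  · rcases hlen vs hvs with h | h | h <;> rw [h] <;> assumption
  · exact List.map_congr_left fun x _ => h x

/-- Turns the code of a graph into a code of its complex. -/
def complexProg : Prog :=
  .seq readGraph (.seq (seqs [.write 40, .const 22 0, .add 8 0 22, .const 7 0, .add 6 4 22])
    (.loop 6 (.seq labels (.seq (writeRegs faceRegs)
      (seqs [.add 7 7 2, .add 8 8 9, .sub 6 6 1])))))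

theorem complexProg_spec (G : DegThreeOrientedGraph) :
    Reaches complexProg (init G.code) (400 * (G.m + 1) ^ 2) fun s =>
      s.out = 91 * G.m :: (List.finRange G.m).flatMap G.faceCode := by
  have key := (readGraph_spec G (s := init G.code) (rest := []) (by simp [init]) (by
      ext i; simp [init, ofList])).seq (T' := 6 + (G.m * ((20 * G.m + 20 + (248 + 4)) + 1) + 1))
    (q := .seq (seqs [.write 40, .const 22 0, .add 8 0 22, .const 7 0, .add 6 4 22])
    (.loop 6 (.seq labels (.seq (writeRegs faceRegs)
      (seqs [.add 7 7 2, .add 8 8 9, .sub 6 6 1])))))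
    (Q' := fun s => s.out = 91 * G.m :: (List.finRange G.m).flatMap G.faceCode) ?_
  · refine key.mono ?_ fun s' h => h
    nlinarith
  rintro s ⟨⟨h0, h1, h2, h3, h4, h9, hm⟩, -, ho, -, h40⟩
  have ho : s.out = [] := ho
  refine Reaches.seq (Q := fun s => HasGraph G [] s ∧ AtArc G 0 s ∧ s.out = [91 * G.m] ∧
    s.reg 6 = G.m) (Reaches.flat rfl ?_) fun s1 hs1 => ?_
  · simp [Prog.exec, seqs, h0, h1, h2, h3, h4, h9, hm, HasGraph, AtArc, ho, h40]
  obtain ⟨hG, hA, ho, h6⟩ := hs1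
  have hloop := Reaches.loop_list (x := 6) (α := Fin G.m) (T := 20 * G.m + 20 + (248 + 4))
    (p := .seq labels (.seq (writeRegs faceRegs) (seqs [.add 7 7 2, .add 8 8 9, .sub 6 6 1])))
    (fun d t s => d ++ t = List.finRange G.m ∧ HasGraph G [] s ∧ AtArc G d.length s ∧
      s.out = 91 * G.m :: d.flatMap G.faceCode) ?_ (List.finRange G.m) [] s1
      ⟨rfl, hG, hA, by simpa using ho⟩ (by simpa using h6)
  · exact hloop.mono (by simp) fun s' h => by simpa using h.2.2.2
  rintro d e t s ⟨hd, hG, hA, ho⟩ h6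
  rw [← eq_length_of_append_cons hd] at hA
  refine Reaches.seq (labels_spec e hG hA) fun s' hs' => ?_
  obtain ⟨hlab, hreg, hmem, -, hout⟩ := hs'
  obtain ⟨h0, h1, h2, h3, h4, h9, hm⟩ := hG
  obtain ⟨h7, h8⟩ := hA
  have r0 := hreg 0 (by omega)
  have r1 := hreg 1 (by omega)
  have r2 := hreg 2 (by omega)
  have r3 := hreg 3 (by omega)
  have r4 := hreg 4 (by omega)
  have r6 := hreg 6 (by omega)
  have r7 := hreg 7 (by omega)
  have r8 := hreg 8 (by omega)
  have r9 := hreg 9 (by omega)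
  have hcost : (writeRegs faceRegs).cost = 248 := by
    rw [cost_writeRegs, show faceRegs.length = 247 by decide +kernel]
  rw [← hcost]
  refine Reaches.seq (Q := fun s'' => s'' = (writeRegs faceRegs).exec s')
    (Reaches.flat (flat_writeRegs _) rfl) fun s'' hs'' => ?_
  rw [exec_writeRegs, map_faceRegs (r1.trans h1) (r2.trans h2) (r3.trans h3) hlab] at hs''
  subst hs''
  refine Reaches.flat rfl ?_
  have hlen := eq_length_of_append_cons hd
  have hd' : (d ++ [e]) ++ t = List.finRange G.m := by rw [← hd]; simp
  simp [Prog.exec, seqs, HasGraph, AtArc, hd', r0, r1, r2, r3, r4, r6, r7, r8, r9, h0, h1, h2, h3,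
    h4, h6, h7, h8, h9, hmem, hm, hout, ho]
  omega

theorem isCode_complex (G : DegThreeOrientedGraph) :
    G.complex.IsCode (91 * G.m :: (List.finRange G.m).flatMap G.faceCode) := by
  refine ⟨(List.finRange G.m).flatMap fun e => dunceFaceLists.map fun vs => vs.map (G.gluing e),
    ?_, fun σ => ?_, ?_⟩
  · intro vs hvs
    obtain ⟨e, -, hvs⟩ := List.mem_flatMap.1 hvs
    obtain ⟨us, hus, rfl⟩ := List.mem_map.1 hvs
    exact (nodup_of_mem_dunceFaceLists us hus).map (gluing_injective e)
  · have hmap : ∀ (e : Fin G.m) (vs : List DunceVertex),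
        (vs.map (G.gluing e)).toFinset = G.glued e vs.toFinset := fun e vs => by
      ext; simp [glued]
    rw [mem_complex]
    constructor
    · rintro ⟨e, ρ, hρ, rfl⟩
      obtain ⟨vs, hvs, rfl⟩ := mem_dunceFaces_iff.1 hρ
      exact ⟨vs.map (G.gluing e), List.mem_flatMap.2 ⟨e, List.mem_finRange e,
        List.mem_map.2 ⟨vs, hvs, rfl⟩⟩, hmap e vs⟩
    · rintro ⟨us, hus, rfl⟩
      obtain ⟨e, -, hus⟩ := List.mem_flatMap.1 hus
      obtain ⟨vs, hvs, rfl⟩ := List.mem_map.1 hus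
      exact ⟨e, _, mem_dunceFaces_iff.2 ⟨vs, hvs, rfl⟩, (hmap e vs).symm⟩
  · have hlen : dunceFaceLists.length = 91 := rfl
    rw [List.length_flatMap, List.flatMap_assoc]
    congr 1
    simp [hlen, mul_comm]

theorem length_le_size (l : List ℕ) : l.length ≤ RAM.size l := by
  induction l with
  | nil => simp
  | cons x l ih =>
    simp only [RAM.size, List.map_cons, List.sum_cons, List.length_cons] at *
    omega

theorem length_code (G : DegThreeOrientedGraph) : G.code.length = 2 * G.m + 2 := by
  rw [← length_arcList]; rfl

theorem polyTime_complex :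
    RAM.PolyTime OMAS3.instCode fun G => MaxMM.instCode (DegThreeOrientedGraph.complex G) := by
  refine ⟨complexProg, Polynomial.C 400 * (Polynomial.X + 1) ^ 2,
    fun (G : DegThreeOrientedGraph) l hl => ?_⟩
  obtain rfl : l = G.code := hl
  obtain ⟨t, s, hr, ht, hout⟩ := complexProg_spec G
  refine ⟨t, s, hr, ht.trans ?_, ?_⟩
  · have h1 := length_le_size (G.code)
    rw [length_code] at h1
    simp only [Polynomial.eval_mul, Polynomial.eval_C, Polynomial.eval_pow, Polynomial.eval_add,
      Polynomial.eval_X, Polynomial.eval_one]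
    gcongr
    omega
  · rw [hout]
    exact isCode_complex G

end DegThreeOrientedGraph

/-! ### Computing the subgraph of a matching -/

namespace DegThreeOrientedGraph

open RAM RAM.Prog

variable {G : DegThreeOrientedGraph}

/-- The code of a pair of a matching. -/
def pairCode (q : List ℕ × List ℕ) : List ℕ :=
  FiniteComplex.simplexCode q.1 ++ FiniteComplex.simplexCode q.2

/-- The vertices of the upper face of a pair; the last vertex of an edge is repeated. -/
def upperTriple (q : List ℕ × List ℕ) : ℕ × ℕ × ℕ :=
  (q.2.getD 0 0, q.2.getD 1 0, q.2.getD 2 (q.2.getD 1 0))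

/-- The memory contents for a list of triples. -/
def tripleCode (Tr : List (ℕ × ℕ × ℕ)) : List ℕ := Tr.flatMap fun q => [q.1, q.2.1, q.2.2]

theorem length_tripleCode (Tr : List (ℕ × ℕ × ℕ)) : (tripleCode Tr).length = 3 * Tr.length := by
  simp [tripleCode, mul_comm]

/-- The lengths of the two lists are those of a vertex and an edge, or of an edge and a triangle, as
far as the program depends on it. -/
def IsPairOfLists (q : List ℕ × List ℕ) : Prop :=
  (q.1.length = 1 ∨ q.1.length = 2) ∧ (q.2.length = 2 ∨ q.2.length = 3)

/-- Reads a pair of a matching and appends the triple of its upper face to the memory. -/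
def readPair : Prog :=
  seqs [.read 23, .read 24, .sub 23 23 1, .ite 23 (.read 24) .skip, .read 23, .read 24,
    .store 5 24, .add 5 5 1, .read 24, .store 5 24, .add 5 5 1, .sub 23 23 2,
    .ite 23 (.read 24) .skip, .store 5 24, .add 5 5 1, .sub 6 6 1]

/-- Reads a matching; register 35 receives the number of pairs, register 36 the address of the
first triple. -/
def readMatching : Prog :=
  .seq (seqs [.read 6, .const 22 0, .add 35 6 22, .add 36 5 22]) (.loop 6 readPair)

theorem readMatching_spec {L : List (List ℕ × List ℕ)} (hL : ∀ q ∈ L, IsPairOfLists q) {s : State}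
    (hG : HasGraph G [] s) (h5 : s.reg 5 = 2 * G.m) (hinp : s.inp = L.length :: L.flatMap pairCode) :
    Reaches readMatching s (22 * L.length + 6) fun s' =>
      HasGraph G (tripleCode (L.map upperTriple)) s' ∧ s'.reg 35 = L.length ∧
      s'.reg 36 = 2 * G.m ∧ s'.reg 5 = 2 * G.m + 3 * L.length ∧ s'.out = s.out := by
  obtain ⟨h0, h1, h2, h3, h4, h9, hm⟩ := hG
  refine (Reaches.seq (Q := fun s' => HasGraph G [] s' ∧ s'.reg 35 = L.length ∧
    s'.reg 36 = 2 * G.m ∧ s'.reg 5 = 2 * G.m ∧ s'.inp = L.flatMap pairCode ∧ s'.out = s.out ∧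
    s'.reg 6 = L.length) (Reaches.flat rfl ?_) fun s1 hs1 => ?_).mono
    (T := 5 + (L.length * (21 + 1) + 1)) (by omega) fun s' h => h
  · simp [Prog.exec, seqs, HasGraph, hinp, h0, h1, h2, h3, h4, h9, hm, h5]
  obtain ⟨hG, h35, h36, h5, hi, ho, h6⟩ := hs1
  have hloop := Reaches.loop_list (x := 6) (p := readPair) (T := 21)
    (fun (d t : List (List ℕ × List ℕ)) s' => HasGraph G (tripleCode (d.map upperTriple)) s' ∧
      s'.reg 35 = L.length ∧ s'.reg 36 = 2 * G.m ∧ s'.reg 5 = 2 * G.m + 3 * d.length ∧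
      s'.inp = t.flatMap pairCode ∧ s'.out = s.out ∧ ∀ q ∈ t, IsPairOfLists q) ?_ L [] s1
      ⟨hG, h35, h36, by simpa using h5, hi, ho, hL⟩ h6
  · refine hloop.mono le_rfl fun s' h => ?_
    obtain ⟨hG, h35, h36, h5, -, ho, -⟩ := h
    exact ⟨hG, h35, h36, h5, ho⟩
  rintro d ⟨σ, τ⟩ t s' ⟨⟨h0, h1, h2, h3, h4, h9, hm⟩, h35, h36, h5, hi, ho, hv⟩ h6
  have hq : IsPairOfLists (σ, τ) := hv _ (by simp)
  have hv' : ∀ q ∈ t, IsPairOfLists q := fun q hq => hv q (by simp [hq])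
  have hupd : ∀ x y z, Function.update (Function.update (Function.update s'.mem
      (2 * G.m + 3 * d.length) x) (2 * G.m + 3 * d.length + 1) y)
      (2 * G.m + 3 * d.length + 1 + 1) z =
      ofList (G.arcList ++ tripleCode (d.map upperTriple ++ [(x, y, z)])) := by
    intro x y z
    have hlen : 2 * G.m + 3 * d.length = (G.arcList ++ tripleCode (d.map upperTriple)).length := by
      rw [List.length_append, length_arcList, length_tripleCode, List.length_map]
    rw [hlen, hm, update_ofList]
    have e1 := update_ofList ((G.arcList ++ tripleCode (d.map upperTriple)) ++ [x]) y
    have e2 := update_ofList (((G.arcList ++ tripleCode (d.map upperTriple)) ++ [x]) ++ [y]) z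
    simp only [List.length_append, List.length_singleton] at e1 e2 ⊢
    rw [e1, e2]
    simp [tripleCode]
  refine Reaches.flat (p := readPair) rfl ?_
  obtain ⟨hσ, hτ⟩ := hq
  have hσ' : (∃ a, σ = [a]) ∨ ∃ a b, σ = [a, b] :=
    hσ.imp List.length_eq_one_iff.1 List.length_eq_two.1
  have hτ' : (∃ x y, τ = [x, y]) ∨ ∃ x y z, τ = [x, y, z] :=
    hτ.imp List.length_eq_two.1 List.length_eq_three.1
  rcases hσ' with ⟨a, rfl⟩ | ⟨a, b, rfl⟩ <;> rcases hτ' with ⟨x, y, rfl⟩ | ⟨x, y, z, rfl⟩ <;>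
    simp [Prog.exec, seqs, readPair, HasGraph, hi, h0, h1, h2, h3, h4, h9, h5, h6, h35, h36, ho,
      pairCode, FiniteComplex.simplexCode, hupd, upperTriple] <;>
    exact ⟨by ring, fun a b hab => hv' _ hab⟩

/-- A number is an entry of a triple. -/
def Hits (q : ℕ × ℕ × ℕ) (v : ℕ) : Prop := v = q.1 ∨ v = q.2.1 ∨ v = q.2.2

instance (q : ℕ × ℕ × ℕ) (v : ℕ) : Decidable (Hits q v) := by unfold Hits; infer_instance

/-- Clears register 31 unless the content of register `p` is in one of the registers 28, 29, 30. -/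
def memTest (p : ℕ) : Prog :=
  seqs [.sub 32 28 p, .sub 33 p 28, .add 32 32 33, .ite 32
    (seqs [.sub 32 29 p, .sub 33 p 29, .add 32 32 33, .ite 32
      (seqs [.sub 32 30 p, .sub 33 p 30, .add 32 32 33, .ite 32 (.const 31 0) .skip]) .skip]) .skip]

theorem memTest_reg {p : ℕ} (hp : p < 25) (s : State) :
    ((memTest p).exec s).reg 31 =
      if Hits (s.reg 28, s.reg 29, s.reg 30) (s.reg p) then s.reg 31 else 0 := by
  have h1 : p ≠ 32 := by omega
  have h2 : p ≠ 33 := by omega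
  simp only [memTest, seqs, Prog.exec, State.set_reg, h1, h2, Hits]
  by_cases e1 : s.reg p = s.reg 28
  · simp [e1]
  by_cases e2 : s.reg p = s.reg 29
  · have d1 : ¬ (s.reg 28 - s.reg 29 = 0 ∧ s.reg 29 - s.reg 28 = 0) := by omega
    simp [d1, e2]
  by_cases e3 : s.reg p = s.reg 30
  · have d1 : ¬ (s.reg 28 - s.reg 30 = 0 ∧ s.reg 30 - s.reg 28 = 0) := by omega
    have d2 : ¬ (s.reg 29 - s.reg 30 = 0 ∧ s.reg 30 - s.reg 29 = 0) := by omega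
    simp [d1, d2, e3, h1, h2]
  have d1 : ¬ (s.reg 28 - s.reg p = 0 ∧ s.reg p - s.reg 28 = 0) := by omega
  have d2 : ¬ (s.reg 29 - s.reg p = 0 ∧ s.reg p - s.reg 29 = 0) := by omega
  have d3 : ¬ (s.reg 30 - s.reg p = 0 ∧ s.reg p - s.reg 30 = 0) := by omega
  simp [d1, d2, d3, e1, e2, e3, h1, h2]

theorem memTest_frame (p : ℕ) (s : State) : (∀ r, r ≠ 31 → r ≠ 32 → r ≠ 33 →
    ((memTest p).exec s).reg r = s.reg r) ∧ ((memTest p).exec s).mem = s.mem := by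
  obtain ⟨t, hr, -⟩ := exists_run_exec (p := memTest p) rfl s
  refine ⟨fun r h1 h2 h3 => hr.reg_eq ?_, (hr.quiet rfl).1⟩
  simp [memTest, seqs, targets, h1, h2, h3]

/-- The membership tests for three registers. -/
def memTests (p q r : ℕ) : Prog := .seq (memTest p) (.seq (memTest q) (memTest r))

theorem memTests_spec {p q r : ℕ} (hp : p < 25) (hq : q < 25) (hr : r < 25) (s : State) :
    Reaches (memTests p q r) s 60 fun s' =>
      (s'.reg 31 = if Hits (s.reg 28, s.reg 29, s.reg 30) (s.reg p) ∧
        Hits (s.reg 28, s.reg 29, s.reg 30) (s.reg q) ∧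
        Hits (s.reg 28, s.reg 29, s.reg 30) (s.reg r) then s.reg 31 else 0) ∧
      (∀ x, x ≠ 31 → x ≠ 32 → x ≠ 33 → s'.reg x = s.reg x) ∧ s'.mem = s.mem := by
  have hf := fun p s => (memTest_frame p s).1
  have hm := fun p s => (memTest_frame p s).2
  refine (Reaches.flat (p := memTests p q r) rfl ?_).mono
    (show 19 + (19 + 19) ≤ 60 by norm_num) fun s' h => h
  simp only [memTests, Prog.exec]
  refine ⟨?_, fun x h1 h2 h3 => ?_, ?_⟩
  · rw [memTest_reg hr, memTest_reg hq, memTest_reg hp]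
    rw [hf q _ 28 (by norm_num) (by norm_num) (by norm_num),
      hf q _ 29 (by norm_num) (by norm_num) (by norm_num),
      hf q _ 30 (by norm_num) (by norm_num) (by norm_num),
      hf p _ 28 (by norm_num) (by norm_num) (by norm_num),
      hf p _ 29 (by norm_num) (by norm_num) (by norm_num),
      hf p _ 30 (by norm_num) (by norm_num) (by norm_num),
      hf q _ r (by omega) (by omega) (by omega), hf p _ r (by omega) (by omega) (by omega),
      hf p _ q (by omega) (by omega) (by omega)]
    split_ifs <;> simp_all
  · rw [hf r _ x h1 h2 h3, hf q _ x h1 h2 h3, hf p _ x h1 h2 h3]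
  · rw [hm, hm, hm]

/-- The body of `searchTriple`. -/
def searchBody (p q r : ℕ) : Prog :=
  .seq (seqs [.load 28 26, .add 26 26 1, .load 29 26, .add 26 26 1, .load 30 26, .add 26 26 1,
    .const 31 1]) (.seq (memTests p q r) (seqs [.ite 31 (.const 25 1) .skip, .sub 27 27 1]))

/-- Clears register 34 unless one of the triples in the memory has the contents of the registers
`p`, `q` and `r` among its entries. -/
def searchTriple (p q r : ℕ) : Prog :=
  .seq (seqs [.const 25 0, .const 32 0, .add 26 36 32, .add 27 35 32])
    (.seq (.loop 27 (searchBody p q r)) (.ite 25 .skip (.const 34 0)))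

/-- The memory holds the arcs of the graph and a list of triples, whose number and address are in
the registers 35 and 36. -/
def HasTriples (G : DegThreeOrientedGraph) (Tr : List (ℕ × ℕ × ℕ)) (l : List ℕ) (s : State) :
    Prop :=
  HasGraph G (tripleCode Tr ++ l) s ∧ s.reg 35 = Tr.length ∧ s.reg 36 = 2 * G.m

theorem targets_searchTriple (p q r : ℕ) : ∀ x ∈ (searchTriple p q r).targets, 25 ≤ x ∧ x < 35 := by
  simp [searchTriple, searchBody, memTests, memTest, seqs, targets]

theorem searchTriple_spec {Tr : List (ℕ × ℕ × ℕ)} {l : List ℕ} {p q r : ℕ} (hp : p < 25)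
    (hq : q < 25) (hr : r < 25) {s : State} (hs : HasTriples G Tr l s) :
    Reaches (searchTriple p q r) s (80 * Tr.length + 20) fun s' =>
      s'.reg 34 = if ∃ u ∈ Tr, Hits u (s.reg p) ∧ Hits u (s.reg q) ∧ Hits u (s.reg r)
        then s.reg 34 else 0 := by
  obtain ⟨⟨-, h1, -, -, -, -, hm⟩, h35, h36⟩ := hs
  refine (Reaches.seq (Q := fun s' => (s'.reg 1 = 1 ∧ s'.mem = s.mem ∧ s'.reg p = s.reg p ∧
      s'.reg q = s.reg q ∧ s'.reg r = s.reg r ∧ s'.reg 34 = s.reg 34) ∧ s'.reg 25 = 0 ∧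
      s'.reg 26 = 2 * G.m ∧ s'.reg 27 = Tr.length) (T := 5)
    (T' := (Tr.length * (73 + 1) + 1) + 3) (Reaches.flat rfl ?_) fun s1 hs1 => ?_).mono (by omega)
    fun s' h => h
  · have hne : ∀ x, x < 25 → x ≠ 25 ∧ x ≠ 26 ∧ x ≠ 27 ∧ x ≠ 32 := by intro x hx; omega
    simp [Prog.exec, seqs, h1, h35, h36, hne p hp, hne q hq, hne r hr]
  obtain ⟨hc, h25, h26, h27⟩ := hs1
  have hloop := Reaches.loop_list (x := 27) (p := searchBody p q r) (T := 73)
    (fun (d t : List (ℕ × ℕ × ℕ)) s' => d ++ t = Tr ∧ (s'.reg 1 = 1 ∧ s'.mem = s.mem ∧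
      s'.reg p = s.reg p ∧ s'.reg q = s.reg q ∧ s'.reg r = s.reg r ∧ s'.reg 34 = s.reg 34) ∧
      s'.reg 26 = 2 * G.m + 3 * d.length ∧ (s'.reg 25 ≠ 0 ↔
        ∃ u ∈ d, Hits u (s.reg p) ∧ Hits u (s.reg q) ∧ Hits u (s.reg r))) ?_ Tr [] s1
      ⟨rfl, hc, by simpa using h26, by simp [h25]⟩ h27
  · refine Reaches.seq hloop fun s2 hs2 => Reaches.flat (p := .ite 25 .skip (.const 34 0)) rfl ?_
    obtain ⟨-, ⟨-, -, -, -, -, h34⟩, -, h25⟩ := hs2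
    rw [List.nil_append] at h25
    by_cases h : s2.reg 25 = 0
    · rw [if_neg (fun hh => h25.2 hh h)]
      simp [Prog.exec, h]
    · rw [if_pos (h25.1 h)]
      simp [Prog.exec, h, h34]
  rintro d ⟨x, y, z⟩ t s' ⟨hd, ⟨h1, hm', hp', hq', hr', h34⟩, h26, h25⟩ h27
  have hmem : s'.mem (2 * G.m + 3 * d.length) = x ∧ s'.mem (2 * G.m + 3 * d.length + 1) = y ∧
      s'.mem (2 * G.m + 3 * d.length + 1 + 1) = z := by
    have hlen : 2 * G.m + 3 * d.length = (G.arcList ++ tripleCode d).length := by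
      rw [List.length_append, length_arcList, length_tripleCode]
    have hl : G.arcList ++ (tripleCode Tr ++ l) =
        (G.arcList ++ tripleCode d) ++ (x :: y :: z :: (tripleCode t ++ l)) := by
      rw [← hd]; simp [tripleCode]
    rw [hm', hm, hl, hlen]
    refine ⟨?_, ?_, ?_⟩
    · exact ofList_append_right _ _ 0
    · exact ofList_append_right _ _ 1
    · exact ofList_append_right _ _ 2
  have hd' : (d ++ [(x, y, z)]) ++ t = Tr := by rw [← hd]; simp
  refine Reaches.seq (T := 8) (T' := 60 + 5) (Q := fun s2 => (s2.reg 1 = 1 ∧ s2.mem = s.mem ∧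
      s2.reg p = s.reg p ∧ s2.reg q = s.reg q ∧ s2.reg r = s.reg r ∧ s2.reg 34 = s.reg 34) ∧
      s2.reg 26 = 2 * G.m + 3 * d.length + 1 + 1 + 1 ∧ s2.reg 25 = s'.reg 25 ∧
      s2.reg 27 = t.length + 1 ∧ s2.reg 28 = x ∧ s2.reg 29 = y ∧ s2.reg 30 = z ∧ s2.reg 31 = 1)
    (Reaches.flat rfl ?_) fun s2 hs2 => ?_
  · have hne : ∀ x, x < 25 → x ≠ 26 ∧ x ≠ 28 ∧ x ≠ 29 ∧ x ≠ 30 ∧ x ≠ 31 := by intro x hx; omega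
    simp [Prog.exec, seqs, hne p hp, hne q hq, hne r hr, h1, h26, h27, hmem, hm', hp', hq', hr',
      h34]
  obtain ⟨⟨h1, hm2, hp2, hq2, hr2, h34⟩, h26, h25', h27, h28, h29, h30, h31⟩ := hs2
  refine Reaches.seq (memTests_spec hp hq hr s2) fun s3 hs3 => Reaches.flat (p := seqs [
    .ite 31 (.const 25 1) .skip, .sub 27 27 1]) rfl ?_
  obtain ⟨hs31, hf, hm3⟩ := hs3
  rw [h28, h29, h30, h31, hp2, hq2, hr2] at hs31
  have f1 := hf 1 (by norm_num) (by norm_num) (by norm_num)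
  have f25 := hf 25 (by norm_num) (by norm_num) (by norm_num)
  have f26 := hf 26 (by norm_num) (by norm_num) (by norm_num)
  have f27 := hf 27 (by norm_num) (by norm_num) (by norm_num)
  have f34 := hf 34 (by norm_num) (by norm_num) (by norm_num)
  have fp := hf p (by omega) (by omega) (by omega)
  have fq := hf q (by omega) (by omega) (by omega)
  have fr := hf r (by omega) (by omega) (by omega)
  have hne : ∀ x, x < 25 → x ≠ 25 ∧ x ≠ 27 := by intro x hx; omega
  rw [← h25', ← f25] at h25
  split_ifs at hs31 with hh
  · simp [Prog.exec, seqs, hs31, hne p hp, hne q hq, hne r hr, f1, f26, f27, f34, fp, fq, fr, hm3,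
      h1, hm2, hp2, hq2, hr2, h34, h26, h27, hd, hh]
    ring
  · have hex : (∃ u ∈ d ++ [(x, y, z)], Hits u (s.reg p) ∧ Hits u (s.reg q) ∧ Hits u (s.reg r)) ↔
        s3.reg 25 ≠ 0 := by
      rw [h25]
      constructor
      · rintro ⟨u, hu, hu'⟩
        rcases List.mem_append.1 hu with hu | hu
        · exact ⟨u, hu, hu'⟩
        · exact absurd (List.mem_singleton.1 hu ▸ hu') hh
      · rintro ⟨u, hu, hu'⟩
        exact ⟨u, List.mem_append_left _ hu, hu'⟩
    rw [hex]
    simp [Prog.exec, seqs, hs31, hne p hp, hne q hq, hne r hr, f1, f26, f27, f34, fp, fq, fr, hm3,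
      h1, hm2, hp2, hq2, hr2, h34, h26, h27, hd]
    ring

/-- Clears register 34 unless each of the triangles in the list `Q`, in the current copy, is
contained in one of the triples in the memory. -/
def searchAll (Q : List (DunceVertex × DunceVertex × DunceVertex)) : Prog :=
  seqs (Q.map fun τ => searchTriple (labelReg τ.1) (labelReg τ.2.1) (labelReg τ.2.2))

theorem quiet_searchAll (Q : List (DunceVertex × DunceVertex × DunceVertex)) :
    (searchAll Q).Quiet = true := by
  induction Q with
  | nil => rfl
  | cons τ Q ih => exact ih

theorem targets_searchAll (Q : List (DunceVertex × DunceVertex × DunceVertex)) :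
    ∀ x ∈ (searchAll Q).targets, 25 ≤ x ∧ x < 35 := by
  induction Q with
  | nil => simp [searchAll, seqs, targets]
  | cons τ Q ih =>
    intro x hx
    rcases List.mem_append.1 (show x ∈ (searchTriple (labelReg τ.1) (labelReg τ.2.1)
      (labelReg τ.2.2)).targets ++ (searchAll Q).targets from hx) with hx | hx
    · exact targets_searchTriple _ _ _ x hx
    · exact ih x hx

theorem labelReg_lt (x : DunceVertex) : labelReg x < 25 := by cases x <;> decide

theorem HasTriples.of_frame {Tr : List (ℕ × ℕ × ℕ)} {l : List ℕ} {s s' : State}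
    (hs : HasTriples G Tr l s) (hreg : ∀ r, r < 10 ∨ 35 ≤ r → s'.reg r = s.reg r)
    (hmem : s'.mem = s.mem) : HasTriples G Tr l s' := by
  obtain ⟨⟨h0, h1, h2, h3, h4, h9, hm⟩, h35, h36⟩ := hs
  exact ⟨⟨(hreg 0 (by omega)).trans h0, (hreg 1 (by omega)).trans h1, (hreg 2 (by omega)).trans h2,
    (hreg 3 (by omega)).trans h3, (hreg 4 (by omega)).trans h4, (hreg 9 (by omega)).trans h9,
    hmem.trans hm⟩, (hreg 35 (by omega)).trans h35, (hreg 36 (by omega)).trans h36⟩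

theorem searchAll_spec {Tr : List (ℕ × ℕ × ℕ)} {l : List ℕ}
    (Q : List (DunceVertex × DunceVertex × DunceVertex)) {s : State} (hs : HasTriples G Tr l s) :
    Reaches (searchAll Q) s (Q.length * (80 * Tr.length + 20) + 1) fun s' =>
      s'.reg 34 = if ∀ τ ∈ Q, ∃ u ∈ Tr, Hits u (s.reg (labelReg τ.1)) ∧
        Hits u (s.reg (labelReg τ.2.1)) ∧ Hits u (s.reg (labelReg τ.2.2)) then s.reg 34 else 0 := by
  induction Q generalizing s with
  | nil => exact ⟨1, s, .skip s, by simp, by simp⟩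
  | cons τ Q ih =>
    refine (Reaches.seq (((searchTriple_spec (labelReg_lt τ.1) (labelReg_lt τ.2.1)
      (labelReg_lt τ.2.2) hs).frame).quiet rfl) fun s' hs' => ?_).mono
      (T := (80 * Tr.length + 20) + (Q.length * (80 * Tr.length + 20) + 1))
      (by rw [List.length_cons]; ring_nf; rfl) fun s' h => h
    obtain ⟨⟨h34, hreg⟩, hm, -, -⟩ := hs'
    have hreg : ∀ r, r < 25 ∨ 35 ≤ r → s'.reg r = s.reg r := fun r hr => hreg r fun hmem => by
      have := targets_searchTriple _ _ _ r hmem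
      omega
    have hlab : ∀ x, s'.reg (labelReg x) = s.reg (labelReg x) := fun x =>
      hreg _ (Or.inl (labelReg_lt x))
    refine (ih (hs.of_frame (fun r hr => hreg r (by omega)) hm)).mono le_rfl fun s'' h => ?_
    simp only [hlab] at h
    rw [h, h34]
    simp only [List.forall_mem_cons]
    split_ifs <;> simp_all

/-- Each triangle of the copy at `e` is contained in one of the triples. -/
def AllHit (G : DegThreeOrientedGraph) (Tr : List (ℕ × ℕ × ℕ)) (e : Fin G.m) : Prop :=
  ∀ τ ∈ dunceTriples, ∃ u ∈ Tr, Hits u (G.gluing e τ.1) ∧ Hits u (G.gluing e τ.2.1) ∧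
    Hits u (G.gluing e τ.2.2)

instance (Tr : List (ℕ × ℕ × ℕ)) (e : Fin G.m) : Decidable (G.AllHit Tr e) := by
  unfold AllHit; infer_instance

/-- Examines the current arc: its number, which is in register 39, is appended to the memory if all
triangles of its copy are found there. -/
def arcBody : Prog :=
  .seq labels (.seq (.const 34 1) (.seq (searchAll dunceTriples) (seqs [
    .ite 34 (seqs [.store 5 39, .add 5 5 1, .add 37 37 1]) .skip,
    .add 7 7 2, .add 8 8 9, .add 39 39 1, .sub 6 6 1])))

/-- The state before an arc is examined, where `d` is the list of the arcs examined before. -/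
def ArcInv (G : DegThreeOrientedGraph) (Tr : List (ℕ × ℕ × ℕ)) (d : List (Fin G.m)) (s : State) :
    Prop :=
  HasTriples G Tr ((d.filter fun e => G.AllHit Tr e).map Fin.val) s ∧ AtArc G d.length s ∧
    s.reg 5 = 2 * G.m + 3 * Tr.length + (d.filter fun e => G.AllHit Tr e).length ∧
    s.reg 37 = (d.filter fun e => G.AllHit Tr e).length ∧
    s.reg 38 = 2 * G.m + 3 * Tr.length ∧ s.reg 39 = d.length ∧ s.out = []

theorem arcBody_spec {Tr : List (ℕ × ℕ × ℕ)} {d t : List (Fin G.m)} {e : Fin G.m} {s : State}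
    (hd : d ++ e :: t = List.finRange G.m) (hs : ArcInv G Tr d s) (h6 : s.reg 6 = t.length + 1) :
    Reaches arcBody s (20 * G.m + 1040 * Tr.length + 300) fun s' =>
      ArcInv G Tr (d ++ [e]) s' ∧ s'.reg 6 = t.length := by
  obtain ⟨hT, hA, h5, h37, h38, h39, ho⟩ := hs
  have hlen := eq_length_of_append_cons hd
  rw [← hlen] at hA
  refine (Reaches.seq (T' := 1 + ((13 * (80 * Tr.length + 20) + 1) + 11))
    (labels_spec e hT.1 hA) fun s1 hs1 => ?_).mono (by omega) fun s' h => h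
  obtain ⟨hlab1, hreg1, hmem1, -, hout1⟩ := hs1
  have hT1 := hT.of_frame (fun r hr => hreg1 r (by omega)) hmem1
  refine Reaches.seq (Q := fun s2 => s2 = s1.set 34 1) (Reaches.flat (p := .const 34 1) rfl rfl)
    fun s2 hs2 => ?_
  have hreg2 : ∀ r, r ≠ 34 → s2.reg r = s1.reg r := fun r hr => by rw [hs2]; simp [hr]
  have h34 : s2.reg 34 = 1 := by rw [hs2]; simp
  have hmem2 : s2.mem = s1.mem := by rw [hs2]; rfl
  have hout2 : s2.out = s1.out := by rw [hs2]; rfl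
  have hT2 := hT1.of_frame (fun r hr => hreg2 r (by omega)) hmem2
  refine Reaches.seq (((searchAll_spec dunceTriples hT2).frame).quiet (quiet_searchAll _))
    fun s3 hs3 => Reaches.flat (p := seqs [
      .ite 34 (seqs [.store 5 39, .add 5 5 1, .add 37 37 1]) .skip,
      .add 7 7 2, .add 8 8 9, .add 39 39 1, .sub 6 6 1]) rfl ?_
  obtain ⟨⟨hs34, hreg3⟩, hmem3, -, hout3⟩ := hs3
  have hlab2 : ∀ x, s2.reg (labelReg x) = G.gluing e x := fun x => by
    rw [hreg2 _ (by have := labelReg_lt x; omega), hlab1]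
  have hs34 : s3.reg 34 = if G.AllHit Tr e then 1 else 0 := by
    rw [hs34, h34]
    simp only [hlab2]
    rfl
  have hreg : ∀ r, r < 10 ∨ 35 ≤ r → s3.reg r = s.reg r := fun r hr => by
    rw [hreg3 r fun hmem => by have := targets_searchAll _ r hmem; omega, hreg2 r (by omega),
      hreg1 r (by omega)]
  obtain ⟨⟨h0, h1, h2, h3, h4, h9, hm⟩, h35, h36⟩ := hT
  obtain ⟨h7, h8⟩ := hA
  have r0 := hreg 0 (by omega)
  have r1 := hreg 1 (by omega)
  have r2 := hreg 2 (by omega)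
  have r3 := hreg 3 (by omega)
  have r4 := hreg 4 (by omega)
  have r5 := hreg 5 (by omega)
  have r6 := hreg 6 (by omega)
  have r7 := hreg 7 (by omega)
  have r8 := hreg 8 (by omega)
  have r9 := hreg 9 (by omega)
  have r35 := hreg 35 (by omega)
  have r36 := hreg 36 (by omega)
  have r37 := hreg 37 (by omega)
  have r38 := hreg 38 (by omega)
  have r39 := hreg 39 (by omega)
  have hmem : s3.mem = s.mem := hmem3.trans (hmem2.trans hmem1)
  have hout : s3.out = s.out := hout3.trans (hout2.trans hout1)
  by_cases hg : G.AllHit Tr e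
  · rw [if_pos hg] at hs34
    have hupd : Function.update s.mem (2 * G.m + 3 * Tr.length +
        (d.filter fun e => G.AllHit Tr e).length) d.length = ofList (G.arcList ++ (tripleCode Tr ++
          ((d.filter fun e => G.AllHit Tr e).map Fin.val ++ [d.length]))) := by
      have h := update_ofList (G.arcList ++ (tripleCode Tr ++
          (d.filter fun e => G.AllHit Tr e).map Fin.val)) d.length
      simp only [List.length_append, length_arcList, length_tripleCode, List.length_map] at h
      rw [hm, Nat.add_assoc, h]
      simp
    simp [ArcInv, HasTriples, HasGraph, AtArc, Prog.exec, seqs, hg, hs34, r0, r1, r2, r3, r4, r5,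
      r6, r7, r8, r9, r35, r36, r37, r38, r39, h0, h1, h2, h3, h4, h5, h6, h7, h8, h9, h35, h36,
      h37, h38, h39, hmem, hout, ho, hupd, hlen]
    omega
  · rw [if_neg hg] at hs34
    simp [ArcInv, HasTriples, HasGraph, AtArc, Prog.exec, seqs, hg, hs34, r0, r1, r2, r3, r4, r5,
      r6, r7, r8, r9, r35, r36, r37, r38, r39, h0, h1, h2, h3, h4, h5, h6, h7, h8, h9, h35, h36,
      h37, h38, h39, hmem, hout, ho, hm, hlen]
    omega

/-- Turns a code of a graph and a Morse matching into a code of the subgraph of the matching. -/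
def matchingProg : Prog :=
  .seq (.read 21) (.seq readGraph (.seq readMatching (.seq (seqs [.const 22 0, .const 7 0,
    .add 8 0 22, .const 37 0, .add 38 5 22, .const 39 0, .add 6 4 22]) (.seq (.loop 6 arcBody)
      (.seq (.write 37) (.loop 37 (seqs [.load 21 38, .write 21, .add 38 38 1, .sub 37 37 1])))))))

/-- The first number `k` of the input, the length of the code of the graph, is skipped. -/
theorem matchingProg_spec (G : DegThreeOrientedGraph) {L : List (List ℕ × List ℕ)}
    (hL : ∀ q ∈ L, IsPairOfLists q) (k : ℕ) :
    Reaches matchingProg (init (k :: (G.code ++ (L.length :: L.flatMap pairCode))))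
      (3000 * (G.m + L.length + 1) ^ 2) fun s => s.out =
        ((List.finRange G.m).filter fun e => G.AllHit (L.map upperTriple) e).length ::
        ((List.finRange G.m).filter fun e => G.AllHit (L.map upperTriple) e).map Fin.val := by
  set Tr := L.map upperTriple with hTr
  have hTrl : Tr.length = L.length := by simp [hTr]
  set A := (List.finRange G.m).filter fun e => G.AllHit Tr e with hA
  have hAl : A.length ≤ G.m := (List.length_filter_le _ _).trans (by simp)
  refine (Reaches.seq (T := 1) (T' := (20 * G.m + 20) + ((22 * L.length + 6) + (8 +
    ((G.m * ((20 * G.m + 1040 * L.length + 300) + 1) + 1) + (1 + (A.length * (5 + 1) + 1))))))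
    (Q := fun s => s.inp = G.code ++ (L.length :: L.flatMap pairCode) ∧ s.mem = ofList [] ∧
      s.out = []) (Reaches.flat rfl ?_) fun s1 hs1 => ?_).mono ?_ fun s' h => h
  · refine ⟨by simp [Prog.exec, init], ?_, by simp [Prog.exec, init]⟩
    ext i
    simp [Prog.exec, init, ofList]
  · obtain ⟨hinp, hmem, hout⟩ := hs1
    refine Reaches.seq (readGraph_spec G hinp hmem) fun s2 hs2 => ?_
    obtain ⟨hG, hinp, hout2, h5, -⟩ := hs2
    rw [hout] at hout2
    refine Reaches.seq (readMatching_spec hL hG h5 hinp) fun s3 hs3 => ?_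
    obtain ⟨⟨h0, h1, h2, h3, h4, h9, hm⟩, h35, h36, h5, hout3⟩ := hs3
    rw [hout2] at hout3
    refine Reaches.seq (Q := fun s4 => ArcInv G Tr [] s4 ∧ s4.reg 6 = G.m) (Reaches.flat rfl ?_)
      fun s4 hs4 => ?_
    · simp [ArcInv, HasTriples, HasGraph, AtArc, Prog.exec, seqs, h0, h1, h2, h3, h4, h9, hm, h35,
        h36, h5, hout3, hTrl, ← hTr]
    have hloop := Reaches.loop_list (x := 6) (p := arcBody)
      (T := 20 * G.m + 1040 * L.length + 300)
      (fun (d t : List (Fin G.m)) s => d ++ t = List.finRange G.m ∧ ArcInv G Tr d s)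
      (fun d e t s hs h6 => by
        refine (arcBody_spec hs.1 hs.2 h6).mono (by rw [hTrl]) fun s' h => ?_
        exact ⟨⟨by rw [← hs.1]; simp, h.1⟩, h.2⟩)
      (List.finRange G.m) [] s4 ⟨rfl, hs4.1⟩ (by simpa using hs4.2)
    refine Reaches.seq (hloop.mono (by simp) fun s' h => h.2) fun s5 hs5 => ?_
    rw [List.nil_append] at hs5
    obtain ⟨⟨⟨-, h1, -, -, -, -, hm⟩, -⟩, -, -, h37, h38, -, hout⟩ := hs5
    refine Reaches.seq (Q := fun s6 => s6.reg 1 = 1 ∧ s6.mem = s5.mem ∧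
      s6.reg 38 = 2 * G.m + 3 * Tr.length ∧ s6.out = [A.length] ∧ s6.reg 37 = A.length)
      (Reaches.flat (p := .write 37) rfl ?_) fun s6 hs6 => ?_
    · simp [Prog.exec, h1, h37, h38, hout, hA]
    obtain ⟨h1, hm6, h38, hout, h37⟩ := hs6
    have hloop := Reaches.loop_list (x := 37) (T := 5)
      (p := seqs [.load 21 38, .write 21, .add 38 38 1, .sub 37 37 1])
      (fun (d t : List (Fin G.m)) s => d ++ t = A ∧ s.reg 1 = 1 ∧ s.mem = s5.mem ∧
        s.reg 38 = 2 * G.m + 3 * Tr.length + d.length ∧ s.out = A.length :: d.map Fin.val) ?_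
      A [] s6 ⟨rfl, h1, hm6, by simpa using h38, by simpa using hout⟩ h37
    · exact hloop.mono le_rfl fun s' h => by simpa using h.2.2.2.2
    rintro d e t s ⟨hd, h1, hm', h38, hout⟩ h37
    have he : s.mem (2 * G.m + 3 * Tr.length + d.length) = e := by
      have hl : G.arcList ++ (tripleCode Tr ++ A.map Fin.val) =
          (G.arcList ++ (tripleCode Tr ++ d.map Fin.val)) ++ ((e : ℕ) :: t.map Fin.val) := by
        rw [← hd]; simp
      have hlen : 2 * G.m + 3 * Tr.length + d.length =
          (G.arcList ++ (tripleCode Tr ++ d.map Fin.val)).length + 0 := by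
        simp only [List.length_append, length_arcList, length_tripleCode, List.length_map]
        omega
      rw [hm', hm, ← hA, hl, hlen, ofList_append_right]
      rfl
    have hd' : (d ++ [e]) ++ t = A := by rw [← hd]; simp
    refine Reaches.flat rfl ?_
    simp [Prog.exec, seqs, h1, hm', h38, hout, h37, ← hd]
    refine ⟨by ring, ?_⟩
    rw [← hm', he]
  · nlinarith [Nat.zero_le G.m, Nat.zero_le L.length]

theorem upperTriple_hits {q : List ℕ × List ℕ} (hq : IsPairOfLists q) {v : ℕ} :
    Hits (upperTriple q) v ↔ v ∈ q.2 := by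
  obtain ⟨σ, τ⟩ := q
  have hτ : (∃ x y, τ = [x, y]) ∨ ∃ x y z, τ = [x, y, z] :=
    hq.2.imp List.length_eq_two.1 List.length_eq_three.1
  rcases hτ with ⟨x, y, rfl⟩ | ⟨x, y, z, rfl⟩ <;> simp [Hits, upperTriple]

section Matching

variable {M : Finset (G.complex.Face × G.complex.Face)} {L : List (List ℕ × List ℕ)}

theorem isPairOfLists_of_code (hM : G.complex.IsMorseMatching M)
    (hnd : ∀ q ∈ L, q.1.Nodup ∧ q.2.Nodup)
    (hL : ∀ σ τ : Finset ℕ, (∃ p ∈ M, p.1.1 = σ ∧ p.2.1 = τ) ↔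
      ∃ q ∈ L, q.1.toFinset = σ ∧ q.2.toFinset = τ) : ∀ q ∈ L, IsPairOfLists q := by
  intro q hq
  obtain ⟨p, hp, h1, h2⟩ := (hL _ _).2 ⟨q, hq, rfl, rfl⟩
  have c1 := List.toFinset_card_of_nodup (hnd q hq).1
  have c2 := List.toFinset_card_of_nodup (hnd q hq).2
  have h3 := hM.card_snd hp
  have h4 := card_le_three p.2.2
  have h5 := card_pos.2 (FiniteComplex.face_nonempty p.1)
  rw [← h1] at c1
  rw [← h2] at c2
  constructor <;> omega

/-- As a triangle has three vertices, it is contained in a stored upper face only if it is equal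
to it. -/
theorem allHit_iff (hM : G.complex.IsMorseMatching M) (hnd : ∀ q ∈ L, q.1.Nodup ∧ q.2.Nodup)
    (hL : ∀ σ τ : Finset ℕ, (∃ p ∈ M, p.1.1 = σ ∧ p.2.1 = τ) ↔
      ∃ q ∈ L, q.1.toFinset = σ ∧ q.2.toFinset = τ) (e : Fin G.m) :
    G.AllHit (L.map upperTriple) e ↔ e ∈ G.arcsOfMatching M := by
  have hv := isPairOfLists_of_code hM hnd hL
  rw [mem_arcsOfMatching]
  constructor
  · rintro h ⟨τ, hτ⟩
    obtain ⟨x, hx, rfl⟩ := mem_dunceTriangles_iff.1 hτ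
    obtain ⟨u, hu, h1, h2, h3⟩ := h x hx
    obtain ⟨q, hq, rfl⟩ := List.mem_map.1 hu
    rw [upperTriple_hits (hv q hq)] at h1 h2 h3
    obtain ⟨p, hp, -, hp2⟩ := (hL _ _).2 ⟨q, hq, rfl, rfl⟩
    have hsub : (G.triangle e ⟨_, hτ⟩).1 ⊆ p.2.1 := by
      rw [hp2]
      simp [triangle, glued, insert_subset_iff, h1, h2, h3]
    refine FiniteComplex.mem_matched.2 ⟨p, hp, Or.inr (Subtype.ext ?_)⟩
    exact (eq_of_subset_of_card_le hsub (by
      rw [card_triangle]; exact card_le_three p.2.2)).symm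
  · intro h x hx
    have hτ := mem_dunceTriangles_iff.2 ⟨x, hx, rfl⟩
    obtain ⟨σ, hσ⟩ := exists_mem_of_triangle_matched hM (h ⟨_, hτ⟩)
    obtain ⟨q, hq, -, hq2⟩ := (hL _ _).1 ⟨_, hσ, rfl, rfl⟩
    refine ⟨_, List.mem_map_of_mem hq, ?_⟩
    simp only [upperTriple_hits (hv q hq), ← List.mem_toFinset, hq2]
    simp [triangle, glued]

end Matching

theorem polyTime_arcsOfMatching :
    RAM.PolyTime (ι := Σ G : DegThreeOrientedGraph,
      {M : Finset (G.complex.Face × G.complex.Face) // G.complex.IsMorseMatching M})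
    (fun i l => ∃ l₁ l₂, OMAS3.instCode i.1 l₁ ∧ MaxMM.solCode i.1.complex i.2.1 l₂ ∧
      l = l₁.length :: (l₁ ++ l₂))
    (fun i => OMAS3.solCode i.1 (i.1.arcsOfMatching i.2.1)) := by
  refine ⟨matchingProg, Polynomial.C 3000 * (Polynomial.X + 1) ^ 2, ?_⟩
  rintro ⟨G, M, hM⟩ l ⟨l₁, l₂, h₁, ⟨L, hnd, hL, h₂⟩, rfl⟩
  obtain rfl : l₁ = G.code := h₁
  subst h₂
  obtain ⟨t, s, hr, ht, hout⟩ :=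
    matchingProg_spec G (isPairOfLists_of_code hM hnd hL) G.code.length
  refine ⟨t, s, hr, ht.trans ?_, ?_⟩
  · have h1 := length_le_size (G.code.length :: (G.code ++ (L.length :: L.flatMap pairCode)))
    have h2 : L.length ≤ (L.flatMap pairCode).length := by
      rw [List.length_flatMap]
      calc L.length = (L.map fun _ => 1).sum := by simp
        _ ≤ _ := List.sum_le_sum fun q _ => by
          simp only [pairCode, FiniteComplex.simplexCode, List.length_append, List.length_cons]
          omega
    simp only [List.length_cons, List.length_append, length_code] at h1
    simp only [Polynomial.eval_mul, Polynomial.eval_C, Polynomial.eval_pow, Polynomial.eval_add,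
      Polynomial.eval_X, Polynomial.eval_one]
    have h3 : G.m + L.length ≤ RAM.size (G.code.length :: (G.code ++
        (L.length :: L.flatMap pairCode))) := by
      rw [length_code]; omega
    exact Nat.mul_le_mul_left _ (Nat.pow_le_pow_left (Nat.succ_le_succ h3) 2)
  · refine ⟨_, ?_, hout⟩
    ext e
    rw [List.mem_toFinset, List.mem_filter]
    simpa using allHit_iff hM hnd hL e

end DegThreeOrientedGraph

/-! ### The reduction -/

theorem mainTheorem7 (𝔽 : Type*) [Field 𝔽] :
    (∀ G : DegThreeOrientedGraph,
      (MaxMM.opt G.complex : ℤ) = (G.complex.numSimplices : ℤ) - 2 * (G.optMinFAS : ℤ)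
        - ∑ i ∈ Finset.range 3, (G.complex.betti 𝔽 i : ℤ) ∧
      MaxMM.opt G.complex ≤ 78 * OMAS3.opt G ∧
      ∀ M : Finset (G.complex.Face × G.complex.Face), G.complex.IsMorseMatching M →
        (OMAS3.opt G : ℝ) - OMAS3.value G (G.arcsOfMatching M) ≤
          1 / 2 * ((MaxMM.opt G.complex : ℝ) - MaxMM.value G.complex M)) ∧
    IsLReduction OMAS3 MaxMM (fun G => G.complex) (fun G M => G.arcsOfMatching M) 78 (1 / 2) := by
  refine ⟨fun G => ⟨G.opt_MaxMM_eq 𝔽, G.opt_MaxMM_le, fun M hM => G.opt_gap_le hM⟩, ?_⟩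
  exact
    { mu_pos := by norm_num
      nu_pos := by norm_num
      polyTime_f := DegThreeOrientedGraph.polyTime_complex
      polyTime_g := DegThreeOrientedGraph.polyTime_arcsOfMatching
      feasible_g := fun G M hM => DegThreeOrientedGraph.acyclic_arcsOfMatching hM
      opt_le := fun G => by exact_mod_cast DegThreeOrientedGraph.opt_MaxMM_le G
      gap_le := fun G M hM => DegThreeOrientedGraph.opt_gap_le hM }
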